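/- Let $q=p^{\nu}$ be a prime power, let $n\ge 1$, let $a_1,\dots,a_n,g_1,\dots,g_n\in\mathbb{F}_q^{\times}$, and for $b\in\mathbb{F}_q$ put \[ f_b(x_1,\dots,x_n)=a_1g_1^{x_1}+\cdots+a_ng_n^{x_n}-b . \] Let $s_i$ be the multiplicative order of $g_i$, and let $\boldsymbol{X}^n=X_1\times\cdots\times X_n$ with $X_i=\{0,1,\dots,s_i-1\}$. There is a deterministic classical algorithm (one program for a random access machine with logarithmic cost, i.e. every instruction is charged according to the bit lengths of the numbers it handles) and there are absolute constants $K$ and $C$ such that for all $q$, $n$, $a_i$, $g_i$ as above the following holds for all $b\in\mathbb{F}_q$ with at most $q/\log q$ exceptions. Given $p$, $\nu$, $n$, the minimal polynomial over $\mathbb{F}_p$ of a generator $\alpha$ of $\mathbb{F}_q=\mathbb{F}_p(\alpha)$, and the coordinates of $a_1,\dots,a_n,g_1,\dots,g_n,b$ with respect to the basis $1,\alpha,\dots,\alpha^{\nu-1}$, the algorithm halts in time at most \[ K\,q^{\frac{n(n+1)}{2(2n-1)}}(\log q)^{C} \] and either outputs an $\vec{x}\in\boldsymbol{X}^n$ with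 $f_b(\vec{x})=0$ or correctly reports that there is no such $\vec{x}$. Here $\log$ is the natural logarithm. -/

import Mathlib

/-! ## A deterministic random access machine with logarithmic (bit) cost -/

namespace ExpZeros

/-- Binary arithmetic operations on natural numbers (`sub` is truncated subtraction). -/
inductive Op where
  | add
  | sub
  | mul
  | div
  | mod

/-- The value of an arithmetic operation. -/
def Op.eval : Op → ℕ → ℕ → ℕ
  | .add, x, y => x + y
  | .sub, x, y => x - y
  | .mul, x, y => x * y
  | .div, x, y => x / y
  | .mod, x, y => x % y

/-- The cost of an arithmetic operation in bit operations: linear in the bit lengths for addition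
and subtraction, the product of the bit lengths (schoolbook) for multiplication and division. -/
def Op.cost : Op → ℕ → ℕ → ℕ
  | .add, x, y => 1 + x.size + y.size
  | .sub, x, y => 1 + x.size + y.size
  | .mul, x, y => (1 + x.size) * (1 + y.size)
  | .div, x, y => (1 + x.size) * (1 + y.size)
  | .mod, x, y => (1 + x.size) * (1 + y.size)

/-- Programs of the machine, in structured form. Numbers `d`, `x`, `y` are names of registers. -/
inductive Prog where
  /-- `r_d := c` -/
  | const (d c : ℕ)
  /-- `r_d := r_x o r_y` -/
  | arith (o : Op) (d x y : ℕ)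
  /-- `r_d := mem[r_x]` -/
  | load (d x : ℕ)
  /-- `mem[r_x] := r_y` -/
  | store (x y : ℕ)
  /-- first `P`, then `Q` -/
  | seq (P Q : Prog)
  /-- if `r_x ≠ 0` then `P` else `Q` -/
  | ite (x : ℕ) (P Q : Prog)
  /-- while `r_x ≠ 0` do `P` -/
  | loop (x : ℕ) (P : Prog)

/-- A configuration: the registers and the memory cells, each holding a natural number. -/
structure State where
  reg : ℕ → ℕ
  mem : ℕ → ℕ

/-- Write `v` into register `d`. -/
def State.setReg (σ : State) (d v : ℕ) : State :=
  { σ with reg := Function.update σ.reg d v }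

/-- Write `v` into the memory cell with address `k`. -/
def State.setMem (σ : State) (k v : ℕ) : State :=
  { σ with mem := Function.update σ.mem k v }

/-- `Runs P σ t τ`: started in `σ`, the program `P` halts in `τ` after time `t`. Every instruction
and every test is charged the bit lengths of the numbers (and addresses) it handles. -/
inductive Runs : Prog → State → ℕ → State → Prop
  | const (σ : State) (d c : ℕ) :
      Runs (.const d c) σ (1 + c.size) (σ.setReg d c)
  | arith (σ : State) (o : Op) (d x y : ℕ) :
      Runs (.arith o d x y) σ (o.cost (σ.reg x) (σ.reg y))
        (σ.setReg d (o.eval (σ.reg x) (σ.reg y)))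
  | load (σ : State) (d x : ℕ) :
      Runs (.load d x) σ (1 + (σ.reg x).size + (σ.mem (σ.reg x)).size)
        (σ.setReg d (σ.mem (σ.reg x)))
  | store (σ : State) (x y : ℕ) :
      Runs (.store x y) σ (1 + (σ.reg x).size + (σ.reg y).size)
        (σ.setMem (σ.reg x) (σ.reg y))
  | seq {P Q : Prog} {σ τ ρ : State} {s t : ℕ} :
      Runs P σ s τ → Runs Q τ t ρ → Runs (.seq P Q) σ (s + t) ρ
  | ite_true {x : ℕ} {P Q : Prog} {σ τ : State} {t : ℕ} :
      σ.reg x ≠ 0 → Runs P σ t τ → Runs (.ite x P Q) σ (1 + (σ.reg x).size + t) τ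
  | ite_false {x : ℕ} {P Q : Prog} {σ τ : State} {t : ℕ} :
      σ.reg x = 0 → Runs Q σ t τ → Runs (.ite x P Q) σ (1 + t) τ
  | loop_true {x : ℕ} {P : Prog} {σ τ ρ : State} {s t : ℕ} :
      σ.reg x ≠ 0 → Runs P σ s τ → Runs (.loop x P) τ t ρ →
        Runs (.loop x P) σ (1 + (σ.reg x).size + s + t) ρ
  | loop_false {x : ℕ} {P : Prog} {σ : State} :
      σ.reg x = 0 → Runs (.loop x P) σ 1 σ

/-- The machine is deterministic: final configuration and running time are determined by the
program and the initial configuration. -/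
theorem Runs.deterministic {P : Prog} {σ τ τ' : State} {t t' : ℕ}
    (h : Runs P σ t τ) (h' : Runs P σ t' τ') : t = t' ∧ τ = τ' := by
  induction h generalizing t' τ' with
  | const | arith | load | store => cases h'; exact ⟨rfl, rfl⟩
  | seq _ _ ih₁ ih₂ =>
    cases h' with
    | seq k₁ k₂ =>
      obtain ⟨rfl, rfl⟩ := ih₁ k₁
      obtain ⟨rfl, rfl⟩ := ih₂ k₂
      exact ⟨rfl, rfl⟩
  | ite_true hx _ ih =>
    cases h' with
    | ite_true _ k => obtain ⟨rfl, rfl⟩ := ih k; exact ⟨rfl, rfl⟩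
    | ite_false hx' _ => exact absurd hx' hx
  | ite_false hx _ ih =>
    cases h' with
    | ite_true hx' _ => exact absurd hx hx'
    | ite_false _ k => obtain ⟨rfl, rfl⟩ := ih k; exact ⟨rfl, rfl⟩
  | loop_true hx _ _ ih₁ ih₂ =>
    cases h' with
    | loop_true _ k₁ k₂ =>
      obtain ⟨rfl, rfl⟩ := ih₁ k₁
      obtain ⟨rfl, rfl⟩ := ih₂ k₂
      exact ⟨rfl, rfl⟩
    | loop_false hx' => exact absurd hx' hx
  | loop_false hx =>
    cases h' with
    | loop_true hx' _ _ => exact absurd hx hx'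
    | loop_false _ => exact ⟨rfl, rfl⟩

/-- Initial configuration: the input is a list of natural numbers, stored in the memory cells
`0, 1, 2, …`; all other cells and all registers hold `0`. -/
def State.init (input : List ℕ) : State where
  reg := fun _ => 0
  mem := fun k => input.getD k 0

/-! ## The equation and its presentation to the machine -/

/-- `f_b(x_1, …, x_n) = a_1 g_1^{x_1} + ⋯ + a_n g_n^{x_n} - b`. -/
def expPoly {F : Type*} [Field F] {n : ℕ} (a g : Fin n → Fˣ) (b : F) (x : Fin n → ℕ) : F :=
  ∑ i, (a i : F) * (g i : F) ^ x i - b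

/-- The box `X_1 × ⋯ × X_n` with `X_i = {0, 1, …, s_i - 1}`, where `s_i` is the multiplicative
order of `g_i`. -/
def box {F : Type*} [Field F] {n : ℕ} (g : Fin n → Fˣ) : Set (Fin n → ℕ) :=
  {x | ∀ i, x i < orderOf (g i)}

section Input

variable {p : ℕ} {F : Type*} [Field F] [Algebra (ZMod p) F]

/-- An element of `𝔽_q = 𝔽_p(α)` is given by its coordinates with respect to
`1, α, …, α^{ν-1}`, each being a number in `{0, …, p - 1}`. -/
noncomputable def coords (B : PowerBasis (ZMod p) F) (y : F) : List ℕ :=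
  List.ofFn fun i : Fin B.dim => (B.basis.repr y i).val

/-- The input: `p`, `ν` and `n`, the non-leading coefficients of the minimal polynomial of `α`
over `𝔽_p` (it describes the field `𝔽_q`), the coordinates of `a_1, …, a_n`, of `g_1, …, g_n`
and of `b`. -/
noncomputable def inputData (B : PowerBasis (ZMod p) F) {n : ℕ} (a g : Fin n → Fˣ) (b : F) :
    List ℕ :=
  [p, B.dim, n]
    ++ (List.ofFn fun i : Fin B.dim => ((minpoly (ZMod p) B.gen).coeff i).val)
    ++ (List.ofFn fun i => coords B (a i : F)).flatten
    ++ (List.ofFn fun i => coords B (g i : F)).flatten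
    ++ coords B b

end Input

/-- The final configuration `τ` answers the question for `f_b` correctly: either register `0`
holds `1` and the memory cells `0, …, n - 1` hold a solution in the box, or register `0` holds
`0` and there is no solution in the box. -/
def Answers {F : Type*} [Field F] {n : ℕ} (a g : Fin n → Fˣ) (b : F) (τ : State) : Prop :=
  (τ.reg 0 = 1 ∧ (fun i : Fin n => τ.mem i) ∈ box g ∧
      expPoly a g b (fun i : Fin n => τ.mem i) = 0) ∨
    (τ.reg 0 = 0 ∧ ∀ x ∈ box g, expPoly a g b x ≠ 0)

/-- On the input describing `𝔽_q`, `a`, `g` and `b`, the program `P` halts within time `T` with a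
correct answer. -/
def SolvesWithin {p : ℕ} {F : Type*} [Field F] [Algebra (ZMod p) F] (P : Prog)
    (B : PowerBasis (ZMod p) F) {n : ℕ} (a g : Fin n → Fˣ) (b : F) (T : ℝ) : Prop :=
  ∃ (t : ℕ) (τ : State),
    Runs P (State.init (inputData B a g b)) t τ ∧ (t : ℝ) ≤ T ∧ Answers a g b τ

end ExpZeros

/-! The program adds two dummy terms with coefficient 0, so that three terms always exist, and
orders the terms so that `s₁ ≥ s₂ ≥ s₃` are the three largest orders. A table with one cell per
field element records the values of the first term. A search runs over the exponents of the third
term (outer loop) and the second term (inner loop), and finds the first exponent by one table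
lookup. All other exponents are first frozen at 0.

Character sums show that this restricted search succeeds early for most `b` when the orders are
large. For a coset of a multiplicative subgroup, every nontrivial Fourier coefficient has modulus at
most `√q` (`norm_expSum_sq_le`). Hence two cosets of sizes `s₁`, `s₂` and a set of size `h` have a
sumset that misses at most `q⁴ / (s₁² s₂² h)` elements (`card_missed_le`). If `q³ log q ≤ s₁² s₂²
s₃`, then some `h ≤ s₃`, about `q³ log q / (s₁² s₂²)`, leaves at most `q / log q` exceptional `b`;
for all others the outer loop stops within `h` rounds. If `s₁² s₂² s₃ ≤ q³ log q`, there is no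
exception: should the restricted search fail, the table is extended by all remaining terms and the
search repeated, which is exhaustive.

The costs are `h s₂` or `s₂ s₃` for searching, at most about `q^(6/5)` if `n ≥ 3` by the size
assumption and `s₁ ≥ s₂ ≥ s₃` (`div_pow_five_le`, `mul_pow_five_le`), and at most about `q` if `n ≤
2`. Extending the table by a further nontrivial term of order `s` only happens for `n ≥ 4`. It costs
about `q + s₁ s ≤ q + q^(4/3)` for `n = 4` and `q + q s ≤ q + q^(8/5)` for `n ≥ 5`, up to logarithms
(`steps_le`). These exponents do not exceed `n(n+1) / (2(2n-1))`. For `n ≥ 5` the excess of that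
exponent over `8/5` grows linearly in `n` and absorbs all powers of `n`
(`exists_pow_mul_rpow_stepExp_le`), which makes the constants absolute.

The machine side is a small program logic: `Ex` bounds the number of instructions of a run on
`w`-bit numbers, each costing at most `(1 + w)²`. Correctness and cost of the whole program are
combined in `solvesWithin_main`. -/

namespace ExpZeros

local notation:60 P:61 ";;" Q:60 => Prog.seq P Q

/-! ### Hoare-style reasoning with step counts -/

/-- Whether the program contains an instruction that writes register `r`. -/
def Prog.wr : Prog → ℕ → Bool
  | .const d _, r => d == r
  | .arith _ d _ _, r => d == r
  | .load d _, r => d == r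
  | .store _ _, _ => false
  | .seq P Q, r => P.wr r || Q.wr r
  | .ite _ P Q, r => P.wr r || Q.wr r
  | .loop _ P, r => P.wr r

/-- Whether the program contains an instruction that writes the memory. -/
def Prog.st : Prog → Bool
  | .const _ _ => false
  | .arith _ _ _ _ => false
  | .load _ _ => false
  | .store _ _ => true
  | .seq P Q => P.st || Q.st
  | .ite _ P Q => P.st || Q.st
  | .loop _ P => P.st

/-- What a run of `P` from `σ` to `τ` cannot have changed. -/
def Keep (P : Prog) (σ τ : State) : Prop :=
  (∀ r, P.wr r = false → τ.reg r = σ.reg r) ∧ (P.st = false → τ.mem = σ.mem)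

theorem Keep.reg {P : Prog} {σ τ : State} (h : Keep P σ τ) (r : ℕ) (hr : P.wr r = false) :
    τ.reg r = σ.reg r := h.1 r hr

theorem Keep.refl (P : Prog) (σ : State) : Keep P σ σ := ⟨fun _ _ => rfl, fun _ => rfl⟩

theorem Keep.trans {P : Prog} {σ τ ρ : State} (h : Keep P σ τ) (h' : Keep P τ ρ) :
    Keep P σ ρ :=
  ⟨fun r hr => (h'.1 r hr).trans (h.1 r hr), fun hs => (h'.2 hs).trans (h.2 hs)⟩

/-- The frame rule is purely syntactic: for a concrete program its side conditions are Boolean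
computations closed by `rfl`. This is how register facts are carried across subprograms below. -/
theorem Runs.keep {P : Prog} {σ τ : State} {t : ℕ} (h : Runs P σ t τ) : Keep P σ τ := by
  induction h with
  | const σ d c =>
    refine ⟨fun r hr => ?_, fun _ => rfl⟩
    have : r ≠ d := by rintro rfl; simp [Prog.wr] at hr
    simp [State.setReg, this]
  | arith σ o d x y =>
    refine ⟨fun r hr => ?_, fun _ => rfl⟩
    have : r ≠ d := by rintro rfl; simp [Prog.wr] at hr
    simp [State.setReg, this]
  | load σ d x =>
    refine ⟨fun r hr => ?_, fun _ => rfl⟩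
    have : r ≠ d := by rintro rfl; simp [Prog.wr] at hr
    simp [State.setReg, this]
  | store σ x y => exact ⟨fun r _ => rfl, fun h => by simp [Prog.st] at h⟩
  | seq _ _ ih₁ ih₂ =>
    refine ⟨fun r hr => ?_, fun hs => ?_⟩
    · simp only [Prog.wr, Bool.or_eq_false_iff] at hr
      rw [ih₂.1 r hr.2, ih₁.1 r hr.1]
    · simp only [Prog.st, Bool.or_eq_false_iff] at hs
      rw [ih₂.2 hs.2, ih₁.2 hs.1]
  | ite_true _ _ ih =>
    refine ⟨fun r hr => ?_, fun hs => ?_⟩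
    · simp only [Prog.wr, Bool.or_eq_false_iff] at hr
      exact ih.1 r hr.1
    · simp only [Prog.st, Bool.or_eq_false_iff] at hs
      exact ih.2 hs.1
  | ite_false _ _ ih =>
    refine ⟨fun r hr => ?_, fun hs => ?_⟩
    · simp only [Prog.wr, Bool.or_eq_false_iff] at hr
      exact ih.1 r hr.2
    · simp only [Prog.st, Bool.or_eq_false_iff] at hs
      exact ih.2 hs.2
  | loop_true _ _ _ ih₁ ih₂ =>
    refine ⟨fun r hr => ?_, fun hs => ?_⟩
    · rw [ih₂.1 r hr]; exact ih₁.1 r hr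
    · rw [ih₂.2 hs]; exact ih₁.2 hs
  | loop_false _ => exact ⟨fun _ _ => rfl, fun _ => rfl⟩

/-- All registers and cells hold numbers below `2 ^ w`. -/
def Bd (w : ℕ) (σ : State) : Prop := (∀ r, σ.reg r < 2 ^ w) ∧ ∀ k, σ.mem k < 2 ^ w

/-- Started in a configuration `σ` with `w`-bit entries, `P` halts after at most `k` steps, each of
cost at most `(1 + w) ^ 2`, in a configuration with `w`-bit entries satisfying `Q`. -/
def Ex (w : ℕ) (P : Prog) (σ : State) (k : ℕ) (Q : State → Prop) : Prop :=
  Bd w σ → ∃ t τ, Runs P σ t τ ∧ t ≤ k * (1 + w) ^ 2 ∧ Bd w τ ∧ Q τ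

variable {w : ℕ} {P P' : Prog} {σ : State} {k k' : ℕ} {Q R : State → Prop}

theorem Bd.reg_size (h : Bd w σ) (r : ℕ) : (σ.reg r).size ≤ w := Nat.size_le.2 (h.1 r)

theorem Bd.mem_size (h : Bd w σ) (r : ℕ) : (σ.mem r).size ≤ w := Nat.size_le.2 (h.2 r)

theorem Bd.setReg (h : Bd w σ) {d v : ℕ} (hv : v < 2 ^ w) : Bd w (σ.setReg d v) := by
  refine ⟨fun r => ?_, h.2⟩
  by_cases hr : r = d
  · subst hr; simpa [State.setReg] using hv
  · simpa [State.setReg, hr] using h.1 r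

theorem Bd.setMem (h : Bd w σ) {d v : ℕ} (hv : v < 2 ^ w) : Bd w (σ.setMem d v) := by
  refine ⟨h.1, fun r => ?_⟩
  by_cases hr : r = d
  · subst hr; simpa [State.setMem] using hv
  · simpa [State.setMem, hr] using h.2 r

theorem Ex.call (h : Ex w P σ k R) (hk : k ≤ k') (hQ : ∀ τ, Keep P σ τ → R τ → Q τ) :
    Ex w P σ k' Q := fun hb => by
  obtain ⟨t, τ, h1, h2, h3, h4⟩ := h hb
  exact ⟨t, τ, h1, h2.trans (Nat.mul_le_mul_right _ hk), h3, hQ τ h1.keep h4⟩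

theorem Ex.mono (h : Ex w P σ k Q) (hk : k ≤ k') : Ex w P σ k' Q :=
  h.call hk fun _ _ h => h

theorem Ex.seq (h : Ex w P σ k R) (h' : ∀ τ, Keep P σ τ → R τ → Ex w P' τ k' Q) :
    Ex w (P ;; P') σ (k + k') Q := fun hb => by
  obtain ⟨t, τ, h1, h2, h3, h4⟩ := h hb
  obtain ⟨t', τ', h1', h2', h3', h4'⟩ := h' τ h1.keep h4 h3
  exact ⟨t + t', τ', h1.seq h1', by rw [add_mul]; omega, h3', h4'⟩

theorem Ex.ite {x : ℕ} (h : σ.reg x ≠ 0 → Ex w P σ k Q) (h' : σ.reg x = 0 → Ex w P' σ k Q) :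
    Ex w (.ite x P P') σ (k + 1) Q := fun hb => by
  have hx := hb.reg_size x
  by_cases h0 : σ.reg x = 0
  · obtain ⟨t, τ, h1, h2, h3, h4⟩ := h' h0 hb
    refine ⟨_, τ, .ite_false h0 h1, ?_, h3, h4⟩
    nlinarith
  · obtain ⟨t, τ, h1, h2, h3, h4⟩ := h h0 hb
    refine ⟨_, τ, .ite_true h0 h1, ?_, h3, h4⟩
    nlinarith

@[simp] theorem State.setReg_reg (σ : State) (d v r : ℕ) :
    (σ.setReg d v).reg r = if r = d then v else σ.reg r := by
  simp [State.setReg, Function.update_apply]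

@[simp] theorem State.setReg_mem (σ : State) (d v : ℕ) : (σ.setReg d v).mem = σ.mem := rfl

@[simp] theorem State.setMem_reg (σ : State) (d v : ℕ) : (σ.setMem d v).reg = σ.reg := rfl

theorem State.setMem_mem (σ : State) (d v : ℕ) :
    (σ.setMem d v).mem = Function.update σ.mem d v := rfl

/-- `r_d := r_x`; register `90` holds `0`. -/
def mov (d x : ℕ) : Prog := .arith .sub d x 90

/-- The effect of straight-line code. -/
def Prog.exec : Prog → State → State
  | .const d c, σ => σ.setReg d c
  | .arith o d x y, σ => σ.setReg d (o.eval (σ.reg x) (σ.reg y))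
  | .load d x, σ => σ.setReg d (σ.mem (σ.reg x))
  | .store x y, σ => σ.setMem (σ.reg x) (σ.reg y)
  | .seq P Q, σ => Q.exec (P.exec σ)
  | .ite _ _ _, σ => σ
  | .loop _ _, σ => σ

/-- The program is straight-line code that, when started in `σ`, produces only numbers below
`2 ^ w`, if the numbers in `σ` are. -/
def Prog.ok (w : ℕ) : Prog → State → Prop
  | .const _ c, _ => c < 2 ^ w
  | .arith .add _ x y, σ => σ.reg x + σ.reg y < 2 ^ w
  | .arith .mul _ x y, σ => σ.reg x * σ.reg y < 2 ^ w
  | .arith _ _ _ _, _ => True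
  | .load _ _, _ => True
  | .store _ _, _ => True
  | .seq P Q, σ => P.ok w σ ∧ Q.ok w (P.exec σ)
  | .ite _ _ _, _ => False
  | .loop _ _, _ => False

attribute [simp] Prog.exec Prog.ok Op.eval mov

theorem Prog.keep_exec (P : Prog) (σ : State) : Keep P σ (P.exec σ) := by
  induction P generalizing σ with
  | const d c =>
    exact ⟨fun r hr => by simp [Prog.wr] at hr; simp [Ne.symm hr], fun _ => rfl⟩
  | arith o d x y =>
    exact ⟨fun r hr => by simp [Prog.wr] at hr; simp [Ne.symm hr], fun _ => rfl⟩
  | load d x =>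
    exact ⟨fun r hr => by simp [Prog.wr] at hr; simp [Ne.symm hr], fun _ => rfl⟩
  | store x y => exact ⟨fun r _ => rfl, fun h => by simp [Prog.st] at h⟩
  | seq P Q ih₁ ih₂ =>
    refine ⟨fun r hr => ?_, fun hs => ?_⟩
    · simp only [Prog.wr, Bool.or_eq_false_iff] at hr
      rw [Prog.exec, (ih₂ _).1 r hr.2, (ih₁ _).1 r hr.1]
    · simp only [Prog.st, Bool.or_eq_false_iff] at hs
      rw [Prog.exec, (ih₂ _).2 hs.2, (ih₁ _).2 hs.1]
  | ite => exact Keep.refl _ _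
  | loop => exact Keep.refl _ _

/-- The number of instructions of straight-line code. -/
def Prog.len : Prog → ℕ
  | .seq P Q => P.len + Q.len
  | _ => 1

/-- Reduces straight-line code to evaluating `exec` with `simp`. Only constants, sums and products
can overflow; the other instructions never produce a number larger than one already present. -/
theorem Ex.straight (h : P.ok w σ) (hQ : Q (P.exec σ)) : Ex w P σ P.len Q := by
  induction P generalizing σ Q with
  | const d c =>
    intro hb
    refine ⟨_, _, .const σ d c, ?_, hb.setReg h, hQ⟩
    have : c.size ≤ w := Nat.size_le.2 h
    simp only [Prog.len]; nlinarith
  | arith o d x y =>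
    intro hb
    have h1 := hb.reg_size x
    have h2 := hb.reg_size y
    have h3 := hb.1 x
    have h4 : (1 + (σ.reg x).size) * (1 + (σ.reg y).size) ≤ (1 + w) * (1 + w) := by gcongr
    refine ⟨_, _, .arith σ o d x y, ?_, hb.setReg ?_, hQ⟩
    · cases o <;> simp only [Prog.len, Op.cost] <;> nlinarith
    · cases o with
      | add => exact h
      | sub => exact lt_of_le_of_lt (Nat.sub_le _ _) h3
      | mul => exact h
      | div => exact lt_of_le_of_lt (Nat.div_le_self _ _) h3
      | mod => exact lt_of_le_of_lt (Nat.mod_le _ _) h3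
  | load d x =>
    intro hb
    refine ⟨_, _, .load σ d x, ?_, hb.setReg (hb.2 _), hQ⟩
    have h1 := hb.reg_size x
    have h2 := hb.mem_size (σ.reg x)
    simp only [Prog.len]; nlinarith
  | store x y =>
    intro hb
    refine ⟨_, _, .store σ x y, ?_, hb.setMem (hb.1 _), hQ⟩
    have h1 := hb.reg_size x
    have h2 := hb.reg_size y
    simp only [Prog.len]; nlinarith
  | seq P Q ih₁ ih₂ =>
    exact (ih₁ (Q := fun τ => τ = P.exec σ) h.1 rfl).seq fun τ _ hτ => by
      subst hτ; exact ih₂ h.2 hQ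
  | ite => exact h.elim
  | loop => exact h.elim

/-- Rule for loops that stop early: `N - i` is the value of the loop register after `i` rounds, and
the first round with a hit sets it to `0`. -/
theorem Ex.loop_search {c : ℕ} {body : Prog} {N kb h : ℕ} (hit : ℕ → Prop) (I : ℕ → State → Prop)
    (D : State → Prop) (hI : I 0 σ) (hc : σ.reg c = N)
    (step : ∀ i < N, ∀ σ', Keep body σ σ' → I i σ' → σ'.reg c = N - i →
      Ex w body σ' kb fun τ => (hit i ∧ τ.reg c = 0 ∧ D τ) ∨
        (¬ hit i ∧ τ.reg c = N - (i + 1) ∧ I (i + 1) τ))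
    (hh : N ≤ h ∨ ∃ i < h, i < N ∧ hit i) :
    Ex w (.loop c body) σ (h * (kb + 1) + 1) fun τ =>
      ((∃ i < N, hit i) ∧ D τ) ∨ ((∀ i < N, ¬ hit i) ∧ I N τ) := by
  -- Induction on the number `j` of rounds still possible, with `h` generalized: each round without
  -- a hit uses up one of the `h` rounds and brings the promised hit one round closer.
  suffices H : ∀ j ≤ N, ∀ σ' h, Keep body σ σ' → I (N - j) σ' → σ'.reg c = j →
      (∀ i < N - j, ¬ hit i) → (j ≤ h ∨ ∃ i < h, N - j + i < N ∧ hit (N - j + i)) →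
      Ex w (.loop c body) σ' (h * (kb + 1) + 1) fun τ =>
      ((∃ i < N, hit i) ∧ D τ) ∨ ((∀ i < N, ¬ hit i) ∧ I N τ) by
    refine H N le_rfl σ h (Keep.refl _ _) (by simpa using hI) hc (by simp) ?_
    simpa using hh
  intro j
  induction j with
  | zero =>
    intro _ σ' h _ hI hc hno _ hb
    refine ⟨1, σ', .loop_false hc, ?_, hb, .inr ⟨by simpa using hno, by simpa using hI⟩⟩
    exact Nat.succ_le_of_lt (by positivity)
  | succ j ih =>
    intro hj σ' h hkp hI hc hno hh hb
    obtain ⟨t, τ, h1, h2, h3, h4⟩ := step (N - (j + 1)) (by omega) σ' hkp hI (by omega) hb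
    have hx := hb.reg_size c
    have hc0 : σ'.reg c ≠ 0 := by omega
    have hh1 : 1 ≤ h := by
      rcases hh with hh | ⟨i, hi, _⟩ <;> omega
    obtain ⟨h, rfl⟩ : ∃ h', h = h' + 1 := ⟨h - 1, by omega⟩
    rcases h4 with ⟨hhit, hτ, hD⟩ | ⟨hnhit, hτ, hI'⟩
    · refine ⟨_, τ, .loop_true hc0 h1 (.loop_false hτ), ?_, h3,
        .inl ⟨⟨_, by omega, hhit⟩, hD⟩⟩
      nlinarith [Nat.zero_le (h * (kb + 1) * (1 + w) ^ 2)]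
    · have e : N - (j + 1) + 1 = N - j := by omega
      rw [e] at hI' hτ
      obtain ⟨t', τ', h1', h2', h3', h4'⟩ := ih (by omega) τ h (hkp.trans h1.keep) hI'
        (by omega)
        (fun i hi => by
          rcases (by omega : i < N - (j + 1) ∨ i = N - (j + 1)) with hi | rfl
          · exact hno i hi
          · exact hnhit)
        (by
          rcases hh with hh | ⟨i, hi, hiN, hhi⟩
          · left; omega
          · right
            rcases Nat.eq_zero_or_pos i with rfl | hi0
            · exact absurd hhi hnhit
            · refine ⟨i - 1, by omega, by omega, ?_⟩
              rwa [show N - j + (i - 1) = N - (j + 1) + i by omega]) h3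
      refine ⟨_, τ', .loop_true hc0 h1 h1', ?_, h3', h4'⟩
      nlinarith

/-- Rule for loops that run a known number of times. -/
theorem Ex.loop {c : ℕ} {body : Prog} {N : ℕ} {kb : ℕ → ℕ} (I : ℕ → State → Prop)
    (hI : I 0 σ) (hc : ∀ i ≤ N, ∀ σ', I i σ' → (σ'.reg c = 0 ↔ i = N))
    (step : ∀ i < N, ∀ σ', Keep body σ σ' → I i σ' → Ex w body σ' (kb i) (I (i + 1))) :
    Ex w (.loop c body) σ (∑ i ∈ Finset.range N, (kb i + 1) + 1) (I N) := by
  suffices H : ∀ j ≤ N, ∀ σ', Keep body σ σ' → I (N - j) σ' →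
      Ex w (.loop c body) σ' (∑ i ∈ Finset.Ico (N - j) N, (kb i + 1) + 1) (I N) by
    have := H N le_rfl σ (Keep.refl _ _) (by simpa using hI)
    simpa using this
  intro j
  induction j with
  | zero =>
    intro _ σ' _ hI hb
    simp only [Nat.sub_zero] at hI
    refine ⟨1, σ', .loop_false ((hc N le_rfl σ' hI).2 rfl), ?_, hb, hI⟩
    exact Nat.succ_le_of_lt (by positivity)
  | succ j ih =>
    intro hj σ' hkp hI hb
    obtain ⟨t, τ, h1, h2, h3, h4⟩ := step (N - (j + 1)) (by omega) σ' hkp hI hb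
    have e : N - (j + 1) + 1 = N - j := by omega
    rw [e] at h4
    obtain ⟨t', τ', h1', h2', h3', h4'⟩ := ih (by omega) τ (hkp.trans h1.keep) h4 h3
    have hc0 : σ'.reg c ≠ 0 := fun h0 => by
      have := (hc _ (by omega) σ' hI).1 h0
      omega
    have hx := hb.reg_size c
    refine ⟨_, τ', .loop_true hc0 h1 h1', ?_, h3', h4'⟩
    rw [Finset.sum_eq_sum_Ico_succ_bot (by omega), e]
    nlinarith

/-- `body` is repeated as often as register `c` says; register `91` holds `1`. -/
def rep (c : ℕ) (body : Prog) : Prog := .loop c (body ;; .arith .sub c c 91)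

/-- The cost of a round may depend on its number. Table extension needs this, because only rounds
that meet a nonzero entry are expensive. The invariant is required after the decrement of the
counter. -/
theorem Ex.rep_sum {c : ℕ} {body : Prog} {N : ℕ} {kb : ℕ → ℕ} (I : ℕ → State → Prop)
    (hI : I 0 σ) (hN : σ.reg c = N) (h1 : σ.reg 91 = 1)
    (hwc : body.wr c = false) (hw1 : (rep c body).wr 91 = false)
    (step : ∀ i < N, ∀ σ', Keep (rep c body) σ σ' → I i σ' → σ'.reg c = N - i →
      Ex w body σ' (kb i) fun τ => I (i + 1) (τ.setReg c (N - (i + 1)))) :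
    Ex w (rep c body) σ (∑ i ∈ Finset.range N, (kb i + 2) + 1) (I N) := by
  have := Ex.loop (w := w) (c := c) (body := body ;; .arith .sub c c 91) (σ := σ) (N := N)
    (kb := fun i => kb i + 1) (fun i τ => I i τ ∧ τ.reg c = N - i) ⟨hI, by simpa using hN⟩
    (fun i hi σ' h => by rw [h.2]; omega) (fun i hi σ' hkp hI => by
      have hkp' : Keep (rep c body) σ σ' := hkp
      refine (step i hi σ' hkp' hI.1 hI.2).seq (k' := 1) fun τ hk hτ => ?_
      have e1 : τ.reg 91 = 1 := by
        rw [hk.reg 91 (by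
          simp only [rep, Prog.wr, Bool.or_eq_false_iff] at hw1; exact hw1.1),
          hkp'.reg 91 hw1, h1]
      have e2 : τ.reg c = N - i := by rw [hk.reg c hwc, hI.2]
      refine Ex.straight (P := .arith .sub c c 91) trivial ?_
      simp only [Prog.exec, Op.eval, e1, e2, Nat.sub_sub]
      exact ⟨hτ, by simp [State.setReg]⟩)
  exact this.call le_rfl fun τ _ h => h.1

theorem Ex.rep {c : ℕ} {body : Prog} {N kb : ℕ} (I : ℕ → State → Prop)
    (hI : I 0 σ) (hN : σ.reg c = N) (h1 : σ.reg 91 = 1)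
    (hwc : body.wr c = false) (hw1 : (rep c body).wr 91 = false)
    (step : ∀ i < N, ∀ σ', Keep (ExpZeros.rep c body) σ σ' → I i σ' → σ'.reg c = N - i →
      Ex w body σ' kb fun τ => I (i + 1) (τ.setReg c (N - (i + 1)))) :
    Ex w (ExpZeros.rep c body) σ (N * (kb + 2) + 1) (I N) := by
  simpa using Ex.rep_sum (kb := fun _ => kb) I hI hN h1 hwc hw1 step

/-! ### Field elements as numbers -/

theorem sum_digits_lt {p : ℕ} (hp : 0 < p) (d : ℕ → ℕ) (hd : ∀ i, d i < p) (k : ℕ) :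
    ∑ i ∈ Finset.range k, d i * p ^ i < p ^ k := by
  induction k with
  | zero => simp
  | succ k ih =>
    rw [Finset.sum_range_succ, pow_succ]
    have := hd k
    nlinarith [Nat.mul_le_mul_right (p ^ k) (Nat.succ_le_of_lt this), pow_pos hp k]

theorem sum_digits_split {p : ℕ} (d : ℕ → ℕ) {i k : ℕ} (hik : i ≤ k) :
    ∑ j ∈ Finset.range k, d j * p ^ j =
      ∑ j ∈ Finset.range i, d j * p ^ j
        + p ^ i * ∑ j ∈ Finset.range (k - i), d (i + j) * p ^ j := by
  obtain ⟨m, rfl⟩ := Nat.exists_eq_add_of_le hik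
  rw [Finset.sum_range_add, Nat.add_sub_cancel_left, Finset.mul_sum]
  congr 1
  refine Finset.sum_congr rfl fun j _ => ?_
  ring

theorem sum_digits_div {p : ℕ} (hp : 0 < p) (d : ℕ → ℕ) (hd : ∀ i, d i < p) {i k : ℕ}
    (hik : i ≤ k) :
    (∑ j ∈ Finset.range k, d j * p ^ j) / p ^ i
      = ∑ j ∈ Finset.range (k - i), d (i + j) * p ^ j := by
  rw [sum_digits_split d hik, Nat.add_mul_div_left _ _ (pow_pos hp i),
    Nat.div_eq_of_lt (sum_digits_lt hp d hd i), zero_add]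

theorem sum_digits_mod {p : ℕ} (hp : 0 < p) (d : ℕ → ℕ) (hd : ∀ i, d i < p) {i k : ℕ}
    (hik : i ≤ k) :
    (∑ j ∈ Finset.range k, d j * p ^ j) % p ^ i = ∑ j ∈ Finset.range i, d j * p ^ j := by
  rw [sum_digits_split d hik, Nat.add_mul_mod_self_left,
    Nat.mod_eq_of_lt (sum_digits_lt hp d hd i)]

/-- Applied in two bases: base `p` for reading coordinates of field elements, and base `q` for
decoding exponent vectors in `Ex.output`. -/
theorem sum_digits_div_mod {p : ℕ} (hp : 0 < p) (d : ℕ → ℕ) (hd : ∀ i, d i < p) {i k : ℕ}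
    (hik : i < k) : (∑ j ∈ Finset.range k, d j * p ^ j) / p ^ i % p = d i := by
  rw [sum_digits_div hp d hd hik.le]
  have := sum_digits_mod hp (fun j => d (i + j)) (fun j => hd _) (i := 1) (k := k - i) (by omega)
  simpa using this

section Enc

variable {p : ℕ} {F : Type*} [Field F] [Algebra (ZMod p) F] (B : PowerBasis (ZMod p) F)

/-- The `i`-th coordinate of `y`. -/
noncomputable def dg (y : F) (i : ℕ) : ℕ :=
  if h : i < B.dim then (B.basis.repr y ⟨i, h⟩).val else 0

/-- The number whose base `p` digits are the coordinates of `y`. -/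
noncomputable def enc (y : F) : ℕ := ∑ i ∈ Finset.range B.dim, dg B y i * p ^ i

variable [hp : Fact p.Prime]

theorem dg_lt (y : F) (i : ℕ) : dg B y i < p := by
  unfold dg
  split_ifs
  · exact ZMod.val_lt _
  · exact hp.out.pos

theorem enc_lt (y : F) : enc B y < p ^ B.dim := sum_digits_lt hp.out.pos _ (dg_lt B y) _

theorem enc_div_mod (y : F) {i : ℕ} (hi : i < B.dim) : enc B y / p ^ i % p = dg B y i :=
  sum_digits_div_mod hp.out.pos _ (dg_lt B y) hi

theorem cast_dg (y : F) {i : ℕ} (hi : i < B.dim) :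
    ((dg B y i : ℕ) : ZMod p) = B.basis.repr y ⟨i, hi⟩ := by
  have : NeZero p := ⟨hp.out.ne_zero⟩
  simp [dg, hi]

theorem charP_of_algebra : CharP F p := charP_of_injective_algebraMap
  (algebraMap (ZMod p) F).injective p

theorem eq_sum_dg (y : F) : y = ∑ i ∈ Finset.range B.dim, (dg B y i : F) * B.gen ^ i := by
  conv_lhs => rw [← B.basis.sum_repr y]
  rw [Finset.sum_range]
  refine Finset.sum_congr rfl fun i _ => ?_
  rw [B.coe_basis, Algebra.smul_def, ← cast_dg B y i.2, map_natCast]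

theorem dg_sum (d : ℕ → ℕ) {i : ℕ} (hi : i < B.dim) :
    dg B (∑ j ∈ Finset.range B.dim, (d j : F) * B.gen ^ j) i = d i % p := by
  have : NeZero p := ⟨hp.out.ne_zero⟩
  have h : (∑ j ∈ Finset.range B.dim, (d j : F) * B.gen ^ j)
      = ∑ j : Fin B.dim, ((d j : ℕ) : ZMod p) • B.basis j := by
    rw [Finset.sum_range]
    refine Finset.sum_congr rfl fun j _ => ?_
    rw [B.coe_basis, Algebra.smul_def, map_natCast]
  rw [h, dg, dif_pos hi, B.basis.repr_sum_self, ZMod.val_natCast]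

theorem enc_sum (d : ℕ → ℕ) :
    enc B (∑ j ∈ Finset.range B.dim, (d j : F) * B.gen ^ j)
      = ∑ j ∈ Finset.range B.dim, d j % p * p ^ j :=
  Finset.sum_congr rfl fun i hi => by rw [dg_sum B d (Finset.mem_range.1 hi)]

theorem enc_injective : Function.Injective (enc B) := by
  intro x y h
  rw [eq_sum_dg B x, eq_sum_dg B y]
  refine Finset.sum_congr rfl fun i hi => ?_
  have hi := Finset.mem_range.1 hi
  rw [← enc_div_mod B x hi, ← enc_div_mod B y hi, h]

/-- Tables are scanned by address, so every offset below `q` has to be the code of an element. -/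
theorem enc_surj {k : ℕ} (hk : k < p ^ B.dim) : ∃ y, enc B y = k := by
  refine ⟨∑ j ∈ Finset.range B.dim, ((k / p ^ j % p : ℕ) : F) * B.gen ^ j, ?_⟩
  rw [enc_sum]
  suffices H : ∀ m, ∑ j ∈ Finset.range m, k / p ^ j % p % p * p ^ j = k % p ^ m by
    rw [H, Nat.mod_eq_of_lt hk]
  intro m
  induction m with
  | zero => simp [Nat.mod_one]
  | succ m ih =>
    rw [Finset.sum_range_succ, ih, Nat.mod_mod, pow_succ, Nat.mod_mul]
    ring

theorem enc_zero : enc B 0 = 0 := by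
  simp [enc, dg]

theorem enc_eq_zero {y : F} : enc B y = 0 ↔ y = 0 := by
  rw [← enc_zero B, (enc_injective B).eq_iff]

theorem enc_one : enc B 1 = 1 := by
  have h0 : 0 < B.dim := B.dim_pos
  have h : (1 : F) = ∑ j ∈ Finset.range B.dim, ((if j = 0 then 1 else 0 : ℕ) : F) * B.gen ^ j := by
    rw [Finset.sum_eq_single 0]
    · simp
    · intro j _ hj; simp [hj]
    · intro h; simp at h; omega
  rw [h, enc_sum, Finset.sum_eq_single 0]
  · simp [Nat.mod_eq_of_lt hp.out.one_lt]
  · intro j _ hj; simp [hj]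
  · intro h; simp at h; omega

/-- Coordinates are combined independently modulo `p`, without carries, so `axpy` can treat one
digit per round. -/
theorem enc_add_mul (x y : F) (c : ℕ) :
    enc B (x + c * y)
      = ∑ j ∈ Finset.range B.dim, (dg B x j + c * dg B y j) % p * p ^ j := by
  rw [← enc_sum]
  congr 1
  conv_lhs => rw [eq_sum_dg B x, eq_sum_dg B y, Finset.mul_sum, ← Finset.sum_add_distrib]
  refine Finset.sum_congr rfl fun j _ => ?_
  push_cast; ring

/-- The element with the coordinates of `y` except for the leading one. -/
noncomputable def low (y : F) : F :=
  ∑ j ∈ Finset.range (B.dim - 1), (dg B y j : F) * B.gen ^ j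

/-- The value of the non-leading part of the minimal polynomial at the generator. -/
noncomputable def minTail : F :=
  ∑ j ∈ Finset.range B.dim, ((((minpoly (ZMod p) B.gen).coeff j).val : ℕ) : F) * B.gen ^ j

theorem gen_pow_dim : B.gen ^ B.dim = - minTail B := by
  have : NeZero p := ⟨hp.out.ne_zero⟩
  have hi : IsIntegral (ZMod p) B.gen := B.isIntegral_gen
  have hm := minpoly.monic hi
  have h := minpoly.aeval (ZMod p) B.gen
  rw [Polynomial.aeval_eq_sum_range, B.natDegree_minpoly, Finset.sum_range_succ] at h
  have hl : (minpoly (ZMod p) B.gen).coeff B.dim = 1 := by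
    rw [← B.natDegree_minpoly]; exact hm
  rw [hl, one_smul] at h
  rw [eq_neg_iff_add_eq_zero, ← h, add_comm]
  congr 1
  refine Finset.sum_congr rfl fun j _ => ?_
  rw [Algebra.smul_def, ← map_natCast (algebraMap (ZMod p) F), ZMod.natCast_val, ZMod.cast_id]

/-- Reduction by the minimal polynomial: a leading coordinate `λ` of `y` contributes `-λ` times
`minTail`. In characteristic `p` the factor `-λ` can be written as the natural number `p - λ`, which
the machine can hold. -/
theorem gen_mul_eq (y : F) :
    B.gen * y = B.gen * low B y + ((p - dg B y (B.dim - 1) : ℕ) : F) * minTail B := by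
  have := charP_of_algebra (p := p) (F := F)
  obtain ⟨m, hm⟩ : ∃ m, B.dim = m + 1 := ⟨B.dim - 1, by have := B.dim_pos; omega⟩
  have h1 := eq_sum_dg B y
  rw [hm, Finset.sum_range_succ] at h1
  have h2 := gen_pow_dim B
  rw [Nat.cast_sub (dg_lt B y _).le, CharP.cast_eq_zero F p, low, hm, Nat.add_sub_cancel]
  conv_lhs => rw [h1]
  rw [hm] at h2
  linear_combination (dg B y m : F) * h2

/-- Without a leading coordinate, multiplication by the generator is a shift of the base `p` digits.
-/
theorem enc_gen_mul_low (y : F) :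
    enc B (B.gen * low B y) = enc B y % p ^ (B.dim - 1) * p := by
  obtain ⟨m, hm⟩ : ∃ m, B.dim = m + 1 := ⟨B.dim - 1, by have := B.dim_pos; omega⟩
  have h1 : B.gen * low B y = ∑ j ∈ Finset.range B.dim,
      ((if j = 0 then 0 else dg B y (j - 1) : ℕ) : F) * B.gen ^ j := by
    rw [hm, Finset.sum_range_succ', low, hm, Nat.add_sub_cancel, Finset.mul_sum]
    simp only [Nat.add_eq_zero_iff, one_ne_zero, and_false, if_false, if_true, Nat.cast_zero,
      zero_mul, add_zero, Nat.add_sub_cancel]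
    exact Finset.sum_congr rfl fun j _ => by ring
  rw [h1, enc_sum]
  unfold enc
  rw [sum_digits_mod hp.out.pos _ (dg_lt B y) (Nat.sub_le _ _), hm, Finset.sum_range_succ']
  simp only [Nat.add_eq_zero_iff, one_ne_zero, and_false, if_false, if_true, Nat.zero_mod,
      zero_mul, add_zero, Nat.add_sub_cancel, Finset.sum_mul]
  refine Finset.sum_congr rfl fun j _ => ?_
  rw [Nat.mod_eq_of_lt (dg_lt B y j)]; ring

theorem enc_div_pow (y : F) : enc B y / p ^ (B.dim - 1) = dg B y (B.dim - 1) := by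
  have h0 := B.dim_pos
  have h1 := enc_div_mod B y (i := B.dim - 1) (by omega)
  rw [← h1, Nat.mod_eq_of_lt]
  rw [Nat.div_lt_iff_lt_mul (pow_pos hp.out.pos _), ← pow_succ', Nat.sub_add_cancel h0]
  exact enc_lt B y

end Enc

/-! ### Programs for the field operations -/

/-- The configuration holds the constants describing the field in registers `90, …, 97`. -/
structure Cst {p : ℕ} [Fact p.Prime] {F : Type*} [Field F] [Algebra (ZMod p) F]
    (B : PowerBasis (ZMod p) F) (σ : State) : Prop where
  r90 : σ.reg 90 = 0
  r91 : σ.reg 91 = 1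
  r92 : σ.reg 92 = p
  r93 : σ.reg 93 = B.dim
  r94 : σ.reg 94 = p ^ B.dim
  r95 : σ.reg 95 = p ^ (B.dim - 1)
  r96 : σ.reg 96 = enc B (minTail B)
  r97 : σ.reg 97 = p - 1

/-- The program writes none of the registers `90, …, 97`. -/
def Prog.low (P : Prog) : Bool :=
  !(P.wr 90 || P.wr 91 || P.wr 92 || P.wr 93 || P.wr 94 || P.wr 95 || P.wr 96 || P.wr 97)

/-- `r_4 := r_1 + r_2 • r_3` for field elements in registers `1` and `3`. -/
def axpy : Prog :=
  (.const 4 0 ;; .const 5 1 ;; mov 6 93) ;;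
  rep 6 (.arith .mod 7 1 92 ;; .arith .mod 8 3 92 ;; .arith .mul 8 2 8 ;; .arith .add 7 7 8 ;;
    .arith .mod 7 7 92 ;; .arith .mul 7 7 5 ;; .arith .add 4 4 7 ;; .arith .mul 5 5 92 ;;
    .arith .div 1 1 92 ;; .arith .div 3 3 92)

/-- Multiply the field element in register `9` by the generator. -/
def mulGen : Prog :=
  (mov 3 96 ;; .arith .div 2 9 95 ;; .arith .sub 2 92 2 ;; .arith .mod 1 9 95 ;;
    .arith .mul 1 1 92) ;;
  axpy ;; mov 9 4

/-- `r_12 := r_10 * r_11` for field elements in registers `10` and `11`. -/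
def fmul : Prog :=
  (.const 12 0 ;; mov 9 10 ;; mov 13 93) ;;
  rep 13 ((mov 1 12 ;; .arith .mod 2 11 92 ;; mov 3 9) ;; axpy ;; mov 12 4 ;; mulGen ;;
    .arith .div 11 11 92)

/-- `r_4 := r_1 - r_3` for field elements in registers `1` and `3`. -/
def fsub : Prog := mov 2 97 ;; axpy

/-- `r_4 := r_1 + r_3` for field elements in registers `1` and `3`. -/
def fadd : Prog := mov 2 91 ;; axpy

section

variable {p : ℕ} [hp : Fact p.Prime] {F : Type*} [Field F] [Algebra (ZMod p) F]
  {B : PowerBasis (ZMod p) F} {w : ℕ} {σ τ : State} {P : Prog}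

theorem Cst.keep (h : Cst B σ) (hk : Keep P σ τ) (hP : P.low = true) : Cst B τ := by
  simp only [Prog.low, Bool.not_eq_true', Bool.or_eq_false_iff] at hP
  obtain ⟨⟨⟨⟨⟨⟨⟨h0, h1⟩, h2⟩, h3⟩, h4⟩, h5⟩, h6⟩, h7⟩ := hP
  exact ⟨(hk.reg _ h0).trans h.r90, (hk.reg _ h1).trans h.r91, (hk.reg _ h2).trans h.r92,
    (hk.reg _ h3).trans h.r93, (hk.reg _ h4).trans h.r94, (hk.reg _ h5).trans h.r95,
    (hk.reg _ h6).trans h.r96, (hk.reg _ h7).trans h.r97⟩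

theorem le_pow_dim (B : PowerBasis (ZMod p) F) : p ≤ p ^ B.dim := by
  simpa using Nat.pow_le_pow_right hp.out.pos B.dim_pos

theorem pow_le_pow_dim (B : PowerBasis (ZMod p) F) {i : ℕ} (hi : i ≤ B.dim) :
    p ^ i ≤ p ^ B.dim := Nat.pow_le_pow_right hp.out.pos hi

theorem Ex.axpy (hw : (p ^ B.dim) ^ 2 < 2 ^ w) (hC : Cst B σ) {x y : F} {c : ℕ}
    (hx : σ.reg 1 = enc B x) (hc : σ.reg 2 = c) (hcp : c ≤ p) (hy : σ.reg 3 = enc B y) :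
    Ex w axpy σ (12 * B.dim + 4) fun τ => τ.reg 4 = enc B (x + c * y) := by
  have hp1 : 1 < p := hp.out.one_lt
  have hq := le_pow_dim B
  have hqw : p ^ B.dim < 2 ^ w := lt_of_le_of_lt (Nat.le_self_pow two_ne_zero _) hw
  have hpw : p * p < 2 ^ w := by nlinarith
  let I : ℕ → State → Prop := fun i τ =>
    τ.reg 1 = enc B x / p ^ i ∧ τ.reg 3 = enc B y / p ^ i ∧ τ.reg 5 = p ^ i ∧
    τ.reg 4 = ∑ j ∈ Finset.range i, (dg B x j + c * dg B y j) % p * p ^ j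
  refine Ex.mono (k := 3 + (B.dim * (10 + 2) + 1)) ?_ (by omega)
  refine (Ex.straight (Q := fun τ => τ.reg 1 = enc B x ∧ τ.reg 2 = c ∧ τ.reg 3 = enc B y ∧
      τ.reg 4 = 0 ∧ τ.reg 5 = 1 ∧ τ.reg 6 = B.dim) ?_ ?_).seq ?_
  · have : w ≠ 0 := by rintro rfl; omega
    simp [this]
  · simp [hC.r90, hC.r93, hx, hy, hc]
  rintro τ hk ⟨h1, h2, h3, h4, h5, h6⟩
  have hC' := hC.keep hk rfl
  refine (Ex.rep (N := B.dim) I ?_ h6 hC'.r91 rfl rfl ?_).call le_rfl ?_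
  · simp [I, h1, h3, h4, h5]
  · rintro i hi σ' hk' ⟨i1, i3, i5, i4⟩ i6
    have hC'' := hC'.keep hk' rfl
    have i2 : σ'.reg 2 = c := (hk'.reg 2 rfl).trans h2
    have hdx := dg_lt B x i
    have hdy := dg_lt B y i
    have hm := Nat.mod_lt (dg B x i + c * dg B y i) hp.out.pos
    have hpi : p ^ i * p ≤ p ^ B.dim := by
      rw [← pow_succ]; exact pow_le_pow_dim B hi
    have hs := sum_digits_lt hp.out.pos (fun j => (dg B x j + c * dg B y j) % p)
      (fun j => Nat.mod_lt _ hp.out.pos) (i + 1)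
    rw [Finset.sum_range_succ, pow_succ] at hs
    -- The scalar may equal `p`, which occurs in `mulGen` when the leading coordinate is 0. The
    -- intermediate sum still stays below `p (p - 1) + p = p²`.
    have hcd : c * dg B y i ≤ p * (p - 1) := Nat.mul_le_mul hcp (by omega)
    have hpp : p * (p - 1) + p = p * p := by
      obtain ⟨m, rfl⟩ : ∃ m, p = m + 1 := ⟨p - 1, by omega⟩
      simp; ring
    refine Ex.straight ?_ ?_
    · simp [i1, i2, i3, i4, i5,
        hC''.r92, enc_div_mod B _ hi]
      refine ⟨by omega, by omega, ?_, ?_, ?_⟩ <;> omega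
    · simp [i1, i2, i3, i4, i5,
        hC''.r92, enc_div_mod B _ hi, I, Nat.div_div_eq_div_mul, pow_succ,
        Finset.sum_range_succ]
  · rintro τ' hk' ⟨-, -, -, h⟩
    rw [h, enc_add_mul]

theorem Ex.fsub (hw : (p ^ B.dim) ^ 2 < 2 ^ w) (hC : Cst B σ) {x y : F}
    (hx : σ.reg 1 = enc B x) (hy : σ.reg 3 = enc B y) :
    Ex w fsub σ (12 * B.dim + 5) fun τ => τ.reg 4 = enc B (x - y) := by
  refine Ex.mono (k := 1 + (12 * B.dim + 4)) ?_ (by omega)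
  refine (Ex.straight (Q := fun τ => τ.reg 1 = enc B x ∧ τ.reg 2 = p - 1 ∧ τ.reg 3 = enc B y)
    ?_ ?_).seq ?_
  · simp
  · simp [hC.r90, hC.r97, hx, hy]
  rintro τ hk ⟨h1, h2, h3⟩
  refine (Ex.axpy hw (hC.keep hk rfl) h1 h2 (Nat.sub_le _ _) h3).call le_rfl fun τ' _ h => ?_
  have := charP_of_algebra (p := p) (F := F)
  -- The scalar `p - 1` acts as `-1`.
  rw [h, Nat.cast_sub hp.out.one_lt.le, CharP.cast_eq_zero F p]
  congr 1
  push_cast; ring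

theorem Ex.fadd (hw : (p ^ B.dim) ^ 2 < 2 ^ w) (hC : Cst B σ) {x y : F}
    (hx : σ.reg 1 = enc B x) (hy : σ.reg 3 = enc B y) :
    Ex w fadd σ (12 * B.dim + 5) fun τ => τ.reg 4 = enc B (x + y) := by
  refine Ex.mono (k := 1 + (12 * B.dim + 4)) ?_ (by omega)
  refine (Ex.straight (Q := fun τ => τ.reg 1 = enc B x ∧ τ.reg 2 = 1 ∧ τ.reg 3 = enc B y)
    ?_ ?_).seq ?_
  · simp
  · simp [hC.r90, hC.r91, hx, hy]
  rintro τ hk ⟨h1, h2, h3⟩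
  refine (Ex.axpy hw (hC.keep hk rfl) h1 h2 hp.out.one_lt.le h3).call le_rfl fun τ' _ h => ?_
  rw [h]
  congr 1
  push_cast; ring

theorem Ex.mulGen (hw : (p ^ B.dim) ^ 2 < 2 ^ w) (hC : Cst B σ) {y : F}
    (hy : σ.reg 9 = enc B y) :
    Ex w mulGen σ (12 * B.dim + 10) fun τ => τ.reg 9 = enc B (B.gen * y) := by
  have hqw : p ^ B.dim < 2 ^ w := lt_of_le_of_lt (Nat.le_self_pow two_ne_zero _) hw
  refine Ex.mono (k := 5 + ((12 * B.dim + 4) + 1)) ?_ (by omega)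
  refine (Ex.straight (Q := fun τ => τ.reg 1 = enc B (B.gen * low B y) ∧
    τ.reg 2 = p - dg B y (B.dim - 1) ∧ τ.reg 3 = enc B (minTail B)) ?_ ?_).seq ?_
  · have := enc_lt B (B.gen * low B y)
    rw [enc_gen_mul_low] at this
    simp [hC.r95, hC.r92, hy]
    omega
  · simp [hC.r90, hC.r92, hC.r95,
      hC.r96, hy, enc_gen_mul_low, enc_div_pow]
  rintro τ hk ⟨h1, h2, h3⟩
  have hC' := hC.keep hk rfl
  refine (Ex.axpy hw hC' h1 h2 (Nat.sub_le _ _) h3).seq fun τ' hk' h => ?_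
  have hC'' := hC'.keep hk' rfl
  refine Ex.straight (by simp) ?_
  simp [hC''.r90, h, gen_mul_eq B y]

theorem Ex.fmul (hw : (p ^ B.dim) ^ 2 < 2 ^ w) (hC : Cst B σ) {y g : F}
    (hy : σ.reg 10 = enc B y) (hg : σ.reg 11 = enc B g) :
    Ex w fmul σ (60 * (B.dim + 1) ^ 2) fun τ => τ.reg 12 = enc B (y * g) := by
  have hqw : p ^ B.dim < 2 ^ w := lt_of_le_of_lt (Nat.le_self_pow two_ne_zero _) hw
  -- Register 9 runs through the products of `y` with powers of the generator, register 12
  -- accumulates them with the coordinates of `g` as weights, and register 11 sheds one coordinate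
  -- per round.
  let I : ℕ → State → Prop := fun i τ =>
    τ.reg 12 = enc B (∑ j ∈ Finset.range i, (dg B g j : F) * (B.gen ^ j * y)) ∧
    τ.reg 9 = enc B (B.gen ^ i * y) ∧ τ.reg 11 = enc B g / p ^ i
  refine Ex.mono (k := 3 + (B.dim * ((3 + ((12 * B.dim + 4) + (1 + ((12 * B.dim + 10) + 1)))) + 2)
    + 1)) ?_ (by nlinarith)
  refine (Ex.straight (Q := fun τ => τ.reg 12 = 0 ∧ τ.reg 9 = enc B y ∧ τ.reg 11 = enc B g ∧
    τ.reg 13 = B.dim) ?_ ?_).seq ?_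
  · simp
  · simp [hC.r90, hC.r93, hy, hg]
  rintro τ hk ⟨h12, h9, h11, h13⟩
  have hC := hC.keep hk rfl
  refine (Ex.rep (N := B.dim) I ?_ h13 hC.r91 rfl rfl ?_).call le_rfl ?_
  · simp [I, h12, h9, h11, enc_zero]
  · rintro i hi σ hk ⟨i12, i9, i11⟩ -
    have hC := hC.keep hk rfl
    refine (Ex.straight (Q := fun τ => τ.reg 1 = σ.reg 12 ∧ τ.reg 2 = dg B g i ∧
      τ.reg 3 = σ.reg 9 ∧ τ.reg 9 = σ.reg 9 ∧ τ.reg 11 = σ.reg 11) ?_ ?_).seq ?_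
    · simp
    · simp [hC.r90, hC.r92, i11,
        enc_div_mod B g hi]
    rintro τ hk ⟨h1, h2, h3, h9, h11⟩
    have hC := hC.keep hk rfl
    refine (Ex.axpy hw hC (h1.trans i12) h2 (dg_lt B g i).le (h3.trans i9)).seq fun τ hk h4 => ?_
    have hC := hC.keep hk rfl
    have h9 := (hk.reg 9 rfl).trans h9
    have h11 := (hk.reg 11 rfl).trans h11
    refine (Ex.straight (P := mov 12 4) (Q := fun τ' => τ'.reg 12 = τ.reg 4) ?_ ?_).seq
      fun τ hk h12 => ?_
    · simp
    · simp [hC.r90]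
    have hC := hC.keep hk rfl
    have h9 := (hk.reg 9 rfl).trans h9
    have h11 := (hk.reg 11 rfl).trans h11
    refine (Ex.mulGen hw hC (h9.trans i9)).seq fun τ hk h9 => ?_
    have hC := hC.keep hk rfl
    have h12 := (hk.reg 12 rfl).trans h12
    have h11 := (hk.reg 11 rfl).trans h11
    refine Ex.straight (by simp) ?_
    simp [hC.r92, I, h9, h12, h4, h11, i11,
      Finset.sum_range_succ, Nat.div_div_eq_div_mul, pow_succ]
    congr 1; ring
  · rintro τ' hk' ⟨h, -, -⟩
    rw [h]
    congr 1
    conv_rhs => rw [eq_sum_dg B g, Finset.mul_sum]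
    exact Finset.sum_congr rfl fun j _ => by ring

end

/-! ### Partial solutions and their codes -/

section Sol

variable {F : Type*} [Field F]

/-- `y` is a value of `∑_{i ∈ S} a_i g_i ^ x_i` with exponents `x_i ≤ r_i`, and `c` is the code
`∑_{i ∈ S} x_i q ^ i` of the exponents. -/
def Sol (q : ℕ) (a g : ℕ → F) (r : ℕ → ℕ) (S : Finset ℕ) (y : F) (c : ℕ) : Prop :=
  ∃ x : ℕ → ℕ, (∀ i ∈ S, x i ≤ r i) ∧ y = ∑ i ∈ S, a i * g i ^ x i ∧ c = ∑ i ∈ S, x i * q ^ i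

variable {q : ℕ} {a g : ℕ → F} {r : ℕ → ℕ} {S : Finset ℕ} {y : F} {c : ℕ}

theorem Sol.empty : Sol q a g r ∅ y c ↔ y = 0 ∧ c = 0 := by
  simp [Sol]

theorem Sol.add_index (h : Sol q a g r S y c) {j x : ℕ} (hj : j ∉ S) (hx : x ≤ r j) :
    Sol q a g r (insert j S) (y + a j * g j ^ x) (c + x * q ^ j) := by
  obtain ⟨z, h1, rfl, rfl⟩ := h
  have hne : ∀ i ∈ S, i ≠ j := fun i hi h => hj (h ▸ hi)
  refine ⟨Function.update z j x, ?_, ?_, ?_⟩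
  · intro i hi
    rcases Finset.mem_insert.1 hi with rfl | hi
    · simpa using hx
    · simpa [hne i hi] using h1 i hi
  · rw [Finset.sum_insert hj, add_comm]
    congr 1
    · simp
    · exact Finset.sum_congr rfl fun i hi => by simp [hne i hi]
  · rw [Finset.sum_insert hj, add_comm]
    congr 1
    · simp
    · exact Finset.sum_congr rfl fun i hi => by simp [hne i hi]

theorem Sol.of_insert {j : ℕ} (h : Sol q a g r (insert j S) y c) (hj : j ∉ S) :
    ∃ y' c' x, Sol q a g r S y' c' ∧ x ≤ r j ∧ y = y' + a j * g j ^ x ∧ c = c' + x * q ^ j := by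
  obtain ⟨z, h1, rfl, rfl⟩ := h
  refine ⟨_, _, z j, ⟨z, fun i hi => h1 i (Finset.mem_insert_of_mem hi), rfl, rfl⟩,
    h1 j (Finset.mem_insert_self _ _), ?_, ?_⟩ <;> rw [Finset.sum_insert hj, add_comm]

/-- A code is a base `q` number whose digits are the exponents. This bound determines the word
length. -/
theorem Sol.lt (h : Sol q a g r S y c) (hr : ∀ i, r i < q) {m : ℕ} (hS : S ⊆ Finset.range m) :
    c < q ^ m := by
  obtain ⟨x, h1, -, rfl⟩ := h
  have hq : 0 < q := (Nat.zero_le _).trans_lt (hr 0)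
  calc ∑ i ∈ S, x i * q ^ i ≤ ∑ i ∈ S, r i * q ^ i :=
        Finset.sum_le_sum fun i hi => Nat.mul_le_mul_right _ (h1 i hi)
    _ ≤ ∑ i ∈ Finset.range m, r i * q ^ i := Finset.sum_le_sum_of_subset hS
    _ < q ^ m := sum_digits_lt hq r hr m

end Sol

/-! ### Tables of attainable values -/

section Table

variable {p : ℕ} {F : Type*} [Field F] [Algebra (ZMod p) F] (B : PowerBasis (ZMod p) F)

/-- The cells from `tb` on form a table of the values of `∑_{i ∈ S} a_i g_i ^ x_i`: the entry of a
value is the successor of a code, the entry of any other element is `0`. -/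
def Tab (a g : ℕ → F) (r : ℕ → ℕ) (S : Finset ℕ) (tb : ℕ) (mem : ℕ → ℕ) : Prop :=
  (∀ y c, mem (tb + enc B y) = c + 1 → Sol (p ^ B.dim) a g r S y c) ∧
    ∀ y c, Sol (p ^ B.dim) a g r S y c → mem (tb + enc B y) ≠ 0

/-- The number of nonzero entries of a table. -/
def cnt (q tb : ℕ) (mem : ℕ → ℕ) : ℕ := ((Finset.range q).filter fun k => mem (tb + k) ≠ 0).card

theorem cnt_le (q tb : ℕ) (mem : ℕ → ℕ) : cnt q tb mem ≤ q :=
  (Finset.card_filter_le _ _).trans (by simp)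

variable {B} in
theorem Tab.congr {a g : ℕ → F} {r : ℕ → ℕ} {S : Finset ℕ} {tb : ℕ} {mem mem' : ℕ → ℕ}
    [Fact p.Prime]
    (h : Tab B a g r S tb mem) (he : ∀ k < p ^ B.dim, mem' (tb + k) = mem (tb + k)) :
    Tab B a g r S tb mem' := by
  constructor
  · intro y c hy
    rw [he _ (enc_lt B y)] at hy
    exact h.1 y c hy
  · intro y c hy
    rw [he _ (enc_lt B y)]
    exact h.2 y c hy

-- Each nonzero entry stems from an exponent vector, and different vectors may give the same value.
-- Together with the trivial bound `q` this yields the minimum in `extendCost`.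
variable {B} in
theorem Tab.cnt_le {a g : ℕ → F} {r : ℕ → ℕ} {S : Finset ℕ} {tb : ℕ} {mem : ℕ → ℕ}
    [Fact p.Prime] (h : Tab B a g r S tb mem) :
    cnt (p ^ B.dim) tb mem ≤ ∏ i ∈ S, (r i + 1) := by
  classical
  have h1 : ((Finset.range (p ^ B.dim)).filter fun k => mem (tb + k) ≠ 0) ⊆
      (Fintype.piFinset (fun i : S => Finset.range (r i + 1))).image
        (fun x => enc B (∑ i : S, a i * g i ^ x i)) := by
    intro k hk
    simp only [Finset.mem_filter, Finset.mem_range] at hk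
    obtain ⟨y, rfl⟩ := enc_surj B hk.1
    obtain ⟨c, hc⟩ := Nat.exists_eq_succ_of_ne_zero hk.2
    obtain ⟨x, hx, hy, -⟩ := h.1 y c hc
    refine Finset.mem_image.2 ⟨fun i => x i, ?_, ?_⟩
    · simp only [Fintype.mem_piFinset, Finset.mem_range]
      exact fun i => Nat.lt_succ_of_le (hx i i.2)
    · rw [hy, ← Finset.sum_coe_sort S]
  refine (Finset.card_le_card h1).trans (Finset.card_image_le.trans ?_)
  rw [Fintype.card_piFinset, ← Finset.prod_coe_sort S]
  simp

/-- The state of the memory while the table at `tb + q` is being filled: `D` is the set of those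
elements that have been entered. -/
structure Fill (mem₀ : ℕ → ℕ) (a g : ℕ → F) (r : ℕ → ℕ) (S : Finset ℕ) (tb : ℕ) (D : Set F)
    (mem : ℕ → ℕ) : Prop where
  below : ∀ k < tb, mem k = mem₀ k
  above : ∀ k, tb + p ^ B.dim ≤ k → mem k = 0
  sound : ∀ y c, mem (tb + enc B y) = c + 1 → Sol (p ^ B.dim) a g r S y c
  complete : ∀ y ∈ D, mem (tb + enc B y) ≠ 0

-- Overwriting an earlier entry for the same value is harmless: any valid code will do, since one
-- solution suffices.
variable {B} in
theorem Fill.store {mem₀ : ℕ → ℕ} {a g : ℕ → F} {r : ℕ → ℕ} {S : Finset ℕ} {tb : ℕ}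
    {D D' : Set F} {mem : ℕ → ℕ} [Fact p.Prime]
    (h : Fill B mem₀ a g r S tb D mem) {y : F} {c : ℕ}
    (hy : Sol (p ^ B.dim) a g r S y c) (hD : ∀ z ∈ D', z ≠ y → z ∈ D) :
    Fill B mem₀ a g r S tb D' (Function.update mem (tb + enc B y) (c + 1)) := by
  have hlt := enc_lt B y
  refine ⟨fun k hk => ?_, fun k hk => ?_, fun z d hz => ?_, fun z hz => ?_⟩
  · rw [Function.update_of_ne (by omega), h.below k hk]
  · rw [Function.update_of_ne (by omega), h.above k hk]
  · by_cases hzy : z = y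
    · subst hzy
      simp only [Function.update_self, Nat.add_right_cancel_iff] at hz
      exact hz ▸ hy
    · have : enc B z ≠ enc B y := fun h => hzy (enc_injective B h)
      rw [Function.update_of_ne (by omega)] at hz
      exact h.sound z d hz
  · by_cases hzy : z = y
    · subst hzy; simp
    · have : enc B z ≠ enc B y := fun h => hzy (enc_injective B h)
      rw [Function.update_of_ne (by omega)]
      exact h.complete z (hD z hz hzy)

end Table

/-! ### Orders, table extension, and search -/

/-- `r_21` becomes the order of the field element in register `20`, minus one. -/
def orderProg : Prog :=
  (.const 21 0 ;; mov 22 20 ;; .arith .sub 23 22 91) ;;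
  .loop 23 ((mov 10 22 ;; mov 11 20) ;; fmul ;;
    (mov 22 12 ;; .arith .add 21 21 91 ;; .arith .sub 23 22 91))

/-- Enter `r_30 + x r_25` as the entry of `r_27 + r_24 r_20 ^ x` for the `r_21 + 1` smallest `x`
into the table that follows the table at `r_26`. -/
def extendRow : Prog :=
  (mov 31 24 ;; .arith .add 32 21 91) ;;
  rep 32 ((mov 1 27 ;; mov 3 31) ;; fadd ;;
    (.arith .add 33 26 94 ;; .arith .add 33 33 4 ;; .store 33 30 ;; mov 10 31 ;; mov 11 20) ;;
    fmul ;; (mov 31 12 ;; .arith .add 30 30 25))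

/-- From the table at `r_26`, make the next table by adding the values `a g ^ x` with `a` in
register `24`, `g` in register `20`, and `x` at most the number in register `21`. -/
def extend : Prog :=
  (.const 27 0 ;; mov 28 94) ;;
  rep 28 ((.arith .add 29 26 27 ;; .load 30 29) ;; .ite 30 extendRow (mov 34 90) ;;
    .arith .add 27 27 91) ;;
  .arith .add 26 26 94

/-- Look for the differences of the element in register `53` and `a g ^ x`, with `a` in register
`41`, `g` in register `42`, `x` at most the number in register `43`, in the table at `r_26`. -/
def searchRow : Prog :=
  (mov 54 41 ;; mov 55 51 ;; .arith .add 56 43 91) ;;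
  .loop 56 ((mov 1 53 ;; mov 3 54) ;; fsub ;; (.arith .add 57 26 4 ;; .load 58 57) ;;
    .ite 58 (.arith .add 49 58 55 ;; .const 56 1 ;; .const 52 1) (mov 59 90) ;;
    (mov 10 54 ;; mov 11 42) ;; fmul ;;
    (mov 54 12 ;; .arith .add 55 55 44 ;; .arith .sub 56 56 91))

/-- Look for a representation of the element in register `40` as a sum of an element of the table at
`r_26` and of two terms described by the registers `41, …, 48`. -/
def search : Prog :=
  (.const 49 0 ;; mov 50 45 ;; .const 51 0 ;; .arith .add 52 47 91) ;;
  .loop 52 ((mov 1 40 ;; mov 3 50) ;; fsub ;; mov 53 4 ;; searchRow ;;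
    (mov 10 50 ;; mov 11 46) ;; fmul ;;
    (mov 50 12 ;; .arith .add 51 51 48 ;; .arith .sub 52 52 91))

section

variable {p : ℕ} [hp : Fact p.Prime] {F : Type*} [Field F] [Algebra (ZMod p) F]
  {B : PowerBasis (ZMod p) F} {w : ℕ} {σ τ : State}

theorem Ex.orderProg [Finite F] (hw : (p ^ B.dim) ^ 2 < 2 ^ w) (hC : Cst B σ) {G : Fˣ}
    (hG : σ.reg 20 = enc B (G : F)) (ho : orderOf G ≤ p ^ B.dim) :
    Ex w orderProg σ (p ^ B.dim * (60 * (B.dim + 1) ^ 2 + 6) + 4)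
      fun τ => τ.reg 21 = orderOf G - 1 := by
  have hqw : p ^ B.dim < 2 ^ w := lt_of_le_of_lt (Nat.le_self_pow two_ne_zero _) hw
  have ho0 : 0 < orderOf G := orderOf_pos G
  let I : ℕ → State → Prop := fun i τ => Cst B τ ∧ τ.reg 20 = enc B (G : F) ∧
    τ.reg 21 = i ∧ τ.reg 22 = enc B ((G : F) ^ (i + 1)) ∧ τ.reg 23 = τ.reg 22 - 1
  refine Ex.mono (k := 3 + (∑ i ∈ Finset.range (orderOf G - 1),
    ((2 + (60 * (B.dim + 1) ^ 2 + 3)) + 1) + 1)) ?_ ?_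
  · refine (Ex.straight (Q := fun τ => I 0 τ) ?_ ?_).seq ?_
    · simp
    · exact ⟨hC.keep (Prog.keep_exec _ _) rfl, by simp [hC.r90, hC.r91, hG]⟩
    intro τ hk hI
    refine (Ex.loop I hI ?_ ?_).call le_rfl ?_
    · rintro i hi σ' ⟨-, -, -, h22, h23⟩
      rw [h23, h22]
      -- The code is nonzero, so truncated subtraction of 1 gives 0 exactly when the code is 1, that
      -- is, when the power is the identity. Hence register 23 serves as loop condition.
      have hne : enc B ((G : F) ^ (i + 1)) ≠ 0 := by
        rw [Ne, enc_eq_zero]; exact pow_ne_zero _ G.ne_zero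
      have h1 : enc B ((G : F) ^ (i + 1)) - 1 = 0 ↔ G ^ (i + 1) = 1 := by
        rw [← Units.val_inj, Units.val_pow_eq_pow_val, Units.val_one, ← (enc_injective B).eq_iff,
          enc_one]
        omega
      rw [h1, ← orderOf_dvd_iff_pow_eq_one]
      constructor
      · intro h
        have := Nat.le_of_dvd (Nat.succ_pos _) h
        omega
      · rintro rfl
        rw [Nat.sub_add_cancel ho0]
    · rintro i hi σ hk ⟨hC, h20, h21, h22, -⟩
      refine (Ex.straight (Q := fun τ => τ.reg 10 = enc B ((G : F) ^ (i + 1)) ∧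
        τ.reg 11 = enc B (G : F)) ?_ ?_).seq ?_
      · simp
      · simp [hC.r90, h20, h22]
      rintro τ hk ⟨h10, h11⟩
      have hC := hC.keep hk rfl
      have h20 := (hk.reg 20 rfl).trans h20
      have h21 := (hk.reg 21 rfl).trans h21
      refine (Ex.fmul hw hC h10 h11).seq fun τ hk h12 => ?_
      have hC := hC.keep hk rfl
      have h20 := (hk.reg 20 rfl).trans h20
      have h21 := (hk.reg 21 rfl).trans h21
      refine Ex.straight ?_ ?_
      · simp [hC.r91, h21]; omega
      · exact ⟨hC.keep (Prog.keep_exec _ _) rfl, by simp [hC.r90, hC.r91, h20, h21, h12, pow_succ]⟩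
    · exact fun τ _ h => h.2.2.1
  · simp only [Finset.sum_const, Finset.card_range, smul_eq_mul]
    have h := Nat.mul_le_mul_right (60 * (B.dim + 1) ^ 2 + 6)
      ((Nat.sub_le _ 1).trans ho : orderOf G - 1 ≤ p ^ B.dim)
    have e : 2 + (60 * (B.dim + 1) ^ 2 + 3) + 1 = 60 * (B.dim + 1) ^ 2 + 6 := by ring
    rw [e]
    omega

end

section

variable {p : ℕ} [hp : Fact p.Prime] {F : Type*} [Field F] [Algebra (ZMod p) F]
  {B : PowerBasis (ZMod p) F} {w : ℕ} {σ τ : State} {a g : ℕ → F} {r : ℕ → ℕ} {S : Finset ℕ}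
  {m : ℕ}

theorem sq_lt_of_word (hm : 2 ≤ m) (hw : 4 * (p ^ B.dim) ^ m < 2 ^ w) :
    (p ^ B.dim) ^ 2 < 2 ^ w := by
  have : (p ^ B.dim) ^ 2 ≤ (p ^ B.dim) ^ m :=
    Nat.pow_le_pow_right (pow_pos hp.out.pos _) hm
  omega

theorem mul_pow_le {q x j m : ℕ} (hx : x ≤ q) (hj : j < m) (hq : 0 < q) :
    x * q ^ j ≤ q ^ m :=
  calc x * q ^ j ≤ q * q ^ j := Nat.mul_le_mul_right _ hx
    _ = q ^ (j + 1) := (pow_succ' _ _).symm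
    _ ≤ q ^ m := Nat.pow_le_pow_right hq hj

theorem Ex.extendRow {j tb c : ℕ} {y : F} {mem₀ : ℕ → ℕ} {D : Set F}
    (hm : 2 ≤ m) (hw : 4 * (p ^ B.dim) ^ m < 2 ^ w) (hr : ∀ i, r i < p ^ B.dim)
    (htb : tb + 2 * p ^ B.dim < 2 ^ w) (hC : Cst B σ)
    (h24 : σ.reg 24 = enc B (a j)) (h20 : σ.reg 20 = enc B (g j)) (h21 : σ.reg 21 = r j)
    (h25 : σ.reg 25 = (p ^ B.dim) ^ j) (h26 : σ.reg 26 = tb) (h27 : σ.reg 27 = enc B y)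
    (h30 : σ.reg 30 = c + 1) (hS : S ⊆ Finset.range m) (hj : j < m) (hjS : j ∉ S)
    (hy : Sol (p ^ B.dim) a g r S y c)
    (hF : Fill B mem₀ a g r (insert j S) (tb + p ^ B.dim) D σ.mem) :
    Ex w extendRow σ ((r j + 1) * (80 * (B.dim + 1) ^ 2) + 3) fun τ =>
      Fill B mem₀ a g r (insert j S) (tb + p ^ B.dim)
        (D ∪ {z | ∃ x < r j + 1, z = y + a j * g j ^ x}) τ.mem := by
  have hw2 := sq_lt_of_word hm hw
  have hqw : p ^ B.dim < 2 ^ w := lt_of_le_of_lt (Nat.le_self_pow two_ne_zero _) hw2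
  have hq0 : 0 < p ^ B.dim := pow_pos hp.out.pos _
  have hrj := hr j
  have hc := hy.lt hr hS
  let I : ℕ → State → Prop := fun e τ => τ.reg 31 = enc B (a j * g j ^ e) ∧
    τ.reg 30 = c + 1 + e * (p ^ B.dim) ^ j ∧
    Fill B mem₀ a g r (insert j S) (tb + p ^ B.dim)
        (D ∪ {z | ∃ x < e, z = y + a j * g j ^ x}) τ.mem
  refine Ex.mono (k := 2 + ((r j + 1) * ((2 + ((12 * B.dim + 5) + (5 + (60 * (B.dim + 1) ^ 2 + 2))))
    + 2) + 1)) ?_ ?_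
  · refine (Ex.straight (Q := fun τ => τ.reg 31 = enc B (a j) ∧ τ.reg 32 = r j + 1 ∧
      τ.mem = σ.mem) ?_ ?_).seq ?_
    · simp [hC.r91, h21]; omega
    · simp [hC.r90, hC.r91, h21, h24]
    rintro τ hk ⟨h31, h32, hmem⟩
    have hC := hC.keep hk rfl
    have h30 := (hk.reg 30 rfl).trans h30
    have h20 := (hk.reg 20 rfl).trans h20
    have h25 := (hk.reg 25 rfl).trans h25
    have h26 := (hk.reg 26 rfl).trans h26
    have h27 := (hk.reg 27 rfl).trans h27
    refine (Ex.rep I ⟨?_, ?_, ?_⟩ h32 hC.r91 rfl rfl ?_).call le_rfl fun _ _ h => h.2.2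
    · simp [h31]
    · simp [h30]
    · simpa [hmem] using hF
    rintro e he σ hk ⟨h31, h30, hF⟩ -
    have hC := hC.keep hk rfl
    have h20 := (hk.reg 20 rfl).trans h20
    have h25 := (hk.reg 25 rfl).trans h25
    have h26 := (hk.reg 26 rfl).trans h26
    have h27 := (hk.reg 27 rfl).trans h27
    refine (Ex.straight (Q := fun τ => τ.reg 1 = enc B y ∧ τ.reg 3 = enc B (a j * g j ^ e) ∧
      τ.mem = σ.mem) ?_ ?_).seq ?_
    · simp
    · simp [hC.r90, h27, h31]
    rintro τ hk ⟨h1, h3, hmem⟩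
    have hC := hC.keep hk rfl
    have h20 := (hk.reg 20 rfl).trans h20
    have h25 := (hk.reg 25 rfl).trans h25
    have h26 := (hk.reg 26 rfl).trans h26
    have h30 := (hk.reg 30 rfl).trans h30
    have h31 := (hk.reg 31 rfl).trans h31
    refine (Ex.fadd hw2 hC h1 h3).seq fun τ hk h4 => ?_
    have hC := hC.keep hk rfl
    have h20 := (hk.reg 20 rfl).trans h20
    have h25 := (hk.reg 25 rfl).trans h25
    have h26 := (hk.reg 26 rfl).trans h26
    have h30 := (hk.reg 30 rfl).trans h30
    have h31 := (hk.reg 31 rfl).trans h31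
    have hmem := (hk.2 rfl).trans hmem
    have hlt := enc_lt B (y + a j * g j ^ e)
    refine (Ex.straight (Q := fun τ => τ.reg 10 = enc B (a j * g j ^ e) ∧
      τ.reg 11 = enc B (g j) ∧ Fill B mem₀ a g r (insert j S) (tb + p ^ B.dim)
        (D ∪ {z | ∃ x < e + 1, z = y + a j * g j ^ x}) τ.mem) ?_ ?_).seq ?_
    · simp [hC.r94, h26, h4]; omega
    · refine ⟨?_, ?_, ?_⟩
      · simp [hC.r90, h31]
      · simp [hC.r90, h20]
      -- Register 30 holds the successor of this code, which is exactly what a table entry must be.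
      · have := hF.store (y := y + a j * g j ^ e) (c := c + e * (p ^ B.dim) ^ j)
          (D' := D ∪ {z | ∃ x < e + 1, z = y + a j * g j ^ x})
          (hy.add_index hjS (by omega)) ?_
        · simp only [Prog.exec, Op.eval, State.setReg_mem, State.setMem_mem, State.setReg_reg, mov,
            if_true, h26, hC.r94, h4, hmem]
          simpa [h30, add_right_comm] using this
        · rintro z (hz | ⟨x, hx, rfl⟩) hzy
          · exact .inl hz
          · refine .inr ⟨x, ?_, rfl⟩
            rcases (by omega : x < e ∨ x = e) with h | rfl
            · exact h
            · exact absurd rfl hzy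
    rintro τ hk ⟨h10, h11, hF⟩
    have hC := hC.keep hk rfl
    have h25 := (hk.reg 25 rfl).trans h25
    have h30 := (hk.reg 30 rfl).trans h30
    refine (Ex.fmul hw2 hC h10 h11).seq fun τ hk h12 => ?_
    have hC := hC.keep hk rfl
    have h25 := (hk.reg 25 rfl).trans h25
    have h30 := (hk.reg 30 rfl).trans h30
    refine Ex.straight ?_ ⟨?_, ?_, ?_⟩
    · have := mul_pow_le (by omega : e + 1 ≤ p ^ B.dim) hj hq0
      simp [h30, h25]
      rw [add_mul] at this
      omega
    · simp [hC.r90, h12, pow_succ, mul_assoc]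
    · simp [hC.r90, h30, h25]; ring
    · simpa [hk.2 rfl] using hF
  · have : 2 + ((12 * B.dim + 5) + (5 + (60 * (B.dim + 1) ^ 2 + 2))) + 2 ≤
      80 * (B.dim + 1) ^ 2 := by nlinarith
    have := Nat.mul_le_mul_left (r j + 1) this
    omega

theorem Ex.extend {j tb : ℕ}
    (hm : 2 ≤ m) (hw : 4 * (p ^ B.dim) ^ m < 2 ^ w) (hr : ∀ i, r i < p ^ B.dim)
    (htb : tb + 2 * p ^ B.dim < 2 ^ w) (hC : Cst B σ)
    (h24 : σ.reg 24 = enc B (a j)) (h20 : σ.reg 20 = enc B (g j)) (h21 : σ.reg 21 = r j)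
    (h25 : σ.reg 25 = (p ^ B.dim) ^ j) (h26 : σ.reg 26 = tb)
    (hS : S ⊆ Finset.range m) (hj : j < m) (hjS : j ∉ S)
    (hT : Tab B a g r S tb σ.mem) (hz : ∀ k, tb + p ^ B.dim ≤ k → σ.mem k = 0) :
    Ex w extend σ (100 * (B.dim + 1) ^ 2 *
        (p ^ B.dim + cnt (p ^ B.dim) tb σ.mem * (r j + 1))) fun τ =>
      τ.reg 26 = tb + p ^ B.dim ∧ Tab B a g r (insert j S) (tb + p ^ B.dim) τ.mem ∧
      (∀ k < tb + p ^ B.dim, τ.mem k = σ.mem k) ∧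
      (∀ k, tb + p ^ B.dim + p ^ B.dim ≤ k → τ.mem k = 0) := by
  have hw2 := sq_lt_of_word hm hw
  have hqw : p ^ B.dim < 2 ^ w := lt_of_le_of_lt (Nat.le_self_pow two_ne_zero _) hw2
  have hq0 : 0 < p ^ B.dim := pow_pos hp.out.pos _
  have hrj := hr j
  set mem₀ := σ.mem with hmem₀
  -- The values due after scanning the first `i` cells of the old table.
  let D : ℕ → Set F := fun i => {z | ∃ y c, Sol (p ^ B.dim) a g r S y c ∧ enc B y < i ∧
    ∃ x < r j + 1, z = y + a j * g j ^ x}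
  let I : ℕ → State → Prop := fun i τ => τ.reg 27 = i ∧
    Fill B mem₀ a g r (insert j S) (tb + p ^ B.dim) (D i) τ.mem
  -- An empty cell costs a constant. Summing over all cells therefore gives `q` plus the number of
  -- entries times the length of a row, up to the factor for field arithmetic.
  let kb : ℕ → ℕ := fun i =>
    if mem₀ (tb + i) ≠ 0 then (r j + 1) * (80 * (B.dim + 1) ^ 2) + 3 else 1
  refine Ex.mono (k := 2 + ((∑ i ∈ Finset.range (p ^ B.dim), ((2 + ((kb i + 1) + 1)) + 2) + 1) + 1))
    ?_ ?_
  · refine (Ex.straight (Q := fun τ => τ.reg 27 = 0 ∧ τ.reg 28 = p ^ B.dim) ?_ ?_).seq ?_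
    · simp
    · simp [hC.r90, hC.r94]
    rintro τ hk ⟨h27, h28⟩
    have hC := hC.keep hk rfl
    have hmem : τ.mem = mem₀ := hk.2 rfl
    have h24 := (hk.reg 24 rfl).trans h24
    have h20 := (hk.reg 20 rfl).trans h20
    have h21 := (hk.reg 21 rfl).trans h21
    have h25 := (hk.reg 25 rfl).trans h25
    have h26 := (hk.reg 26 rfl).trans h26
    refine (Ex.rep_sum I ⟨h27, ?_⟩ h28 hC.r91 rfl rfl ?_).seq ?_
    · rw [hmem]
      -- The new table occupies cells that are still 0, so it need not be cleared.
      refine ⟨fun _ _ => rfl, fun k hk => hz k (by omega), fun y c h => ?_, ?_⟩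
      · rw [hz _ (by omega)] at h; omega
      · rintro z ⟨y, c, -, h, -⟩
        omega
    · rintro i hi σ hk ⟨h27, hF⟩ -
      have hC := hC.keep hk rfl
      have h24 := (hk.reg 24 rfl).trans h24
      have h20 := (hk.reg 20 rfl).trans h20
      have h21 := (hk.reg 21 rfl).trans h21
      have h25 := (hk.reg 25 rfl).trans h25
      have h26 := (hk.reg 26 rfl).trans h26
      -- All writes go to the next table; the one being scanned is unchanged.
      have hold := hF.below (tb + i) (by omega)
      refine (Ex.straight (Q := fun τ => τ.reg 30 = mem₀ (tb + i) ∧ τ.mem = σ.mem) ?_ ?_).seq ?_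
      · simp [h26, h27]; omega
      · simp [h26, h27, hold]
      rintro τ hk ⟨h30, hmem⟩
      have hC := hC.keep hk rfl
      have h24 := (hk.reg 24 rfl).trans h24
      have h20 := (hk.reg 20 rfl).trans h20
      have h21 := (hk.reg 21 rfl).trans h21
      have h25 := (hk.reg 25 rfl).trans h25
      have h26 := (hk.reg 26 rfl).trans h26
      have h27 := (hk.reg 27 rfl).trans h27
      rw [← hmem] at hF
      refine (Ex.ite (Q := fun τ' => τ'.reg 27 = i ∧ τ'.reg 91 = 1 ∧
        Fill B mem₀ a g r (insert j S) (tb + p ^ B.dim) (D (i + 1)) τ'.mem)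
        (fun h0 => ?_) (fun h0 => ?_)).seq ?_
      · rw [h30] at h0
        obtain ⟨y, rfl⟩ := enc_surj B hi
        obtain ⟨c, hc⟩ := Nat.exists_eq_succ_of_ne_zero h0
        have hy := hT.1 y c hc
        refine (Ex.extendRow hm hw hr htb hC h24 h20 h21 h25 h26 h27 (h30.trans hc) hS hj hjS hy
          hF).call (by simp only [kb]; rw [if_pos h0]) fun τ hk h => ⟨?_, ?_, ?_⟩
        · rw [hk.reg 27 rfl, h27]
        · rw [hk.reg 91 rfl, hC.r91]
        · refine ⟨h.below, h.above, h.sound, ?_⟩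
          rintro z ⟨y', c', hs, he, hx⟩
          refine h.complete z ?_
          rcases (by omega : enc B y' < enc B y ∨ enc B y' = enc B y) with h | h
          · exact .inl ⟨y', c', hs, h, hx⟩
          · rw [enc_injective B h] at hx
            exact .inr hx
      · rw [h30] at h0
        refine (Ex.straight (P := mov 34 90) (w := w) (σ := τ) (Q := fun τ' => τ'.reg 27 = i ∧
          τ'.reg 91 = 1 ∧ τ'.mem = τ.mem) (by simp) (by simp [hC.r91, h27])).call
          (by simp only [kb]; rw [if_neg (by simpa using h0)]; rfl)
          fun τ' hk h => ⟨h.1, h.2.1, ?_⟩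
        rw [h.2.2]
        refine ⟨hF.below, hF.above, hF.sound, ?_⟩
        rintro z ⟨y', c', hs, he, hx⟩
        refine hF.complete z ?_
        rcases (by omega : enc B y' < i ∨ enc B y' = i) with h | h
        · exact ⟨y', c', hs, h, hx⟩
        · exact absurd (h ▸ h0) (hT.2 y' c' hs)
      · rintro τ hk ⟨h27, h91, hF⟩
        refine Ex.straight ?_ ?_
        · simp [h27, h91]; omega
        · simpa [I, h27, h91] using hF
    · rintro τ hk ⟨-, hF⟩
      have hC := hC.keep hk rfl
      have h26 := (hk.reg 26 rfl).trans h26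
      refine Ex.straight ?_ ⟨?_, ⟨?_, ?_⟩, ?_, ?_⟩
      · simp [h26, hC.r94]; omega
      · simp [h26, hC.r94]
      · simpa using hF.sound
      · simp only [Prog.exec, State.setReg_mem]
        intro y c hs
        obtain ⟨y', c', x, hs', hx, rfl, rfl⟩ := hs.of_insert hjS
        exact hF.complete _ ⟨y', c', hs', enc_lt B y', x, by omega, rfl⟩
      · simpa using hF.below
      · simpa using hF.above
  · have h1 : ∑ i ∈ Finset.range (p ^ B.dim), ((2 + ((kb i + 1) + 1)) + 2) ≤
        ∑ i ∈ Finset.range (p ^ B.dim), (9 +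
          if mem₀ (tb + i) ≠ 0 then (r j + 1) * (80 * (B.dim + 1) ^ 2) else 0) := by
      refine Finset.sum_le_sum fun i _ => ?_
      simp only [kb]
      split_ifs <;> omega
    rw [Finset.sum_add_distrib (f := fun _ => 9), ← Finset.sum_filter] at h1
    simp only [Finset.sum_const, Finset.card_range, smul_eq_mul] at h1
    change _ ≤ _ + cnt (p ^ B.dim) tb mem₀ * _ at h1
    have h2 : 1 ≤ (B.dim + 1) ^ 2 := Nat.one_le_pow _ _ (by omega)
    have h3 : cnt (p ^ B.dim) tb mem₀ * ((r j + 1) * (80 * (B.dim + 1) ^ 2)) ≤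
      100 * (B.dim + 1) ^ 2 * (cnt (p ^ B.dim) tb mem₀ * (r j + 1)) := by
      nlinarith [Nat.zero_le ((B.dim + 1) ^ 2 * (cnt (p ^ B.dim) tb mem₀ * (r j + 1)))]
    rw [mul_add]
    nlinarith

end

section

variable {p : ℕ} [hp : Fact p.Prime] {F : Type*} [Field F] [Algebra (ZMod p) F]
  {B : PowerBasis (ZMod p) F} {w : ℕ} {σ τ : State} {a g : ℕ → F} {r : ℕ → ℕ} {S : Finset ℕ}
  {m : ℕ}

theorem Ex.searchRow {j tb d e : ℕ} {v : F}
    (hm : 2 ≤ m) (hw : 4 * (p ^ B.dim) ^ m < 2 ^ w) (hr : ∀ i, r i < p ^ B.dim)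
    (htb : tb + 2 * p ^ B.dim < 2 ^ w) (hC : Cst B σ)
    (h41 : σ.reg 41 = enc B (a j)) (h42 : σ.reg 42 = enc B (g j)) (h43 : σ.reg 43 = r j)
    (h44 : σ.reg 44 = (p ^ B.dim) ^ j) (h26 : σ.reg 26 = tb) (h53 : σ.reg 53 = enc B v)
    (h51 : σ.reg 51 = d) (hd : d ≤ (p ^ B.dim) ^ m) (h49 : σ.reg 49 = 0) (h52 : σ.reg 52 = e)
    (hS : S ⊆ Finset.range m) (hj : j < m) (hT : Tab B a g r S tb σ.mem) :
    Ex w searchRow σ ((r j + 1) * (80 * (B.dim + 1) ^ 2) + 4) fun τ =>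
      ((∃ x < r j + 1, σ.mem (tb + enc B (v - a j * g j ^ x)) ≠ 0) ∧
        ∃ x c, x ≤ r j ∧ Sol (p ^ B.dim) a g r S (v - a j * g j ^ x) c ∧
          τ.reg 49 = c + 1 + (d + x * (p ^ B.dim) ^ j) ∧ τ.reg 52 = 1) ∨
      ((∀ x < r j + 1, ¬ σ.mem (tb + enc B (v - a j * g j ^ x)) ≠ 0) ∧
        τ.reg 49 = 0 ∧ τ.reg 52 = e) := by
  have hw2 := sq_lt_of_word hm hw
  have hqw : p ^ B.dim < 2 ^ w := lt_of_le_of_lt (Nat.le_self_pow two_ne_zero _) hw2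
  have hq0 : 0 < p ^ B.dim := pow_pos hp.out.pos _
  have hw0 : w ≠ 0 := by rintro rfl; omega
  have hrj := hr j
  set mem₀ := σ.mem with hmem₀
  let hit : ℕ → Prop := fun x => mem₀ (tb + enc B (v - a j * g j ^ x)) ≠ 0
  let I : ℕ → State → Prop := fun x τ => τ.reg 54 = enc B (a j * g j ^ x) ∧
    τ.reg 55 = d + x * (p ^ B.dim) ^ j ∧ τ.reg 49 = 0 ∧ τ.reg 52 = e
  let D : State → Prop := fun τ => ∃ x c, x ≤ r j ∧
    Sol (p ^ B.dim) a g r S (v - a j * g j ^ x) c ∧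
          τ.reg 49 = c + 1 + (d + x * (p ^ B.dim) ^ j) ∧ τ.reg 52 = 1
  have hcost : 2 + ((12 * B.dim + 5) + (2 + ((3 + 1) + (2 + (60 * (B.dim + 1) ^ 2 + 3))))) + 1 ≤
      80 * (B.dim + 1) ^ 2 := by nlinarith
  refine Ex.mono (k := 3 + ((r j + 1) * ((2 + ((12 * B.dim + 5) + (2 + ((3 + 1) + (2 +
    (60 * (B.dim + 1) ^ 2 + 3)))))) + 1) + 1)) ?_
    (by have := Nat.mul_le_mul_left (r j + 1) hcost; omega)
  refine (Ex.straight (Q := fun τ => I 0 τ ∧ τ.reg 56 = r j + 1) ?_ ?_).seq ?_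
  · simp [hC.r91, h43]; omega
  · simp [I, hC.r90, hC.r91, h41, h43, h49, h51, h52]
  rintro τ hk ⟨hI, h56⟩
  have hC := hC.keep hk rfl
  have h42 := (hk.reg 42 rfl).trans h42
  have h44 := (hk.reg 44 rfl).trans h44
  have h26 := (hk.reg 26 rfl).trans h26
  have h53 := (hk.reg 53 rfl).trans h53
  have hmem := hk.2 rfl
  refine (Ex.loop_search (h := r j + 1) hit I D hI h56 ?_ (.inl le_rfl)).call le_rfl ?_
  · rintro x hx σ hk ⟨h54, h55, h49, h52⟩ h56
    have hC := hC.keep hk rfl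
    have h42 := (hk.reg 42 rfl).trans h42
    have h44 := (hk.reg 44 rfl).trans h44
    have h26 := (hk.reg 26 rfl).trans h26
    have h53 := (hk.reg 53 rfl).trans h53
    have hmem := (hk.2 rfl).trans hmem
    have hxq := mul_pow_le (by omega : x + 1 ≤ p ^ B.dim) hj hq0
    rw [add_mul, one_mul] at hxq
    refine (Ex.straight (Q := fun τ => τ.reg 1 = enc B v ∧
      τ.reg 3 = enc B (a j * g j ^ x)) ?_ ?_).seq ?_
    · simp
    · simp [hC.r90, h53, h54]
    rintro τ hk ⟨h1, h3⟩
    have hC := hC.keep hk rfl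
    have h42 := (hk.reg 42 rfl).trans h42
    have h44 := (hk.reg 44 rfl).trans h44
    have h26 := (hk.reg 26 rfl).trans h26
    have h54 := (hk.reg 54 rfl).trans h54
    have h55 := (hk.reg 55 rfl).trans h55
    have h56 := (hk.reg 56 rfl).trans h56
    have h49 := (hk.reg 49 rfl).trans h49
    have h52 := (hk.reg 52 rfl).trans h52
    have hmem := (hk.2 rfl).trans hmem
    refine (Ex.fsub hw2 hC h1 h3).seq fun τ hk h4 => ?_
    have hC := hC.keep hk rfl
    have h42 := (hk.reg 42 rfl).trans h42
    have h44 := (hk.reg 44 rfl).trans h44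
    have h26 := (hk.reg 26 rfl).trans h26
    have h54 := (hk.reg 54 rfl).trans h54
    have h55 := (hk.reg 55 rfl).trans h55
    have h56 := (hk.reg 56 rfl).trans h56
    have h49 := (hk.reg 49 rfl).trans h49
    have h52 := (hk.reg 52 rfl).trans h52
    have hmem := (hk.2 rfl).trans hmem
    have hlt := enc_lt B (v - a j * g j ^ x)
    refine (Ex.straight (Q := fun τ => τ.reg 58 = mem₀ (tb + enc B (v - a j * g j ^ x)))
      ?_ ?_).seq ?_
    · simp [h26, h4]; omega
    · simp [h26, h4, hmem, hmem₀]
    intro τ hk h58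
    have hC := hC.keep hk rfl
    have h42 := (hk.reg 42 rfl).trans h42
    have h44 := (hk.reg 44 rfl).trans h44
    have h54 := (hk.reg 54 rfl).trans h54
    have h55 := (hk.reg 55 rfl).trans h55
    have h56 := (hk.reg 56 rfl).trans h56
    have h49 := (hk.reg 49 rfl).trans h49
    have h52 := (hk.reg 52 rfl).trans h52
    -- On a hit both loop counters are set to 1, so that the decrement ending each round brings them
    -- to 0. This stops the inner loop here and the outer loop in `search`.
    refine (Ex.ite (Q := fun τ => (hit x ∧ τ.reg 56 = 1 ∧ D τ) ∨
      (¬ hit x ∧ τ.reg 56 = r j + 1 - x ∧ τ.reg 49 = 0 ∧ τ.reg 52 = e))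
      (fun h0 => ?_) (fun h0 => ?_)).seq ?_
    · rw [h58] at h0
      obtain ⟨c, hc⟩ := Nat.exists_eq_succ_of_ne_zero h0
      have hs := hT.1 _ c hc
      have hcm := hs.lt hr hS
      refine Ex.straight ?_ (.inl ⟨h0, ?_, x, c, by omega, hs, ?_, ?_⟩)
      · simp [h58, h55, hc, hw0]; omega
      · simp
      · simp [h58, hc, h55]
      · simp
    · rw [h58] at h0
      refine (Ex.straight (P := mov 59 90) (w := w) (σ := τ) (Q := fun τ' => τ'.reg 56 = τ.reg 56 ∧
        τ'.reg 49 = τ.reg 49 ∧ τ'.reg 52 = τ.reg 52) (by simp) (by simp)).call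
        (by simp [Prog.len]) fun τ' hk h => ?_
      refine .inr ⟨fun h => h h0, ?_, ?_, ?_⟩
      · rw [h.1, h56]
      · rw [h.2.1, h49]
      · rw [h.2.2, h52]
    · intro τ hk hQ
      have hC := hC.keep hk rfl
      have h42 := (hk.reg 42 rfl).trans h42
      have h44 := (hk.reg 44 rfl).trans h44
      have h54 := (hk.reg 54 rfl).trans h54
      have h55 := (hk.reg 55 rfl).trans h55
      refine (Ex.straight (Q := fun τ => τ.reg 10 = enc B (a j * g j ^ x) ∧
        τ.reg 11 = enc B (g j)) ?_ ?_).seq ?_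
      · simp
      · simp [hC.r90, h54, h42]
      rintro τ₁ hk₁ ⟨h10, h11⟩
      have hC := hC.keep hk₁ rfl
      have h44 := (hk₁.reg 44 rfl).trans h44
      have h55 := (hk₁.reg 55 rfl).trans h55
      refine (Ex.fmul hw2 hC h10 h11).seq fun τ₂ hk₂ h12 => ?_
      have hC := hC.keep hk₂ rfl
      have h44 := (hk₂.reg 44 rfl).trans h44
      have h55 := (hk₂.reg 55 rfl).trans h55
      have h49 := (hk₂.reg 49 rfl).trans (hk₁.reg 49 rfl)
      have h52 := (hk₂.reg 52 rfl).trans (hk₁.reg 52 rfl)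
      have h56 := (hk₂.reg 56 rfl).trans (hk₁.reg 56 rfl)
      refine Ex.straight ?_ ?_
      · simp [h55, h44]; omega
      · rcases hQ with ⟨q1, q2, x', c, q3, q4, q5, q6⟩ | ⟨q1, q2, q3, q4⟩
        · exact .inl ⟨q1, by simp [h56, q2, hC.r91], x', c, q3, q4, by simp [h49, q5],
            by simp [h52, q6]⟩
        · refine .inr ⟨q1, by simp [h56, q2, hC.r91, Nat.sub_sub], ?_, ?_, ?_, ?_⟩
          · simp [hC.r90, h12, pow_succ, mul_assoc]
          · simp [h55, h44]; ring
          · simp [h49, q3]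
          · simp [h52, q4]
  · rintro τ hk (⟨h1, h2⟩ | ⟨h1, h2⟩)
    · exact .inl ⟨h1, h2⟩
    · exact .inr ⟨h1, h2.2.2⟩

/-- The cost is governed by `h`, which either allows every value of the outer exponent or exceeds
one at which a solution is known to exist. The first form serves exhaustive searches, the second the
early success supplied by the character sum estimate. The program itself never sees `h`. -/
theorem Ex.search {j l tb h : ℕ} {b : F}
    (hm : 2 ≤ m) (hw : 4 * (p ^ B.dim) ^ m < 2 ^ w) (hr : ∀ i, r i < p ^ B.dim)
    (htb : tb + 2 * p ^ B.dim < 2 ^ w) (hC : Cst B σ) (h40 : σ.reg 40 = enc B b)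
    (h41 : σ.reg 41 = enc B (a j)) (h42 : σ.reg 42 = enc B (g j)) (h43 : σ.reg 43 = r j)
    (h44 : σ.reg 44 = (p ^ B.dim) ^ j)
    (h45 : σ.reg 45 = enc B (a l)) (h46 : σ.reg 46 = enc B (g l)) (h47 : σ.reg 47 = r l)
    (h48 : σ.reg 48 = (p ^ B.dim) ^ l) (h26 : σ.reg 26 = tb)
    (hS : S ⊆ Finset.range m) (hj : j < m) (hl : l < m) (hjS : j ∉ S) (hlS : l ∉ insert j S)
    (hT : Tab B a g r S tb σ.mem)
    (hh : r l + 1 ≤ h ∨ ∃ x < h, x < r l + 1 ∧ ∃ x' < r j + 1, ∃ c,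
      Sol (p ^ B.dim) a g r S (b - a l * g l ^ x - a j * g j ^ x') c) :
    Ex w search σ (100 * (B.dim + 1) ^ 2 * (2 * (h * (r j + 1)) + 1)) fun τ =>
      (∃ c, τ.reg 49 = c + 1 ∧ Sol (p ^ B.dim) a g r (insert l (insert j S)) b c) ∨
      (τ.reg 49 = 0 ∧ ∀ c, ¬ Sol (p ^ B.dim) a g r (insert l (insert j S)) b c) := by
  have hw2 := sq_lt_of_word hm hw
  have hqw : p ^ B.dim < 2 ^ w := lt_of_le_of_lt (Nat.le_self_pow two_ne_zero _) hw2
  have hq0 : 0 < p ^ B.dim := pow_pos hp.out.pos _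
  have hrl := hr l
  set mem₀ := σ.mem with hmem₀
  let hit : ℕ → Prop := fun x => ∃ x' < r j + 1,
    mem₀ (tb + enc B (b - a l * g l ^ x - a j * g j ^ x')) ≠ 0
  -- Nonzero entries mark exactly the attainable values, which turns the promised solution into a
  -- hit of the loop.
  have hSol : ∀ y, (∃ c, Sol (p ^ B.dim) a g r S y c) ↔ mem₀ (tb + enc B y) ≠ 0 := by
    intro y
    constructor
    · rintro ⟨c, hc⟩; exact hT.2 y c hc
    · intro h
      obtain ⟨c, hc⟩ := Nat.exists_eq_succ_of_ne_zero h
      exact ⟨c, hT.1 y c hc⟩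
  simp only [hSol] at hh
  let I : ℕ → State → Prop := fun x τ => τ.reg 50 = enc B (a l * g l ^ x) ∧
    τ.reg 51 = x * (p ^ B.dim) ^ l ∧ τ.reg 49 = 0
  let D : State → Prop := fun τ => ∃ c, τ.reg 49 = c + 1 ∧
    Sol (p ^ B.dim) a g r (insert l (insert j S)) b c
  refine Ex.mono (k := 4 + (h * ((2 + ((12 * B.dim + 5) + (1 +
    (((r j + 1) * (80 * (B.dim + 1) ^ 2) + 4) + (2 + (60 * (B.dim + 1) ^ 2 + 3)))))) + 1) + 1)) ?_ ?_
  · refine (Ex.straight (Q := fun τ => I 0 τ ∧ τ.reg 52 = r l + 1) ?_ ?_).seq ?_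
    · simp [hC.r91, h47]; omega
    · simp [I, hC.r90, hC.r91, h45, h47]
    rintro τ hk ⟨hI, h52⟩
    have hC := hC.keep hk rfl
    have h40 := (hk.reg 40 rfl).trans h40
    have h41 := (hk.reg 41 rfl).trans h41
    have h42 := (hk.reg 42 rfl).trans h42
    have h43 := (hk.reg 43 rfl).trans h43
    have h44 := (hk.reg 44 rfl).trans h44
    have h46 := (hk.reg 46 rfl).trans h46
    have h48 := (hk.reg 48 rfl).trans h48
    have h26 := (hk.reg 26 rfl).trans h26
    have hmem : τ.mem = mem₀ := hk.2 rfl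
    refine (Ex.loop_search (h := h) hit I D hI h52 ?_ ?_).call le_rfl ?_
    · rintro x hx σ hk ⟨h50, h51, h49⟩ h52
      have hC := hC.keep hk rfl
      have h40 := (hk.reg 40 rfl).trans h40
      have h41 := (hk.reg 41 rfl).trans h41
      have h42 := (hk.reg 42 rfl).trans h42
      have h43 := (hk.reg 43 rfl).trans h43
      have h44 := (hk.reg 44 rfl).trans h44
      have h46 := (hk.reg 46 rfl).trans h46
      have h48 := (hk.reg 48 rfl).trans h48
      have h26 := (hk.reg 26 rfl).trans h26
      have hmem := (hk.2 rfl).trans hmem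
      have hxq := mul_pow_le (by omega : x + 1 ≤ p ^ B.dim) hl hq0
      rw [add_mul, one_mul] at hxq
      refine (Ex.straight (Q := fun τ => τ.reg 1 = enc B b ∧
        τ.reg 3 = enc B (a l * g l ^ x)) ?_ ?_).seq ?_
      · simp
      · simp [hC.r90, h40, h50]
      rintro τ hk ⟨h1, h3⟩
      have hC := hC.keep hk rfl
      have h26 := (hk.reg 26 rfl).trans h26
      have hmem := (hk.2 rfl).trans hmem
      refine (Ex.fsub hw2 hC h1 h3).seq fun τ₁ hk₁ h4 => ?_
      have hk := hk.1
      have hC := hC.keep hk₁ rfl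
      refine (Ex.straight (P := mov 53 4) (Q := fun τ => τ.reg 53 = enc B (b - a l * g l ^ x))
        (by simp) ?_).seq fun τ₂ hk₂ h53 => ?_
      · simp [hC.r90, h4]
      have hC := hC.keep hk₂ rfl
      have h41 := (hk₂.reg 41 rfl).trans ((hk₁.reg 41 rfl).trans ((hk 41 rfl).trans h41))
      have h42 := (hk₂.reg 42 rfl).trans ((hk₁.reg 42 rfl).trans ((hk 42 rfl).trans h42))
      have h43 := (hk₂.reg 43 rfl).trans ((hk₁.reg 43 rfl).trans ((hk 43 rfl).trans h43))
      have h44 := (hk₂.reg 44 rfl).trans ((hk₁.reg 44 rfl).trans ((hk 44 rfl).trans h44))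
      have h46 := (hk₂.reg 46 rfl).trans ((hk₁.reg 46 rfl).trans ((hk 46 rfl).trans h46))
      have h48 := (hk₂.reg 48 rfl).trans ((hk₁.reg 48 rfl).trans ((hk 48 rfl).trans h48))
      have h49 := (hk₂.reg 49 rfl).trans ((hk₁.reg 49 rfl).trans ((hk 49 rfl).trans h49))
      have h50 := (hk₂.reg 50 rfl).trans ((hk₁.reg 50 rfl).trans ((hk 50 rfl).trans h50))
      have h51 := (hk₂.reg 51 rfl).trans ((hk₁.reg 51 rfl).trans ((hk 51 rfl).trans h51))
      have h52 := (hk₂.reg 52 rfl).trans ((hk₁.reg 52 rfl).trans ((hk 52 rfl).trans h52))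
      have h26 := (hk₂.reg 26 rfl).trans ((hk₁.reg 26 rfl).trans h26)
      have hmem := (hk₂.2 rfl).trans ((hk₁.2 rfl).trans hmem)
      refine (Ex.searchRow hm hw hr htb hC h41 h42 h43 h44 h26 h53 h51 (by omega) h49 h52 hS hj
        (hmem ▸ hT)).seq fun τ₃ hk₃ hQ => ?_
      have hC := hC.keep hk₃ rfl
      have h46 := (hk₃.reg 46 rfl).trans h46
      have h48 := (hk₃.reg 48 rfl).trans h48
      have h50 := (hk₃.reg 50 rfl).trans h50
      have h51 := (hk₃.reg 51 rfl).trans h51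
      rw [hmem] at hQ
      refine (Ex.straight (Q := fun τ => τ.reg 10 = enc B (a l * g l ^ x) ∧
        τ.reg 11 = enc B (g l)) ?_ ?_).seq ?_
      · simp
      · simp [hC.r90, h50, h46]
      rintro τ₄ hk₄ ⟨h10, h11⟩
      have hC := hC.keep hk₄ rfl
      have h48 := (hk₄.reg 48 rfl).trans h48
      have h51 := (hk₄.reg 51 rfl).trans h51
      refine (Ex.fmul hw2 hC h10 h11).seq fun τ₅ hk₅ h12 => ?_
      have hC := hC.keep hk₅ rfl
      have h48 := (hk₅.reg 48 rfl).trans h48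
      have h51 := (hk₅.reg 51 rfl).trans h51
      have h49 := (hk₅.reg 49 rfl).trans (hk₄.reg 49 rfl)
      have h52 := (hk₅.reg 52 rfl).trans (hk₄.reg 52 rfl)
      refine Ex.straight ?_ ?_
      · simp [h51, h48]; omega
      · rcases hQ with ⟨q1, x', c, q3, q4, q5, q6⟩ | ⟨q1, q2, q3⟩
        · refine .inl ⟨q1, by simp [h52, q6, hC.r91],
            c + x' * (p ^ B.dim) ^ j + x * (p ^ B.dim) ^ l, ?_, ?_⟩
          · simp [h49, q5]; ring
          · have := (q4.add_index hjS q3).add_index hlS (by omega : x ≤ r l)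
            simpa using this
        · refine .inr ⟨?_, by simp [h52, q3, hC.r91, Nat.sub_sub], ?_, ?_, ?_⟩
          · rintro ⟨x', hx', hne⟩
            exact q1 x' hx' hne
          · simp [hC.r90, h12, pow_succ, mul_assoc]
          · simp [h51, h48]; ring
          · simp [h49, q2]
    · exact hh
    · rintro τ hk (⟨h1, h2⟩ | ⟨h1, h2⟩)
      · exact .inl h2
      · refine .inr ⟨h2.2.2, fun c hc => ?_⟩
        obtain ⟨y₁, c₁, x, hs, hx, rfl, -⟩ := hc.of_insert hlS
        obtain ⟨y₂, c₂, x', hs', hx', rfl, -⟩ := hs.of_insert hjS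
        refine h1 x (by omega) ⟨x', by omega, (hSol _).1 ⟨c₂, ?_⟩⟩
        convert hs' using 1
        ring
  · have h2 : 1 ≤ (B.dim + 1) ^ 2 := Nat.one_le_pow _ _ (by omega)
    have h1 : 2 + ((12 * B.dim + 5) + (1 +
      (((r j + 1) * (80 * (B.dim + 1) ^ 2) + 4) + (2 + (60 * (B.dim + 1) ^ 2 + 3))))) + 1 ≤
      (r j + 1) * (200 * (B.dim + 1) ^ 2) := by nlinarith
    have := Nat.mul_le_mul_left h h1
    nlinarith

end

/-! ### Reading the input -/

/-- Read the coordinates of a field element from the address in register `70` on into register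
`71`, and advance the address. -/
def readVec : Prog :=
  (.const 71 0 ;; .const 72 1 ;; mov 73 93) ;;
  rep 73 (.load 74 70 ;; .arith .mul 74 74 72 ;; .arith .add 71 71 74 ;; .arith .mul 72 72 92 ;;
    .arith .add 70 70 91)

/-- Read as many field elements as register `99` says and store them from the address in register
`75` on. -/
def readVecs : Prog :=
  mov 76 99 ;; rep 76 (readVec ;; (.store 75 71 ;; .arith .add 75 75 91))

/-- Compute the parameters of the field and of the memory layout. -/
def readParams : Prog :=
  (.const 91 1 ;; .load 92 90 ;; .load 93 91 ;; .const 1 2 ;; .load 99 1 ;; .arith .sub 97 92 91 ;;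
    .const 95 1 ;; .arith .sub 2 93 91) ;;
  rep 2 (.arith .mul 95 95 92) ;;
  (.arith .mul 94 95 92 ;; .const 70 3 ;; .arith .add 98 99 1 ;; .arith .add 3 99 99 ;;
    .arith .add 3 3 1 ;; .arith .mul 3 3 93 ;; .arith .add 100 3 70 ;; .arith .add 101 100 98 ;;
    .arith .add 102 101 98 ;; .arith .add 103 102 98 ;; .arith .add 26 103 98)

/-- Store the orders minus one of the elements whose number is in register `99` and which are stored
from the address in register `101` on, from the address in register `102` on. -/
def orders : Prog :=
  (mov 77 101 ;; mov 75 102 ;; mov 76 99) ;;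
  rep 76 (.load 20 77 ;; orderProg ;;
    (.store 75 21 ;; .arith .add 75 75 91 ;; .arith .add 77 77 91))

/-- Read the input. -/
def readInput : Prog :=
  readParams ;; readVec ;; mov 96 71 ;; mov 75 100 ;; readVecs ;; mov 75 101 ;; readVecs ;;
    readVec ;; mov 104 71 ;; orders

section

variable {p : ℕ} [hp : Fact p.Prime] {F : Type*} [Field F] [Algebra (ZMod p) F]
  {B : PowerBasis (ZMod p) F} {w : ℕ} {σ τ : State}

theorem Ex.readVec (hw : (p ^ B.dim) ^ 2 < 2 ^ w) (h90 : σ.reg 90 = 0) (h91 : σ.reg 91 = 1)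
    (h92 : σ.reg 92 = p) (h93 : σ.reg 93 = B.dim) {A : ℕ} (h70 : σ.reg 70 = A) {y : F}
    (hA : A + B.dim < 2 ^ w) (hy : ∀ i < B.dim, σ.mem (A + i) = dg B y i) :
    Ex w readVec σ (7 * B.dim + 4) fun τ => τ.reg 71 = enc B y ∧ τ.reg 70 = A + B.dim := by
  have hqw : p ^ B.dim < 2 ^ w := lt_of_le_of_lt (Nat.le_self_pow two_ne_zero _) hw
  have hw0 : w ≠ 0 := by
    rintro rfl
    have := pow_pos hp.out.pos B.dim
    omega
  let I : ℕ → State → Prop := fun i τ =>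
    τ.reg 71 = ∑ j ∈ Finset.range i, dg B y j * p ^ j ∧ τ.reg 72 = p ^ i ∧ τ.reg 70 = A + i
  refine Ex.mono (k := 3 + (B.dim * (5 + 2) + 1)) ?_ (by omega)
  refine (Ex.straight (Q := fun τ => I 0 τ ∧ τ.reg 73 = B.dim) ?_ ?_).seq ?_
  · simp [hw0]
  · simp [I, h90, h93, h70]
  rintro τ hk ⟨hI, h73⟩
  have h91 := (hk.reg 91 rfl).trans h91
  have h92 := (hk.reg 92 rfl).trans h92
  have hmem := hk.2 rfl
  refine (Ex.rep I hI h73 h91 rfl rfl ?_).call le_rfl fun _ _ h => ⟨h.1, h.2.2⟩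
  rintro i hi σ hk ⟨i71, i72, i70⟩ -
  have h91 := (hk.reg 91 rfl).trans h91
  have h92 := (hk.reg 92 rfl).trans h92
  have hmem := (hk.2 rfl).trans hmem
  have hpi : p ^ i * p ≤ p ^ B.dim := by
    rw [← pow_succ]; exact pow_le_pow_dim B hi
  have hs := sum_digits_lt hp.out.pos (dg B y) (dg_lt B y) (i + 1)
  rw [Finset.sum_range_succ, pow_succ] at hs
  have hyi := hy i hi
  refine Ex.straight ?_ ?_
  · simp [i70, i71, i72, h91, h92, hmem, hyi]
    refine ⟨?_, ?_, ?_, ?_⟩ <;> omega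
  · simp [I, i70, i71, i72, h91, h92, hmem, hyi, Finset.sum_range_succ, pow_succ, add_assoc]

theorem Ex.readVecs (hw : (p ^ B.dim) ^ 2 < 2 ^ w) (h90 : σ.reg 90 = 0) (h91 : σ.reg 91 = 1)
    (h92 : σ.reg 92 = p) (h93 : σ.reg 93 = B.dim) {A O n : ℕ} (h99 : σ.reg 99 = n)
    (h70 : σ.reg 70 = A) (h75 : σ.reg 75 = O) {y : ℕ → F} (hAO : A + n * B.dim ≤ O)
    (hO : O + n < 2 ^ w)
    (hy : ∀ k < n, ∀ i < B.dim, σ.mem (A + k * B.dim + i) = dg B (y k) i) :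
    Ex w readVecs σ (n * (7 * B.dim + 8) + 2) fun τ => τ.reg 70 = A + n * B.dim ∧
      (∀ k < n, τ.mem (O + k) = enc B (y k)) ∧
      ∀ k, (k < O ∨ O + n ≤ k) → τ.mem k = σ.mem k := by
  let I : ℕ → State → Prop := fun e τ => τ.reg 70 = A + e * B.dim ∧ τ.reg 75 = O + e ∧
    (∀ k < e, τ.mem (O + k) = enc B (y k)) ∧ ∀ k, (k < O ∨ O + e ≤ k) → τ.mem k = σ.mem k
  refine Ex.mono (k := 1 + (n * (((7 * B.dim + 4) + 2) + 2) + 1)) ?_ (by ring_nf; omega)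
  refine (Ex.straight (P := mov 76 99) (Q := fun τ => I 0 τ ∧ τ.reg 76 = n) ?_ ?_).seq ?_
  · simp
  · simp [I, h90, h99, h70, h75]
  rintro τ hk ⟨hI, h76⟩
  have h90 := (hk.reg 90 rfl).trans h90
  have h91 := (hk.reg 91 rfl).trans h91
  have h92 := (hk.reg 92 rfl).trans h92
  have h93 := (hk.reg 93 rfl).trans h93
  refine (Ex.rep I hI h76 h91 rfl rfl ?_).call le_rfl fun _ _ h => ⟨h.1, h.2.2⟩
  rintro e he σ' hk ⟨h70, h75, hd, hu⟩ -
  have h90 := (hk.reg 90 rfl).trans h90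
  have h91 := (hk.reg 91 rfl).trans h91
  have h92 := (hk.reg 92 rfl).trans h92
  have h93 := (hk.reg 93 rfl).trans h93
  have hle : e * B.dim + B.dim ≤ n * B.dim := by
    rw [← Nat.succ_mul]; exact Nat.mul_le_mul_right _ he
  change Ex w _ _ ((7 * B.dim + 4) + 2) _
  refine (Ex.readVec hw h90 h91 h92 h93 h70 (y := y e) (by omega) ?_).seq ?_
  · intro i hi
    -- Stores only affect cells from `O` on, and `hAO` keeps the unread input below `O`.
    rw [hu _ (by omega)]
    exact hy e he i hi
  rintro τ hk ⟨h71, h70⟩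
  have h91 := (hk.reg 91 rfl).trans h91
  have h75 := (hk.reg 75 rfl).trans h75
  have hmem := hk.2 rfl
  refine Ex.straight ?_ ⟨?_, ?_, ?_, ?_⟩
  · simp [h75, h91]; omega
  · simp [h70]; ring
  · simp [h75, h91]; ring
  · intro k hk
    simp only [Prog.exec, State.setReg_mem, State.setMem_mem, h75, h71, hmem]
    rcases (by omega : k < e ∨ k = e) with h | rfl
    · rw [Function.update_of_ne (by omega)]; exact hd k h
    · simp
  · intro k hk
    simp only [Prog.exec, State.setReg_mem, State.setMem_mem, h75, h71, hmem]
    rw [Function.update_of_ne (by omega)]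
    exact hu k (by omega)

theorem Ex.orders [Finite F] (hw : (p ^ B.dim) ^ 2 < 2 ^ w) (hC : Cst B σ) {O n m : ℕ}
    (h99 : σ.reg 99 = n) (h101 : σ.reg 101 = O) (h102 : σ.reg 102 = O + m) (hnm : n ≤ m)
    (hO : O + m + n < 2 ^ w) {G : ℕ → Fˣ} (hord : ∀ k, orderOf (G k) ≤ p ^ B.dim)
    (hG : ∀ k < n, σ.mem (O + k) = enc B (G k : F)) :
    Ex w orders σ (n * (p ^ B.dim * (60 * (B.dim + 1) ^ 2 + 6) + 10) + 4) fun τ =>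
      (∀ k < n, τ.mem (O + m + k) = orderOf (G k) - 1) ∧
      ∀ k, (k < O + m ∨ O + m + n ≤ k) → τ.mem k = σ.mem k := by
  let I : ℕ → State → Prop := fun e τ => τ.reg 77 = O + e ∧ τ.reg 75 = O + m + e ∧
    (∀ k < e, τ.mem (O + m + k) = orderOf (G k) - 1) ∧
      ∀ k, (k < O + m ∨ O + m + e ≤ k) → τ.mem k = σ.mem k
  refine Ex.mono (k := 3 + (n * ((1 + ((p ^ B.dim * (60 * (B.dim + 1) ^ 2 + 6) + 4) + 3)) + 2) + 1))
    ?_ (by ring_nf; omega)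
  refine (Ex.straight (Q := fun τ => I 0 τ ∧ τ.reg 76 = n) ?_ ?_).seq ?_
  · simp
  · simp [I, hC.r90, h99, h101, h102]
  rintro τ hk ⟨hI, h76⟩
  have hC := hC.keep hk rfl
  refine (Ex.rep I hI h76 hC.r91 rfl rfl ?_).call le_rfl fun _ _ h => h.2.2
  rintro e he σ' hk ⟨h77, h75, hd, hu⟩ -
  have hC := hC.keep hk rfl
  refine (Ex.straight (P := .load 20 77) (Q := fun τ => τ.reg 20 = enc B (G e : F)) ?_ ?_).seq ?_
  · simp
  · simp [h77, hu _ (by omega : O + e < O + m ∨ _), hG e he]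
  intro τ hk h20
  have hC := hC.keep hk rfl
  have h77 := (hk.reg 77 rfl).trans h77
  have h75 := (hk.reg 75 rfl).trans h75
  have hmem := hk.2 rfl
  refine (Ex.orderProg hw hC h20 (hord e)).seq fun τ hk h21 => ?_
  have hC := hC.keep hk rfl
  have h77 := (hk.reg 77 rfl).trans h77
  have h75 := (hk.reg 75 rfl).trans h75
  have hmem := (hk.2 rfl).trans hmem
  refine Ex.straight ?_ ⟨?_, ?_, ?_, ?_⟩
  · simp [h75, h77, hC.r91]; omega
  · simp [h77, hC.r91]; ring
  · simp [h75, hC.r91]; ring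
  · intro k hk
    simp only [Prog.exec, State.setReg_mem, State.setMem_mem, h75, h21, hmem]
    rcases (by omega : k < e ∨ k = e) with h | rfl
    · rw [Function.update_of_ne (by omega)]; exact hd k h
    · simp
  · intro k hk
    simp only [Prog.exec, State.setReg_mem, State.setMem_mem, h75, h21, hmem]
    rw [Function.update_of_ne (by omega)]
    exact hu k (by omega)

/-- The configuration after reading the parameters `p`, `B.dim` and `n`. -/
structure Params (B : PowerBasis (ZMod p) F) (n D : ℕ) (σ : State) : Prop where
  r90 : σ.reg 90 = 0
  r91 : σ.reg 91 = 1
  r92 : σ.reg 92 = p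
  r93 : σ.reg 93 = B.dim
  r94 : σ.reg 94 = p ^ B.dim
  r95 : σ.reg 95 = p ^ (B.dim - 1)
  r97 : σ.reg 97 = p - 1
  r98 : σ.reg 98 = n + 2
  r99 : σ.reg 99 = n
  r100 : σ.reg 100 = D
  r101 : σ.reg 101 = D + (n + 2)
  r102 : σ.reg 102 = D + 2 * (n + 2)
  r103 : σ.reg 103 = D + 3 * (n + 2)
  r26 : σ.reg 26 = D + 4 * (n + 2)

/-- The program writes none of the registers holding parameters. -/
def Prog.pure (P : Prog) : Bool :=
  !(P.wr 90 || P.wr 91 || P.wr 92 || P.wr 93 || P.wr 94 || P.wr 95 || P.wr 97 || P.wr 98 ||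
    P.wr 99 || P.wr 100 || P.wr 101 || P.wr 102 || P.wr 103 || P.wr 26)

theorem Params.keep {n D : ℕ} {P : Prog} (h : Params B n D σ) (hk : Keep P σ τ)
    (hP : P.pure = true) : Params B n D τ := by
  simp only [Prog.pure, Bool.not_eq_true', Bool.or_eq_false_iff] at hP
  obtain ⟨⟨⟨⟨⟨⟨⟨⟨⟨⟨⟨⟨⟨h0, h1⟩, h2⟩, h3⟩, h4⟩, h5⟩, h6⟩, h7⟩, h8⟩, h9⟩, h10⟩, h11⟩, h12⟩, h13⟩ := hP
  exact ⟨(hk.reg _ h0).trans h.r90, (hk.reg _ h1).trans h.r91, (hk.reg _ h2).trans h.r92,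
    (hk.reg _ h3).trans h.r93, (hk.reg _ h4).trans h.r94, (hk.reg _ h5).trans h.r95,
    (hk.reg _ h6).trans h.r97, (hk.reg _ h7).trans h.r98, (hk.reg _ h8).trans h.r99,
    (hk.reg _ h9).trans h.r100, (hk.reg _ h10).trans h.r101, (hk.reg _ h11).trans h.r102,
    (hk.reg _ h12).trans h.r103, (hk.reg _ h13).trans h.r26⟩

theorem Params.cst {n D : ℕ} (h : Params B n D σ) (h96 : σ.reg 96 = enc B (minTail B)) :
    Cst B σ :=
  ⟨h.r90, h.r91, h.r92, h.r93, h.r94, h.r95, h96, h.r97⟩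

/-- Memory layout: the input fills the cells below `D`; then come four arrays of length `n + 2`
(coefficients, bases, orders minus one, marks); the tables start at `D + 4 (n + 2)`. The two extra
places in each array belong to the dummy terms. -/
theorem Ex.readParams {n D : ℕ} (hD : D = 3 + (2 * n + 2) * B.dim)
    (hw : (p ^ B.dim) ^ 2 < 2 ^ w) (hDw : D + 4 * (n + 2) < 2 ^ w) (h90 : σ.reg 90 = 0)
    (hp0 : σ.mem 0 = p) (hp1 : σ.mem 1 = B.dim) (hp2 : σ.mem 2 = n) :
    Ex w readParams σ (3 * B.dim + 20) fun τ => Params B n D τ ∧ τ.reg 70 = 3 := by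
  have hqw : p ^ B.dim < 2 ^ w := lt_of_le_of_lt (Nat.le_self_pow two_ne_zero _) hw
  have hν := B.dim_pos
  refine Ex.mono (k := 8 + ((B.dim - 1) * (1 + 2) + 1 + 11)) ?_ (by omega)
  refine (Ex.straight (Q := fun τ => τ.reg 90 = 0 ∧ τ.reg 91 = 1 ∧ τ.reg 92 = p ∧
    τ.reg 93 = B.dim ∧ τ.reg 1 = 2 ∧ τ.reg 99 = n ∧ τ.reg 97 = p - 1 ∧ τ.reg 95 = 1 ∧
    τ.reg 2 = B.dim - 1) ?_ ?_).seq ?_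
  · simp only [Prog.ok, and_true, true_and]
    omega
  · simp [h90, hp0, hp1, hp2]
  rintro τ hk ⟨h90, h91, h92, h93, h1, h99, h97, h95, h2⟩
  let I : ℕ → State → Prop := fun i τ => τ.reg 95 = p ^ i
  refine (Ex.rep I (by simpa [I] using h95) h2 h91 rfl rfl ?_).seq ?_
  · intro i hi σ hk h95 _
    have h92 := (hk.reg 92 rfl).trans h92
    have : p ^ (i + 1) ≤ p ^ B.dim := pow_le_pow_dim B (by omega)
    rw [pow_succ] at this
    have h95 : σ.reg 95 = p ^ i := h95
    refine Ex.straight (P := .arith .mul 95 95 92) ?_ ?_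
    · simp [h95, h92]; omega
    · simp [I, h95, h92, pow_succ]
  intro τ hk h95
  have h95 : τ.reg 95 = p ^ (B.dim - 1) := h95
  have h90 := (hk.reg 90 rfl).trans h90
  have h91 := (hk.reg 91 rfl).trans h91
  have h92 := (hk.reg 92 rfl).trans h92
  have h93 := (hk.reg 93 rfl).trans h93
  have h97 := (hk.reg 97 rfl).trans h97
  have h99 := (hk.reg 99 rfl).trans h99
  have h1 := (hk.reg 1 rfl).trans h1
  have e : p ^ (B.dim - 1) * p = p ^ B.dim := by
    rw [← pow_succ, Nat.sub_add_cancel hν]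
  have e2 : (n + n + 2) * B.dim + 3 = D := by rw [hD]; ring
  refine Ex.straight ?_ ⟨?_, ?_⟩
  · simp [h99, h1, h93, h95, h92, e, e2]
    refine ⟨?_, ?_, ?_, ?_, ?_, ?_, ?_, ?_, ?_, ?_⟩ <;> omega
  · constructor <;> simp [h99, h1, h93, h95, h92, e, e2, h90, h91, h97] <;> ring
  · simp

end

/-! ### Selecting the elements of largest order -/

/-- The largest value of `r i + 1` for `i < k` outside `U` (`0` if there is none), and the first
index where it is attained. -/
def best (r : ℕ → ℕ) (U : Finset ℕ) : ℕ → ℕ × ℕ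
  | 0 => (0, 0)
  | k + 1 => if k ∉ U ∧ (best r U k).1 < r k + 1 then (r k + 1, k) else best r U k

/-- Since `r i + 1` is recorded, the value 0 means that nothing was found, and terms of order 1 and
dummy terms, both with `r i = 0`, remain selectable. -/
theorem best_spec (r : ℕ → ℕ) (U : Finset ℕ) (k : ℕ) :
    ((best r U k).1 = 0 ∧ ∀ j < k, j ∈ U) ∨
      ((best r U k).2 < k ∧ (best r U k).2 ∉ U ∧ (best r U k).1 = r (best r U k).2 + 1 ∧
        ∀ j < k, j ∉ U → r j ≤ r (best r U k).2) := by
  induction k with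
  | zero => simp [best]
  | succ k ih =>
    rw [best]
    by_cases h : k ∉ U ∧ (best r U k).1 < r k + 1
    · rw [if_pos h]
      refine .inr ⟨by simp, h.1, rfl, fun j hj hjU => ?_⟩
      rcases (by omega : j < k ∨ j = k) with h1 | rfl
      · rcases ih with ⟨_, ih⟩ | ⟨_, _, h2, h3⟩
        · exact absurd (ih j h1) hjU
        · have := h3 j h1 hjU
          have := h.2
          simp only; omega
      · rfl
    · rw [if_neg h]
      rcases ih with ⟨h1, ih⟩ | ⟨h0, h1, h2, h3⟩
      · refine .inl ⟨h1, fun j hj => ?_⟩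
        rcases (by omega : j < k ∨ j = k) with h' | rfl
        · exact ih j h'
        · by_contra hU
          exact h ⟨hU, by omega⟩
      · refine .inr ⟨by omega, h1, h2, fun j hj hjU => ?_⟩
        rcases (by omega : j < k ∨ j = k) with h' | rfl
        · exact h3 j h' hjU
        · by_contra hlt
          exact h ⟨hjU, by omega⟩

/-- The first index outside `U` and below `m` where `r` is largest. -/
def sel (r : ℕ → ℕ) (m : ℕ) (U : Finset ℕ) : ℕ := (best r U m).2

theorem sel_spec {r : ℕ → ℕ} {m : ℕ} {U : Finset ℕ} (hU : U.card < m) :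
    sel r m U < m ∧ sel r m U ∉ U ∧ ∀ j < m, j ∉ U → r j ≤ r (sel r m U) := by
  rcases best_spec r U m with ⟨-, h⟩ | ⟨h1, h2, -, h3⟩
  · have : Finset.range m ⊆ U := fun j hj => h j (Finset.mem_range.1 hj)
    have := Finset.card_le_card this
    simp at this
    omega
  · exact ⟨h1, h2, h3⟩

/-- Put the index of the largest unmarked order and the corresponding power of `q` into registers
`60` and `61`, and mark the index. -/
def select : Prog :=
  (.const 62 0 ;; .const 60 0 ;; .const 61 1 ;; .const 63 0 ;; .const 64 1 ;; mov 65 98) ;;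
  rep 65 ((.arith .add 66 103 63 ;; .load 67 66) ;;
    .ite 67 (mov 69 90) ((.arith .add 66 102 63 ;; .load 67 66 ;; .arith .add 67 67 91 ;;
      .arith .sub 68 67 62) ;; .ite 68 (mov 62 67 ;; mov 60 63 ;; mov 61 64) (mov 69 90)) ;;
    (.arith .add 63 63 91 ;; .arith .mul 64 64 94)) ;;
  (.arith .add 66 103 60 ;; .store 66 91)

/-- Load the data for the index in register `60`. -/
def fetch : Prog :=
  .arith .add 66 100 60 ;; .load 24 66 ;; .arith .add 66 101 60 ;; .load 20 66 ;;
    .arith .add 66 102 60 ;; .load 21 66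

/-- Subtract all unmarked coefficients from the element in register `40`. -/
def shift : Prog :=
  (.const 63 0 ;; mov 65 98) ;;
  rep 65 ((.arith .add 66 103 63 ;; .load 67 66) ;;
    .ite 67 (mov 69 90) ((.arith .add 66 100 63 ;; .load 3 66 ;; mov 1 40) ;; fsub ;; mov 40 4) ;;
    .arith .add 63 63 91)

/-- Extend the table by all unmarked indices. -/
def extendAll : Prog :=
  (.const 60 0 ;; .const 61 1 ;; mov 65 98) ;;
  rep 65 ((.arith .add 66 103 60 ;; .load 67 66) ;;
    .ite 67 (mov 69 90) ((fetch ;; mov 25 61) ;; extend) ;;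
    (.arith .add 60 60 91 ;; .arith .mul 61 61 94))

/-- Write the answer. -/
def output : Prog :=
  .ite 49 (((.arith .sub 49 49 91 ;; .const 60 0 ;; mov 65 99) ;;
      rep 65 (.arith .mod 61 49 94 ;; .arith .div 49 49 94 ;; .store 60 61 ;;
        .arith .add 60 60 91)) ;; .const 0 1)
    (.const 0 0)

/-- Select an index and load its data. -/
def pick : Prog := select ;; fetch

/-- Select three indices, make the table for the first one, and load the data of the others. -/
def prepare : Prog :=
  .store 26 91 ;; pick ;; mov 25 61 ;; extend ;;
  pick ;; (mov 41 24 ;; mov 42 20 ;; mov 43 21 ;; mov 44 61) ;;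
  pick ;; (mov 45 24 ;; mov 46 20 ;; mov 47 21 ;; mov 48 61)

/-- Look for a solution of the equation described by the data in memory. -/
def solve : Prog :=
  prepare ;; mov 40 104 ;; shift ;; search ;;
  .ite 49 (mov 69 90) (extendAll ;; mov 40 104 ;; search) ;;
  output

section

variable {p : ℕ} [hp : Fact p.Prime] {F : Type*} [Field F] [Algebra (ZMod p) F]
  {B : PowerBasis (ZMod p) F} {w : ℕ} {σ τ : State} {a g : ℕ → F} {r : ℕ → ℕ} {U : Finset ℕ}
  {n m D : ℕ} {b : F}

/-- The arrays in memory: coefficients, bases, orders minus one, and marks. -/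
structure Arrays (B : PowerBasis (ZMod p) F) (a g : ℕ → F) (r : ℕ → ℕ) (m D : ℕ) (U : Finset ℕ)
    (mem : ℕ → ℕ) : Prop where
  coeff : ∀ i < m, mem (D + i) = enc B (a i)
  base : ∀ i < m, mem (D + m + i) = enc B (g i)
  order : ∀ i < m, mem (D + 2 * m + i) = r i
  mark : ∀ i < m, mem (D + 3 * m + i) = if i ∈ U then 1 else 0

theorem Arrays.congr {mem mem' : ℕ → ℕ} (h : Arrays B a g r m D U mem)
    (he : ∀ k < D + 4 * m, mem' k = mem k) : Arrays B a g r m D U mem' :=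
  ⟨fun i hi => (he _ (by omega)).trans (h.coeff i hi),
    fun i hi => (he _ (by omega)).trans (h.base i hi),
    fun i hi => (he _ (by omega)).trans (h.order i hi),
    fun i hi => (he _ (by omega)).trans (h.mark i hi)⟩

theorem Arrays.insert {mem : ℕ → ℕ} (h : Arrays B a g r m D U mem) {j : ℕ} (hj : j < m) :
    Arrays B a g r m D (insert j U) (Function.update mem (D + 3 * m + j) 1) := by
  refine ⟨fun i hi => ?_, fun i hi => ?_, fun i hi => ?_, fun i hi => ?_⟩
  · rw [Function.update_of_ne (by omega), h.coeff i hi]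
  · rw [Function.update_of_ne (by omega), h.base i hi]
  · rw [Function.update_of_ne (by omega), h.order i hi]
  · by_cases hij : i = j
    · subst hij; simp
    · rw [Function.update_of_ne (by omega), h.mark i hi]
      simp [hij]

/-- The registers describing the memory layout. -/
structure Layout (B : PowerBasis (ZMod p) F) (n m D : ℕ) (b : F) (σ : State) : Prop where
  cst : Cst B σ
  r98 : σ.reg 98 = m
  r99 : σ.reg 99 = n
  r100 : σ.reg 100 = D
  r101 : σ.reg 101 = D + m
  r102 : σ.reg 102 = D + 2 * m
  r103 : σ.reg 103 = D + 3 * m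
  r104 : σ.reg 104 = enc B b

/-- The program writes none of the registers describing the field and the memory layout. -/
def Prog.lay (P : Prog) : Bool :=
  P.low && !(P.wr 98 || P.wr 99 || P.wr 100 || P.wr 101 || P.wr 102 || P.wr 103 || P.wr 104)

theorem Layout.keep {P : Prog} (h : Layout B n m D b σ) (hk : Keep P σ τ) (hP : P.lay = true) :
    Layout B n m D b τ := by
  simp only [Prog.lay, Bool.and_eq_true, Bool.not_eq_true', Bool.or_eq_false_iff] at hP
  obtain ⟨hl, ⟨⟨⟨⟨⟨h0, h1⟩, h2⟩, h3⟩, h4⟩, h5⟩, h6⟩ := hP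
  exact ⟨h.cst.keep hk hl, (hk.reg _ h0).trans h.r98, (hk.reg _ h1).trans h.r99,
    (hk.reg _ h2).trans h.r100, (hk.reg _ h3).trans h.r101, (hk.reg _ h4).trans h.r102,
    (hk.reg _ h5).trans h.r103, (hk.reg _ h6).trans h.r104⟩

theorem Ex.select (hm : 2 ≤ m) (hw : 4 * (p ^ B.dim) ^ m < 2 ^ w) (hr : ∀ i, r i < p ^ B.dim)
    (hD : D + 4 * m < 2 ^ w) (hL : Layout B n m D b σ) (hA : Arrays B a g r m D U σ.mem)
    (hU : U.card < m) :
    Ex w select σ (m * 15 + 10) fun τ =>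
      τ.reg 60 = sel r m U ∧ τ.reg 61 = (p ^ B.dim) ^ sel r m U ∧
      Arrays B a g r m D (insert (sel r m U) U) τ.mem ∧
      ∀ k, D + 4 * m ≤ k → τ.mem k = σ.mem k := by
  have hw2 := sq_lt_of_word hm hw
  have hqw : p ^ B.dim < 2 ^ w := lt_of_le_of_lt (Nat.le_self_pow two_ne_zero _) hw2
  have hq0 : 0 < p ^ B.dim := pow_pos hp.out.pos _
  have hw0 : w ≠ 0 := by rintro rfl; omega
  let I : ℕ → State → Prop := fun k τ => τ.reg 62 = (best r U k).1 ∧ τ.reg 60 = (best r U k).2 ∧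
    τ.reg 61 = (p ^ B.dim) ^ (best r U k).2 ∧ τ.reg 63 = k ∧ τ.reg 64 = (p ^ B.dim) ^ k
  refine Ex.mono (k := 6 + ((m * ((2 + (((4 + (3 + 1)) + 1) + 2)) + 2) + 1) + 2)) ?_
    (by omega)
  refine (Ex.straight (Q := fun τ => I 0 τ ∧ τ.reg 65 = m) ?_ ?_).seq ?_
  · simp [hw0]
  · simp [I, best, hL.cst.r90, hL.r98]
  rintro τ hk ⟨hI, h65⟩
  have hL := hL.keep hk rfl
  have hmem := hk.2 rfl
  refine (Ex.rep I hI h65 hL.cst.r91 rfl rfl ?_).seq ?_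
  · rintro k hk' σ' hk ⟨h62, h60, h61, h63, h64⟩ -
    have hL := hL.keep hk rfl
    have hmem := (hk.2 rfl).trans hmem
    have hmark := hA.mark k hk'
    have hord := hA.order k hk'
    have hrk := hr k
    have hpow := mul_pow_le (le_refl (p ^ B.dim)) hk' hq0
    rw [mul_comm] at hpow
    refine (Ex.straight (Q := fun τ => τ.reg 67 = if k ∈ U then 1 else 0) ?_ ?_).seq ?_
    · simp [h63, hL.r103]; omega
    · simp [h63, hL.r103, hmem, hmark]
    intro τ hk h67
    have hL := hL.keep hk rfl
    have hmem := (hk.2 rfl).trans hmem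
    have h60 := (hk.reg 60 rfl).trans h60
    have h61 := (hk.reg 61 rfl).trans h61
    have h62 := (hk.reg 62 rfl).trans h62
    have h63 := (hk.reg 63 rfl).trans h63
    have h64 := (hk.reg 64 rfl).trans h64
    change Ex w _ _ (((4 + (3 + 1)) + 1) + 2) _
    refine (Ex.ite (Q := fun τ => τ.reg 62 = (best r U (k + 1)).1 ∧
      τ.reg 60 = (best r U (k + 1)).2 ∧ τ.reg 61 = (p ^ B.dim) ^ (best r U (k + 1)).2)
      (fun h0 => ?_) (fun h0 => ?_)).seq ?_
    · have hkU : k ∈ U := by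
        by_contra h; rw [h67, if_neg h] at h0; exact h0 rfl
      refine (Ex.straight (P := mov 69 90) (by simp) ?_).mono (by simp [Prog.len])
      rw [best, if_neg (by simp [hkU])]
      simp [h60, h61, h62]
    · have hkU : k ∉ U := by
        intro h; rw [h67, if_pos h] at h0; omega
      refine (Ex.straight (Q := fun τ => τ.reg 67 = r k + 1 ∧
        τ.reg 68 = r k + 1 - (best r U k).1) ?_ ?_).seq ?_
      · simp [h63, hL.r102, hmem, hord, hL.cst.r91]; omega
      · simp [h63, hL.r102, hmem, hord, hL.cst.r91, h62]
      rintro τ hk ⟨h67, h68⟩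
      have hL := hL.keep hk rfl
      have h60 := (hk.reg 60 rfl).trans h60
      have h61 := (hk.reg 61 rfl).trans h61
      have h62 := (hk.reg 62 rfl).trans h62
      have h63 := (hk.reg 63 rfl).trans h63
      have h64 := (hk.reg 64 rfl).trans h64
      refine Ex.ite (fun h0 => ?_) (fun h0 => ?_)
      · refine Ex.straight (P := mov 62 67 ;; mov 60 63 ;; mov 61 64) (by simp) ?_
        rw [best, if_pos ⟨hkU, by omega⟩]
        simp [h67, h63, h64, hL.cst.r90]
      · refine (Ex.straight (P := mov 69 90) (by simp) ?_).mono (by simp [Prog.len])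
        rw [best, if_neg (by simp [hkU]; omega)]
        simp [h60, h61, h62]
    · rintro τ hk ⟨h62, h60, h61⟩
      have hL := hL.keep hk rfl
      have h63 := (hk.reg 63 rfl).trans h63
      have h64 := (hk.reg 64 rfl).trans h64
      refine Ex.straight ?_ ⟨?_, ?_, ?_, ?_, ?_⟩
      · simp [h63, h64, hL.cst.r91, hL.cst.r94]; omega
      · simp [h62]
      · simp [h60]
      · simp [h61]
      · simp [h63, hL.cst.r91]
      · simp [h64, hL.cst.r94, pow_succ]
  · rintro τ hk ⟨h62, h60, h61, -, -⟩
    have hL := hL.keep hk rfl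
    have hmem := (hk.2 rfl).trans hmem
    have hlt := (sel_spec (r := r) hU).1
    have h60 : τ.reg 60 = sel r m U := h60
    refine Ex.straight ?_ ⟨?_, ?_, ?_, ?_⟩
    · simp [h60, hL.r103]; omega
    · simp [h60]
    · simp [h61, sel]
    · simp only [Prog.exec, State.setMem_mem, State.setReg_reg, State.setReg_mem, Op.eval, if_true,
        h60, hL.r103, hmem, if_false, hL.cst.r91, Nat.reduceEqDiff]
      exact hA.insert hlt
    · intro k hk
      simp only [Prog.exec, State.setMem_mem, State.setReg_reg, State.setReg_mem, Op.eval, if_true,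
        h60, hL.r103, hmem]
      rw [Function.update_of_ne (by omega)]

theorem Ex.pick (hm : 2 ≤ m) (hw : 4 * (p ^ B.dim) ^ m < 2 ^ w) (hr : ∀ i, r i < p ^ B.dim)
    (hD : D + 4 * m < 2 ^ w) (hL : Layout B n m D b σ) (hA : Arrays B a g r m D U σ.mem)
    (hU : U.card < m) {i : ℕ} (hi : i = sel r m U) :
    Ex w pick σ (m * 15 + 16) fun τ =>
      τ.reg 61 = (p ^ B.dim) ^ i ∧ τ.reg 24 = enc B (a i) ∧ τ.reg 20 = enc B (g i) ∧
      τ.reg 21 = r i ∧ Arrays B a g r m D (insert i U) τ.mem ∧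
      ∀ k, D + 4 * m ≤ k → τ.mem k = σ.mem k := by
  have him := (sel_spec (r := r) hU).1
  rw [← hi] at him
  change Ex w (ExpZeros.select ;; fetch) σ ((m * 15 + 10) + 6) _
  refine (Ex.select hm hw hr hD hL hA hU).seq ?_
  rintro τ hk ⟨h60, h61, hA, hmem⟩
  rw [← hi] at h60 h61 hA
  have hL := hL.keep hk rfl
  have h₁ := hA.coeff i him
  have h₂ := hA.base i him
  have h₃ := hA.order i him
  refine Ex.straight (P := fetch) ?_ ⟨?_, ?_, ?_, ?_, ?_, ?_⟩
  · simp [fetch, h60, hL.r100, hL.r101, hL.r102]; omega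
  · simp [fetch, h61]
  · simp [fetch, h60, hL.r100, h₁]
  · simp [fetch, h60, hL.r101, h₂]
  · simp [fetch, h60, hL.r102, h₃]
  · simpa [fetch] using hA
  · simpa [fetch] using hmem

/-- A term with exponent 0 equals its coefficient. Subtracting the unmarked coefficients thus leaves
an equation in the selected terms alone. -/
theorem Ex.shift (hm : 2 ≤ m) (hw : 4 * (p ^ B.dim) ^ m < 2 ^ w)
    (hD : D + 4 * m < 2 ^ w) (hL : Layout B n m D b σ) (hA : Arrays B a g r m D U σ.mem)
    {v : F} (h40 : σ.reg 40 = enc B v) :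
    Ex w shift σ (m * (12 * B.dim + 15) + 3) fun τ =>
      τ.reg 40 = enc B (v - ∑ i ∈ (Finset.range m).filter (· ∉ U), a i) := by
  have hw2 := sq_lt_of_word hm hw
  have hqw : p ^ B.dim < 2 ^ w := lt_of_le_of_lt (Nat.le_self_pow two_ne_zero _) hw2
  let I : ℕ → State → Prop := fun k τ => τ.reg 63 = k ∧
    τ.reg 40 = enc B (v - ∑ i ∈ (Finset.range k).filter (· ∉ U), a i)
  refine Ex.mono (k := 2 + (m * ((2 + (((3 + ((12 * B.dim + 5) + 1)) + 1) + 1)) + 2) + 1)) ?_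
    (by ring_nf; omega)
  refine (Ex.straight (Q := fun τ => I 0 τ ∧ τ.reg 65 = m) ?_ ?_).seq ?_
  · simp
  · simp [I, h40, hL.cst.r90, hL.r98]
  rintro τ hk ⟨hI, h65⟩
  have hL := hL.keep hk rfl
  have hmem := hk.2 rfl
  refine (Ex.rep I hI h65 hL.cst.r91 rfl rfl ?_).call le_rfl fun _ _ h => h.2
  rintro k hk' σ' hk ⟨h63, h40⟩ -
  have hL := hL.keep hk rfl
  have hmem := (hk.2 rfl).trans hmem
  have hmark := hA.mark k hk'
  have hcoeff := hA.coeff k hk'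
  refine (Ex.straight (Q := fun τ => τ.reg 67 = if k ∈ U then 1 else 0) ?_ ?_).seq ?_
  · simp [h63, hL.r103]; omega
  · simp [h63, hL.r103, hmem, hmark]
  intro τ hk h67
  have hL := hL.keep hk rfl
  have hmem := (hk.2 rfl).trans hmem
  have h63 := (hk.reg 63 rfl).trans h63
  have h40 := (hk.reg 40 rfl).trans h40
  refine (Ex.ite (Q := fun τ =>
    τ.reg 40 = enc B (v - ∑ i ∈ (Finset.range (k + 1)).filter (· ∉ U), a i))
    (fun h0 => ?_) (fun h0 => ?_)).seq ?_
  · have hkU : k ∈ U := by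
      by_contra h; rw [h67, if_neg h] at h0; exact h0 rfl
    refine (Ex.straight (P := mov 69 90) (by simp) ?_).mono (by simp [Prog.len]; omega)
    rw [Finset.range_add_one, Finset.filter_insert, if_neg (by simpa using hkU)]
    simp [h40]
  · have hkU : k ∉ U := by
      intro h; rw [h67, if_pos h] at h0; omega
    refine (Ex.straight (Q := fun τ => τ.reg 3 = enc B (a k) ∧
      τ.reg 1 = enc B (v - ∑ i ∈ (Finset.range k).filter (· ∉ U), a i)) ?_ ?_).seq ?_
    · simp [h63, hL.r100]; omega
    · simp [h63, hL.r100, hmem, hcoeff, hL.cst.r90, h40]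
    rintro τ hk ⟨h3, h1⟩
    have hL := hL.keep hk rfl
    refine (Ex.fsub hw2 hL.cst h1 h3).seq fun τ hk h4 => ?_
    have hL := hL.keep hk rfl
    refine Ex.straight (P := mov 40 4) (by simp) ?_
    rw [Finset.range_add_one, Finset.filter_insert, if_pos (by simpa using hkU),
      Finset.sum_insert (by simp)]
    simp [hL.cst.r90, h4]
    congr 1; ring
  · intro τ hk h40
    have hL := hL.keep hk rfl
    have h63 := (hk.reg 63 rfl).trans h63
    refine Ex.straight (P := .arith .add 63 63 91) ?_ ⟨?_, ?_⟩
    · simp [h63, hL.cst.r91]; omega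
    · simp [h63, hL.cst.r91]
    · simp [h40]

end

/-- The number of steps, up to a factor, for extending the table by the index `k`. -/
def extendCost (r : ℕ → ℕ) (q : ℕ) (U S : Finset ℕ) (k : ℕ) : ℕ :=
  if k ∈ U then 0 else
    q + min q (∏ i ∈ S ∪ (Finset.range k).filter (· ∉ U), (r i + 1)) * (r k + 1)

/-- The new exponents are 0: each new term contributes its coefficient and the code does not change.
This undoes `shift`, so a code found for the shifted element is already a code for `b`. -/
theorem Sol.mono {F : Type*} [Field F] {q : ℕ} {a g : ℕ → F} {r : ℕ → ℕ} {S T : Finset ℕ} {y : F}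
    {c : ℕ} (h : Sol q a g r S y c) (hST : S ⊆ T) :
    Sol q a g r T (y + ∑ i ∈ T \ S, a i) c := by
  classical
  obtain ⟨x, h1, rfl, rfl⟩ := h
  refine ⟨fun i => if i ∈ S then x i else 0, fun i _ => ?_, ?_, ?_⟩
  · simp only; split_ifs with hi
    · exact h1 i hi
    · exact Nat.zero_le _
  · rw [← Finset.sum_sdiff hST, add_comm]
    congr 1
    · exact Finset.sum_congr rfl fun i hi => by simp [(Finset.mem_sdiff.1 hi).2]
    · exact Finset.sum_congr rfl fun i hi => by simp [hi]
  · rw [← Finset.sum_sdiff hST, Finset.sum_eq_zero (s := T \ S), zero_add]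
    · exact Finset.sum_congr rfl fun i hi => by simp [hi]
    · intro i hi; simp [(Finset.mem_sdiff.1 hi).2]

section

variable {p : ℕ} [hp : Fact p.Prime] {F : Type*} [Field F] [Algebra (ZMod p) F]
  {B : PowerBasis (ZMod p) F} {w : ℕ} {σ τ : State} {a g : ℕ → F} {r : ℕ → ℕ} {U S : Finset ℕ}
  {n m D : ℕ} {b : F}

theorem Ex.extendAll {tb : ℕ} (hm : 2 ≤ m) (hw : 4 * (p ^ B.dim) ^ m < 2 ^ w)
    (hr : ∀ i, r i < p ^ B.dim) (hDtb : D + 4 * m ≤ tb)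
    (htb : tb + (m + 2) * p ^ B.dim < 2 ^ w)
    (hL : Layout B n m D b σ) (hA : Arrays B a g r m D U σ.mem)
    (h26 : σ.reg 26 = tb) (hS : S ⊆ Finset.range m) (hSU : S ⊆ U)
    (hT : Tab B a g r S tb σ.mem) (hz : ∀ k, tb + p ^ B.dim ≤ k → σ.mem k = 0) :
    Ex w extendAll σ (15 * m + 4 + 100 * (B.dim + 1) ^ 2 *
        ∑ k ∈ Finset.range m, extendCost r (p ^ B.dim) U S k) fun τ =>
      τ.reg 26 ≤ tb + m * p ^ B.dim ∧
        Tab B a g r (S ∪ (Finset.range m).filter (· ∉ U)) (τ.reg 26) τ.mem := by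
  have hw2 := sq_lt_of_word hm hw
  have hqw : p ^ B.dim < 2 ^ w := lt_of_le_of_lt (Nat.le_self_pow two_ne_zero _) hw2
  have hq0 : 0 < p ^ B.dim := pow_pos hp.out.pos _
  have hw0 : w ≠ 0 := by rintro rfl; omega
  let I : ℕ → State → Prop := fun k τ => τ.reg 60 = k ∧ τ.reg 61 = (p ^ B.dim) ^ k ∧
    tb ≤ τ.reg 26 ∧ τ.reg 26 ≤ tb + k * p ^ B.dim ∧
    Tab B a g r (S ∪ (Finset.range k).filter (· ∉ U)) (τ.reg 26) τ.mem ∧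
    (∀ k < D + 4 * m, τ.mem k = σ.mem k) ∧ ∀ k, τ.reg 26 + p ^ B.dim ≤ k → τ.mem k = 0
  let kb : ℕ → ℕ := fun k => 7 + 100 * (B.dim + 1) ^ 2 * extendCost r (p ^ B.dim) U S k
  refine Ex.mono (k := 3 + (∑ k ∈ Finset.range m, ((2 + ((kb k + 1) + 2)) + 2) + 1)) ?_ ?_
  · refine (Ex.straight (Q := fun τ => I 0 τ ∧ τ.reg 65 = m) ?_ ?_).seq ?_
    · simp [hw0]
    · refine ⟨⟨?_, ?_, ?_, ?_, ?_, ?_, ?_⟩, ?_⟩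
      · simp
      · simp
      · simp [h26]
      · simp [h26]
      · simpa [h26] using hT
      · simp
      · simpa [h26] using hz
      · simp [hL.r98, hL.cst.r90]
    rintro τ hk ⟨hI, h65⟩
    have hL := hL.keep hk rfl
    refine (Ex.rep_sum I hI h65 hL.cst.r91 rfl rfl ?_).call le_rfl
      fun _ _ h => ⟨h.2.2.2.1, h.2.2.2.2.1⟩
    rintro k hk' σ' hk ⟨h60, h61, h26l, h26u, hT, hold, hz⟩ -
    have hL := hL.keep hk rfl
    have hA := hA.congr hold
    have hmark := hA.mark k hk'
    have hkq : k * p ^ B.dim ≤ m * p ^ B.dim := Nat.mul_le_mul_right _ hk'.le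
    have hpow := mul_pow_le (le_refl (p ^ B.dim)) hk' hq0
    rw [mul_comm] at hpow
    rw [add_mul] at htb
    refine (Ex.straight (Q := fun τ => (τ.reg 67 = if k ∈ U then 1 else 0) ∧ τ.mem = σ'.mem)
      ?_ ?_).seq ?_
    · simp [h60, hL.r103]; omega
    · simp [h60, hL.r103, hmark]
    rintro τ hk ⟨h67, hmem⟩
    have hL := hL.keep hk rfl
    have h60 := (hk.reg 60 rfl).trans h60
    have h61 := (hk.reg 61 rfl).trans h61
    rw [← hmem] at hT hold hz hA
    rw [← hk.reg 26 rfl] at hT h26l h26u hz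
    change Ex w _ _ ((kb k + 1) + 2) _
    refine (Ex.ite (Q := fun τ => tb ≤ τ.reg 26 ∧ τ.reg 26 ≤ tb + (k + 1) * p ^ B.dim ∧
      Tab B a g r (S ∪ (Finset.range (k + 1)).filter (· ∉ U)) (τ.reg 26) τ.mem ∧
      (∀ k < D + 4 * m, τ.mem k = σ.mem k) ∧ ∀ k, τ.reg 26 + p ^ B.dim ≤ k → τ.mem k = 0)
      (fun h0 => ?_) (fun h0 => ?_)).seq ?_
    · have hkU : k ∈ U := by
        by_contra h; rw [h67, if_neg h] at h0; exact h0 rfl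
      refine (Ex.straight (P := mov 69 90) (by simp) ?_).mono (by simp [Prog.len, kb]; omega)
      rw [Finset.range_add_one, Finset.filter_insert, if_neg (by simpa using hkU)]
      refine ⟨?_, ?_, ?_, ?_, ?_⟩
      · simpa using h26l
      · simp only [Prog.exec, mov, State.setReg_reg]
        rw [add_mul]; simp; omega
      · simpa using hT
      · simpa using hold
      · simpa using hz
    · have hkU : k ∉ U := by
        intro h; rw [h67, if_pos h] at h0; omega
      -- The number of entries is at most `q` and at most the number of exponent vectors entered so
      -- far.
      have hcost : 7 + 100 * (B.dim + 1) ^ 2 * (p ^ B.dim +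
          cnt (p ^ B.dim) (τ.reg 26) τ.mem * (r k + 1)) ≤ kb k := by
        have := le_min (cnt_le (p ^ B.dim) (τ.reg 26) τ.mem) hT.cnt_le
        simp only [kb, extendCost, if_neg hkU]
        gcongr
      have hcoeff := hA.coeff k hk'
      have hbase := hA.base k hk'
      have horder := hA.order k hk'
      refine Ex.mono (k := 7 + 100 * (B.dim + 1) ^ 2 * (p ^ B.dim +
          cnt (p ^ B.dim) (τ.reg 26) τ.mem * (r k + 1))) ?_ hcost
      refine (Ex.straight (Q := fun τ' => τ'.reg 24 = enc B (a k) ∧ τ'.reg 20 = enc B (g k) ∧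
        τ'.reg 21 = r k ∧ τ'.reg 25 = (p ^ B.dim) ^ k ∧ τ'.mem = τ.mem) ?_ ?_).seq ?_
      · simp [fetch, h60, hL.r100, hL.r101, hL.r102]; omega
      · simp [fetch, h60, h61, hL.r100, hL.r101, hL.r102, hL.cst.r90, hcoeff, hbase, horder]
      rintro τ' hk₁ ⟨h24, h20, h21, h25, hmem⟩
      have hL := hL.keep hk₁ rfl
      rw [← hmem] at hT hold hz ⊢
      rw [← hk₁.reg 26 rfl] at hT h26l h26u hz ⊢
      refine (Ex.extend hm hw hr (by omega) hL.cst h24 h20 h21 h25 rfl ?_ hk' ?_ hT hz).call le_rfl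
        fun τ'' hk₂ h => ⟨?_, ?_, ?_, ?_, ?_⟩
      · refine Finset.union_subset hS fun i hi => ?_
        simp only [Finset.mem_filter, Finset.mem_range] at hi ⊢
        omega
      · simp only [Finset.mem_union, Finset.mem_filter, Finset.mem_range, lt_irrefl, false_and,
          or_false]
        exact fun h => hkU (hSU h)
      · rw [h.1]; omega
      · rw [h.1, add_mul]; omega
      · rw [h.1, Finset.range_add_one, Finset.filter_insert, if_pos (by simpa using hkU),
          Finset.union_insert]
        exact h.2.1
      · intro i hi
        rw [h.2.2.1 i (by omega), hold i hi]
      · rw [h.1]; exact h.2.2.2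
    · rintro τ hk ⟨h26l, h26u, hT, hold, hz⟩
      have hL := hL.keep hk rfl
      have h60 := (hk.reg 60 rfl).trans h60
      have h61 := (hk.reg 61 rfl).trans h61
      refine Ex.straight ?_ ⟨?_, ?_, ?_, ?_, ?_, ?_, ?_⟩
      · simp [h60, h61, hL.cst.r91, hL.cst.r94]; omega
      · simp [h60, hL.cst.r91]
      · simp [h61, hL.cst.r94, pow_succ]
      · simpa using h26l
      · simpa using h26u
      · simpa using hT
      · simpa using hold
      · simpa using hz
  · have h1 : ∀ k, (2 + ((kb k + 1) + 2)) + 2 =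
        14 + 100 * (B.dim + 1) ^ 2 * extendCost r (p ^ B.dim) U S k := fun k => by
      simp only [kb]; ring
    simp only [h1, Finset.sum_add_distrib, ← Finset.mul_sum, Finset.sum_const, Finset.card_range,
      smul_eq_mul]
    omega

theorem Ex.output (hm : 2 ≤ m) (hnm : n ≤ m) (hw : 4 * (p ^ B.dim) ^ m < 2 ^ w)
    (hn : n < 2 ^ w) (hr : ∀ i, r i < p ^ B.dim) (hL : Layout B n m D b σ)
    (h : (∃ c, σ.reg 49 = c + 1 ∧ Sol (p ^ B.dim) a g r (Finset.range m) b c) ∨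
      (σ.reg 49 = 0 ∧ ∀ c, ¬ Sol (p ^ B.dim) a g r (Finset.range m) b c)) :
    Ex w output σ (6 * n + 7) fun τ =>
      (τ.reg 0 = 1 ∧ ∃ x : ℕ → ℕ, (∀ i < m, x i ≤ r i) ∧
        b = ∑ i ∈ Finset.range m, a i * g i ^ x i ∧ ∀ i < n, τ.mem i = x i) ∨
      (τ.reg 0 = 0 ∧ ∀ x : ℕ → ℕ, (∀ i < m, x i ≤ r i) →
        b ≠ ∑ i ∈ Finset.range m, a i * g i ^ x i) := by
  have hw2 := sq_lt_of_word hm hw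
  have hqw : p ^ B.dim < 2 ^ w := lt_of_le_of_lt (Nat.le_self_pow two_ne_zero _) hw2
  have hq0 : 0 < p ^ B.dim := pow_pos hp.out.pos _
  have hw0 : w ≠ 0 := by rintro rfl; omega
  refine Ex.mono (k := ((3 + (n * (4 + 2) + 1)) + 1) + 1) ?_ (by omega)
  refine Ex.ite (fun h0 => ?_) (fun h0 => ?_)
  · rcases h with ⟨c, h49, x, hx, hb, hc⟩ | h
    swap; · exact absurd h.1 h0
    -- Exponents beyond `m` are unconstrained, but the digit lemma wants every digit below the base.
    let d : ℕ → ℕ := fun i => if i < m then x i else 0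
    have hd : ∀ i, d i < p ^ B.dim := fun i => by
      simp only [d]; split_ifs with hi
      · exact (hx i (Finset.mem_range.2 hi)).trans_lt (hr i)
      · exact hq0
    have hcd : c = ∑ i ∈ Finset.range m, d i * (p ^ B.dim) ^ i := by
      rw [hc]
      exact Finset.sum_congr rfl fun i hi => by simp [d, Finset.mem_range.1 hi]
    have hdig : ∀ i < m, c / (p ^ B.dim) ^ i % p ^ B.dim = x i := fun i hi => by
      rw [hcd, sum_digits_div_mod hq0 d hd hi]; simp [d, hi]
    let I : ℕ → State → Prop := fun k τ => τ.reg 49 = c / (p ^ B.dim) ^ k ∧ τ.reg 60 = k ∧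
      ∀ i < k, τ.mem i = x i
    refine Ex.seq (R := I n) ?_ fun τ hk hI => ?_
    · refine (Ex.straight (Q := fun τ => I 0 τ ∧ τ.reg 65 = n) ?_ ?_).seq ?_
      · simp
      · simp [I, h49, hL.cst.r91, hL.cst.r90, hL.r99]
      rintro τ hk ⟨hI, h65⟩
      have hL := hL.keep hk rfl
      refine Ex.rep I hI h65 hL.cst.r91 rfl rfl ?_
      rintro k hk' σ' hk ⟨h49, h60, hold⟩ -
      have hL := hL.keep hk rfl
      refine Ex.straight ?_ ⟨?_, ?_, ?_⟩
      · simp [h60, hL.cst.r91]; omega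
      · simp [h49, hL.cst.r94, Nat.div_div_eq_div_mul, pow_succ]
      · simp [h60, hL.cst.r91]
      · intro i hi
        simp only [Prog.exec, State.setMem_mem, State.setReg_mem, State.setReg_reg, if_true,
          if_false, Nat.reduceEqDiff, h60, h49, hL.cst.r94, Op.eval]
        rcases (by omega : i < k ∨ i = k) with h | rfl
        · rw [Function.update_of_ne (by omega)]; exact hold i h
        · simp [hdig i (by omega)]
    · refine Ex.straight (P := .const 0 1) (by simp [hw0]) (.inl ⟨by simp, x, ?_, hb, ?_⟩)
      · exact fun i hi => hx i (Finset.mem_range.2 hi)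
      · simpa using hI.2.2
  · rcases h with ⟨c, h49, -⟩ | h
    · omega
    refine (Ex.straight (P := .const 0 0) (by simp) (.inr ⟨by simp, ?_⟩)).mono
      (by simp [Prog.len])
    exact fun x hx hb => h.2 _ ⟨x, fun i hi => hx i (Finset.mem_range.1 hi), hb, rfl⟩

/-- The state after selecting three indices. -/
structure Prepared (B : PowerBasis (ZMod p) F) (a g : ℕ → F) (r : ℕ → ℕ) (n m D : ℕ) (b : F)
    (U₁ U₃ : Finset ℕ) (i₂ i₃ tb : ℕ) (σ : State) : Prop where
  lay : Layout B n m D b σ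
  arr : Arrays B a g r m D U₃ σ.mem
  r26 : σ.reg 26 = tb
  tab : Tab B a g r U₁ tb σ.mem
  zero : ∀ k, tb + p ^ B.dim ≤ k → σ.mem k = 0
  r41 : σ.reg 41 = enc B (a i₂)
  r42 : σ.reg 42 = enc B (g i₂)
  r43 : σ.reg 43 = r i₂
  r44 : σ.reg 44 = (p ^ B.dim) ^ i₂
  r45 : σ.reg 45 = enc B (a i₃)
  r46 : σ.reg 46 = enc B (g i₃)
  r47 : σ.reg 47 = r i₃
  r48 : σ.reg 48 = (p ^ B.dim) ^ i₃

theorem Prepared.keep {U₁ U₃ : Finset ℕ} {i₂ i₃ tb : ℕ} {P : Prog}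
    (h : Prepared B a g r n m D b U₁ U₃ i₂ i₃ tb σ) (hk : Keep P σ τ)
    (hP : (P.lay && !(P.st || P.wr 26 || P.wr 41 || P.wr 42 || P.wr 43 || P.wr 44 || P.wr 45 ||
      P.wr 46 || P.wr 47 || P.wr 48)) = true) :
    Prepared B a g r n m D b U₁ U₃ i₂ i₃ tb τ := by
  simp only [Bool.and_eq_true, Bool.not_eq_true', Bool.or_eq_false_iff] at hP
  obtain ⟨hl, ⟨⟨⟨⟨⟨⟨⟨⟨hs, h26⟩, h1⟩, h2⟩, h3⟩, h4⟩, h5⟩, h6⟩, h7⟩, h8⟩ := hP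
  have hm := hk.2 hs
  exact ⟨h.lay.keep hk hl, hm ▸ h.arr, (hk.reg _ h26).trans h.r26, hm ▸ h.tab, hm ▸ h.zero,
    (hk.reg _ h1).trans h.r41, (hk.reg _ h2).trans h.r42, (hk.reg _ h3).trans h.r43,
    (hk.reg _ h4).trans h.r44, (hk.reg _ h5).trans h.r45, (hk.reg _ h6).trans h.r46,
    (hk.reg _ h7).trans h.r47, (hk.reg _ h8).trans h.r48⟩

theorem Ex.prepare (hm : 3 ≤ m) (hw : 4 * (p ^ B.dim) ^ m < 2 ^ w)
    (hr : ∀ i, r i < p ^ B.dim) (hD : D + 4 * m + 2 * p ^ B.dim < 2 ^ w)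
    (hL : Layout B n m D b σ) (hA : Arrays B a g r m D ∅ σ.mem) (h26 : σ.reg 26 = D + 4 * m)
    (hz : ∀ k, D + 4 * m ≤ k → σ.mem k = 0) {U₁ U₂ U₃ : Finset ℕ} {i₁ i₂ i₃ : ℕ}
    (hi₁ : i₁ = sel r m ∅) (hU₁ : U₁ = {i₁}) (hi₂ : i₂ = sel r m U₁) (hU₂ : U₂ = insert i₂ U₁)
    (hi₃ : i₃ = sel r m U₂) (hU₃ : U₃ = insert i₃ U₂) (hc₁ : U₁.card < m) (hc₂ : U₂.card < m) :
    Ex w prepare σ (45 * m + 60 + 100 * (B.dim + 1) ^ 2 * (2 * p ^ B.dim))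
      (Prepared B a g r n m D b U₁ U₃ i₂ i₃ (D + 4 * m + p ^ B.dim)) := by
  have hm2 : 2 ≤ m := by omega
  have hw2 := sq_lt_of_word hm2 hw
  have hqw : p ^ B.dim < 2 ^ w := lt_of_le_of_lt (Nat.le_self_pow two_ne_zero _) hw2
  have hq0 : 0 < p ^ B.dim := pow_pos hp.out.pos _
  have hi₁m : i₁ < m := hi₁ ▸ (sel_spec (r := r) (m := m) (U := ∅) (by simp; omega)).1
  refine Ex.mono (k := 1 + ((m * 15 + 16) + (1 + (100 * (B.dim + 1) ^ 2 * (2 * p ^ B.dim) +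
    ((m * 15 + 16) + (4 + ((m * 15 + 16) + 4))))))) ?_ (by omega)
  -- Writing 1 into the first cell creates the table of the empty sum: its only value is 0, with
  -- code 0, hence entry 1.
  refine (Ex.straight (P := .store 26 91) (Q := fun τ => Arrays B a g r m D ∅ τ.mem ∧
    Tab B a g r ∅ (D + 4 * m) τ.mem ∧ ∀ k, D + 4 * m + p ^ B.dim ≤ k → τ.mem k = 0)
    (by simp) ?_).seq ?_
  · simp only [Prog.exec, State.setMem_mem, h26, hL.cst.r91]
    refine ⟨hA.congr fun k hk => Function.update_of_ne (by omega) _ _, ⟨fun y c hy => ?_,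
      fun y c hy => ?_⟩, fun k hk => ?_⟩
    · rw [Sol.empty]
      by_cases hy0 : enc B y = 0
      · rw [hy0] at hy
        simp at hy
        exact ⟨(enc_eq_zero B).1 hy0, hy⟩
      · rw [Function.update_of_ne (by omega), hz _ (by omega)] at hy
        omega
    · obtain ⟨rfl, rfl⟩ := Sol.empty.1 hy
      simp [enc_zero]
    · rw [Function.update_of_ne (by omega), hz _ (by omega)]
  rintro τ hk ⟨hA, hT, hz⟩
  have hL := hL.keep hk rfl
  have h26 := (hk.reg 26 rfl).trans h26
  refine (Ex.pick hm2 hw hr (by omega) hL hA (by simp; omega) hi₁).seq ?_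
  rintro τ' hk ⟨h61, h24, h20, h21, hA, hmem⟩
  rw [insert_empty_eq, ← hU₁] at hA
  have hL := hL.keep hk rfl
  have h26 := (hk.reg 26 rfl).trans h26
  have hT : Tab B a g r ∅ (D + 4 * m) τ'.mem := hT.congr fun k _ => hmem _ (by omega)
  have hz : ∀ k, D + 4 * m + p ^ B.dim ≤ k → τ'.mem k = 0 := fun k hk => by
    rw [hmem _ (by omega), hz k hk]
  clear hmem
  refine (Ex.straight (P := mov 25 61) (Q := fun τ => τ.reg 25 = (p ^ B.dim) ^ i₁)
    (by simp) (by simp [hL.cst.r90, h61])).seq ?_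
  intro τ hk h25
  have hL := hL.keep hk rfl
  have h20 := (hk.reg 20 rfl).trans h20
  have h21 := (hk.reg 21 rfl).trans h21
  have h24 := (hk.reg 24 rfl).trans h24
  have h26 := (hk.reg 26 rfl).trans h26
  rw [← hk.2 rfl] at hA hT hz
  -- This table has at most one entry, so its extension costs at most `q + q`.
  have hcost : 100 * (B.dim + 1) ^ 2 * (p ^ B.dim +
      cnt (p ^ B.dim) (D + 4 * m) τ.mem * (r i₁ + 1)) ≤
      100 * (B.dim + 1) ^ 2 * (2 * p ^ B.dim) := by
    have h1 := hT.cnt_le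
    rw [Finset.prod_empty] at h1
    have h2 := hr i₁
    gcongr
    nlinarith
  refine ((Ex.extend hm2 hw hr (by omega) hL.cst h24 h20 h21 h25 h26 (Finset.empty_subset _) hi₁m
    (by simp) hT hz).mono hcost).seq ?_
  rintro τ' hk ⟨h26, hT, hmem, hz⟩
  have hL := hL.keep hk rfl
  have hA := hA.congr (mem' := τ'.mem) fun k hk => hmem k (by omega)
  rw [insert_empty_eq, ← hU₁] at hT
  clear hmem
  refine (Ex.pick hm2 hw hr (by omega) hL hA hc₁ hi₂).seq ?_
  rintro τ hk ⟨h61, h24, h20, h21, hA, hmem⟩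
  rw [← hU₂] at hA
  have hL := hL.keep hk rfl
  have h26 := (hk.reg 26 rfl).trans h26
  have hT : Tab B a g r U₁ (D + 4 * m + p ^ B.dim) τ.mem :=
    hT.congr fun k _ => hmem _ (by omega)
  have hz : ∀ k, D + 4 * m + p ^ B.dim + p ^ B.dim ≤ k → τ.mem k = 0 := fun k hk => by
    rw [hmem _ (by omega), hz k hk]
  clear hmem
  refine (Ex.straight (Q := fun τ => τ.reg 41 = enc B (a i₂) ∧ τ.reg 42 = enc B (g i₂) ∧
    τ.reg 43 = r i₂ ∧ τ.reg 44 = (p ^ B.dim) ^ i₂) (by simp)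
    (by simp [h61, h24, h20, h21, hL.cst.r90])).seq ?_
  rintro τ' hk ⟨h41, h42, h43, h44⟩
  have hL := hL.keep hk rfl
  have h26 := (hk.reg 26 rfl).trans h26
  rw [← hk.2 rfl] at hA hT hz
  refine (Ex.pick hm2 hw hr (by omega) hL hA hc₂ hi₃).seq ?_
  rintro τ hk ⟨h61, h24, h20, h21, hA, hmem⟩
  rw [← hU₃] at hA
  have hL := hL.keep hk rfl
  have h26 := (hk.reg 26 rfl).trans h26
  have h41 := (hk.reg 41 rfl).trans h41
  have h42 := (hk.reg 42 rfl).trans h42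
  have h43 := (hk.reg 43 rfl).trans h43
  have h44 := (hk.reg 44 rfl).trans h44
  have hT : Tab B a g r U₁ (D + 4 * m + p ^ B.dim) τ.mem :=
    hT.congr fun k _ => hmem _ (by omega)
  have hz : ∀ k, D + 4 * m + p ^ B.dim + p ^ B.dim ≤ k → τ.mem k = 0 := fun k hk => by
    rw [hmem _ (by omega), hz k hk]
  refine (Ex.straight (P := mov 45 24 ;; mov 46 20 ;; mov 47 21 ;; mov 48 61)
    (Q := fun τ => τ.reg 45 = enc B (a i₃) ∧ τ.reg 46 = enc B (g i₃) ∧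
    τ.reg 47 = r i₃ ∧ τ.reg 48 = (p ^ B.dim) ^ i₃) (by simp)
    (by simp [h61, h24, h20, h21, hL.cst.r90])).call le_rfl ?_
  rintro τ' hk ⟨h45, h46, h47, h48⟩
  rw [← hk.2 rfl] at hA hT hz
  exact ⟨hL.keep hk rfl, hA, (hk.reg 26 rfl).trans h26, hT, hz, (hk.reg 41 rfl).trans h41,
    (hk.reg 42 rfl).trans h42, (hk.reg 43 rfl).trans h43, (hk.reg 44 rfl).trans h44,
    h45, h46, h47, h48⟩

/-- The number of steps of `solve` when the first search visits at most `h` values of its outer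
variable and the rest takes at most `X` steps. -/
def solveCost (q d n m r₂ h X : ℕ) : ℕ :=
  60 * m + 6 * n + 100 + 100 * (d + 1) ^ 2 * (2 * q + 2 * (h * (r₂ + 1)) + 1) +
    m * (12 * d + 15) + X

/-- Either `X` pays for extending the table and for a second, exhaustive search, or a solution with
small third exponent exists. In the latter case the fallback is never entered and `X` is arbitrary.
-/
theorem Ex.solve (hm : 3 ≤ m) (hnm : n ≤ m) (hw : 4 * (p ^ B.dim) ^ m < 2 ^ w)
    (hr : ∀ i, r i < p ^ B.dim) (hD : D + 4 * m + (m + 4) * p ^ B.dim < 2 ^ w)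
    (hL : Layout B n m D b σ) (hA : Arrays B a g r m D ∅ σ.mem) (h26 : σ.reg 26 = D + 4 * m)
    (hz : ∀ k, D + 4 * m ≤ k → σ.mem k = 0) {U₁ U₂ U₃ : Finset ℕ} {i₁ i₂ i₃ h X : ℕ}
    (hi₁ : i₁ = sel r m ∅) (hU₁ : U₁ = {i₁}) (hi₂ : i₂ = sel r m U₁) (hU₂ : U₂ = insert i₂ U₁)
    (hi₃ : i₃ = sel r m U₂) (hU₃ : U₃ = insert i₃ U₂)
    (hX : (r i₃ + 1 ≤ h ∧ 15 * m + 4 + 100 * (B.dim + 1) ^ 2 *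
        (∑ k ∈ Finset.range m, extendCost r (p ^ B.dim) U₃ U₁ k +
          (2 * ((r i₃ + 1) * (r i₂ + 1)) + 1)) ≤ X) ∨
      ∃ x < h, x < r i₃ + 1 ∧ ∃ x' < r i₂ + 1, ∃ x'' < r i₁ + 1,
        b - ∑ i ∈ (Finset.range m).filter (· ∉ U₃), a i =
          a i₁ * g i₁ ^ x'' + a i₂ * g i₂ ^ x' + a i₃ * g i₃ ^ x) :
    Ex w solve σ (solveCost (p ^ B.dim) B.dim n m (r i₂) h X) fun τ =>
      (τ.reg 0 = 1 ∧ ∃ x : ℕ → ℕ, (∀ i < m, x i ≤ r i) ∧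
        b = ∑ i ∈ Finset.range m, a i * g i ^ x i ∧ ∀ i < n, τ.mem i = x i) ∨
      (τ.reg 0 = 0 ∧ ∀ x : ℕ → ℕ, (∀ i < m, x i ≤ r i) →
        b ≠ ∑ i ∈ Finset.range m, a i * g i ^ x i) := by
  have hm2 : 2 ≤ m := by omega
  have hw2 := sq_lt_of_word hm2 hw
  have hqw : p ^ B.dim < 2 ^ w := lt_of_le_of_lt (Nat.le_self_pow two_ne_zero _) hw2
  obtain ⟨hi₁m, -, -⟩ := hi₁ ▸ sel_spec (r := r) (m := m) (U := ∅) (by simp; omega)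
  have hc₁ : U₁.card < m := by rw [hU₁, Finset.card_singleton]; omega
  obtain ⟨hi₂m, hi₂U, -⟩ := hi₂ ▸ sel_spec (r := r) hc₁
  have hc₂ : U₂.card < m := by
    rw [hU₂]; have := Finset.card_insert_le i₂ U₁; rw [hU₁, Finset.card_singleton] at *; omega
  obtain ⟨hi₃m, hi₃U, -⟩ := hi₃ ▸ sel_spec (r := r) hc₂
  have hU₁m : U₁ ⊆ Finset.range m := by simpa [hU₁] using hi₁m
  have hU₃m : U₃ ⊆ Finset.range m := by
    rw [hU₃, hU₂, Finset.insert_subset_iff, Finset.insert_subset_iff]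
    exact ⟨Finset.mem_range.2 hi₃m, Finset.mem_range.2 hi₂m, hU₁m⟩
  have hU₁U₃ : U₁ ⊆ U₃ := by
    rw [hU₃, hU₂]
    exact (Finset.subset_insert _ _).trans (Finset.subset_insert _ _)
  have hsdiff : Finset.range m \ U₃ = (Finset.range m).filter (· ∉ U₃) := by
    ext; simp
  rw [add_mul] at hD
  refine Ex.mono (k := (45 * m + 60 + 100 * (B.dim + 1) ^ 2 * (2 * p ^ B.dim)) +
    (1 + ((m * (12 * B.dim + 15) + 3) +
    (100 * (B.dim + 1) ^ 2 * (2 * (h * (r i₂ + 1)) + 1) + ((X + 2 + 1) + (6 * n + 7))))))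
    ?_ (by unfold solveCost; ring_nf; omega)
  refine (Ex.prepare hm hw hr (by omega) hL hA h26 hz hi₁ hU₁ hi₂ hU₂ hi₃ hU₃ hc₁ hc₂).seq
    fun τ₁ hk hQ => ?_
  refine (Ex.straight (P := mov 40 104) (Q := fun τ => τ.reg 40 = enc B b) (by simp)
    (by simp [hQ.lay.cst.r90, hQ.lay.r104])).seq fun τ₂ hk h40 => ?_
  replace hQ := hQ.keep hk rfl
  refine (Ex.shift hm2 hw (by omega) hQ.lay hQ.arr h40).seq fun τ₃ hk h40 => ?_
  replace hQ := hQ.keep hk rfl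
  have hone : ∀ x'' < r i₁ + 1, ∃ c, Sol (p ^ B.dim) a g r U₁ (a i₁ * g i₁ ^ x'') c := by
    intro x'' hx''
    refine ⟨_, fun _ => x'', ?_, ?_, rfl⟩
    · simp [hU₁]; omega
    · simp [hU₁]
  refine (Ex.search (h := h) hm2 hw hr (by omega) hQ.lay.cst h40 hQ.r41 hQ.r42 hQ.r43 hQ.r44
    hQ.r45 hQ.r46 hQ.r47 hQ.r48 hQ.r26 hU₁m hi₂m hi₃m hi₂U (hU₂ ▸ hi₃U) hQ.tab ?_).seq ?_
  · rcases hX with ⟨hX, -⟩ | ⟨x, hx, hx3, x', hx', x'', hx'', he⟩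
    · exact .inl hX
    · refine .inr ⟨x, hx, hx3, x', hx', ?_⟩
      rw [he]
      obtain ⟨c, hc⟩ := hone x'' hx''
      refine ⟨c, ?_⟩
      convert hc using 1
      ring
  intro τ₄ hk hfound
  rw [← hU₂, ← hU₃] at hfound
  replace hQ := hQ.keep hk rfl
  refine (Ex.ite (Q := fun τ =>
    (∃ c, τ.reg 49 = c + 1 ∧ Sol (p ^ B.dim) a g r (Finset.range m) b c) ∨
      (τ.reg 49 = 0 ∧ ∀ c, ¬ Sol (p ^ B.dim) a g r (Finset.range m) b c))
      (fun h0 => ?_) (fun h0 => ?_)).seq fun τ₅ hk hQ' => ?_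
  · rcases hfound with ⟨c, h49, hs⟩ | hf
    swap; · exact absurd hf.1 h0
    refine (Ex.straight (P := mov 69 90) (by simp) (.inl ⟨c, ?_, ?_⟩)).mono (by simp [Prog.len])
    · simp [h49]
    · have := hs.mono hU₃m
      rw [hsdiff] at this
      simpa using this
  · rcases hfound with ⟨c, h49, hs⟩ | ⟨-, hnot⟩
    · omega
    rcases hX with ⟨-, hX⟩ | ⟨x, hx, hx3, x', hx', x'', hx'', he⟩
    swap
    -- The promised solution contradicts the failure of the first search.
    · obtain ⟨c, hc⟩ := hone x'' hx''
      have h1 := (hc.add_index hi₂U (by omega : x' ≤ r i₂))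
      rw [← hU₂] at h1
      have h2 := h1.add_index hi₃U (by omega : x ≤ r i₃)
      rw [← hU₃, ← he] at h2
      exact absurd h2 (hnot _)
    refine Ex.mono (k := (15 * m + 4 + 100 * (B.dim + 1) ^ 2 *
        ∑ k ∈ Finset.range m, extendCost r (p ^ B.dim) U₃ U₁ k) + (1 +
        100 * (B.dim + 1) ^ 2 * (2 * ((r i₃ + 1) * (r i₂ + 1)) + 1))) ?_
        (by rw [mul_add] at hX; omega)
    refine (Ex.extendAll hm2 hw hr (by omega) (by rw [add_mul]; omega) hQ.lay hQ.arr hQ.r26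
      hU₁m hU₁U₃ hQ.tab hQ.zero).seq ?_
    rintro τ₆ hk₆ ⟨h26, hT⟩
    have hL₆ := hQ.lay.keep hk₆ rfl
    refine (Ex.straight (P := mov 40 104) (Q := fun τ => τ.reg 40 = enc B b) (by simp)
      (by simp [hL₆.cst.r90, hL₆.r104])).seq fun τ₇ hk₇ h40 => ?_
    rw [← hk₇.2 rfl] at hT
    have hi₂U₃ : i₂ ∈ U₃ := by simp [hU₃, hU₂]
    have hi₃U₃ : i₃ ∈ U₃ := by simp [hU₃]
    -- The extended table covers everything except the second and third terms, so the second search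
    -- decides the full equation.
    have hall : insert i₃ (insert i₂ (U₁ ∪ (Finset.range m).filter (· ∉ U₃))) =
        Finset.range m := by
      rw [← Finset.insert_union, ← hU₂, ← Finset.insert_union, ← hU₃, ← hsdiff,
        Finset.union_sdiff_of_subset hU₃m]
    have := Ex.search (w := w) (h := r i₃ + 1) (tb := τ₆.reg 26) hm2 hw hr (by omega)
      (hL₆.keep hk₇ rfl).cst h40
      ((hk₇.reg 41 rfl).trans ((hk₆.reg 41 rfl).trans hQ.r41))
      ((hk₇.reg 42 rfl).trans ((hk₆.reg 42 rfl).trans hQ.r42))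
      ((hk₇.reg 43 rfl).trans ((hk₆.reg 43 rfl).trans hQ.r43))
      ((hk₇.reg 44 rfl).trans ((hk₆.reg 44 rfl).trans hQ.r44))
      ((hk₇.reg 45 rfl).trans ((hk₆.reg 45 rfl).trans hQ.r45))
      ((hk₇.reg 46 rfl).trans ((hk₆.reg 46 rfl).trans hQ.r46))
      ((hk₇.reg 47 rfl).trans ((hk₆.reg 47 rfl).trans hQ.r47))
      ((hk₇.reg 48 rfl).trans ((hk₆.reg 48 rfl).trans hQ.r48)) (hk₇.reg 26 rfl)
      (Finset.union_subset hU₁m (Finset.filter_subset _ _)) hi₂m hi₃m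
      (by simp [hi₂U, hi₂U₃]) (by
        rw [← Finset.insert_union, ← hU₂]
        simp [hi₃U, hi₃U₃]) hT (.inl le_rfl)
    rwa [hall] at this
  · exact Ex.output hm2 hnm hw (by omega) hr (hQ.lay.keep hk rfl) hQ'

end

/-- The whole program. -/
def main : Prog := readInput ;; solve

/-- The number of steps of `readInput`. -/
def readCost (q d n : ℕ) : ℕ :=
  17 * d + 50 + 2 * (n * (7 * d + 8)) + n * (q * (60 * (d + 1) ^ 2 + 6) + 10)

section

variable {p : ℕ} [hp : Fact p.Prime] {F : Type*} [Field F] [Algebra (ZMod p) F]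
  {B : PowerBasis (ZMod p) F} {w : ℕ} {σ τ : State} {n D : ℕ} {b : F}

theorem Ex.readInput [Finite F] (hD : D = 3 + (2 * n + 2) * B.dim)
    (hw : (p ^ B.dim) ^ 2 < 2 ^ w) (hDw : D + 4 * (n + 2) < 2 ^ w) (h90 : σ.reg 90 = 0)
    (hp0 : σ.mem 0 = p) (hp1 : σ.mem 1 = B.dim) (hp2 : σ.mem 2 = n)
    {a : ℕ → F} {G : ℕ → Fˣ} {g : ℕ → F} {r : ℕ → ℕ}
    (hord : ∀ k, orderOf (G k) ≤ p ^ B.dim) (hgG : ∀ k < n, g k = G k)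
    (hrG : ∀ k < n, r k = orderOf (G k) - 1) (ha0 : ∀ k, n ≤ k → a k = 0)
    (hg0 : ∀ k, n ≤ k → g k = 0) (hr0 : ∀ k, n ≤ k → r k = 0)
    (hM : ∀ i < B.dim, σ.mem (3 + i) = dg B (minTail B) i)
    (ha : ∀ k < n, ∀ i < B.dim, σ.mem (3 + B.dim + k * B.dim + i) = dg B (a k) i)
    (hg : ∀ k < n, ∀ i < B.dim, σ.mem (3 + B.dim + n * B.dim + k * B.dim + i) = dg B (g k) i)
    (hb : ∀ i < B.dim, σ.mem (3 + B.dim + n * B.dim + n * B.dim + i) = dg B b i)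
    (hz : ∀ k, D ≤ k → σ.mem k = 0) :
    Ex w readInput σ (readCost (p ^ B.dim) B.dim n) fun τ => Layout B n (n + 2) D b τ ∧
      Arrays B a g r (n + 2) D ∅ τ.mem ∧ τ.reg 26 = D + 4 * (n + 2) ∧
      ∀ k, D + 4 * (n + 2) ≤ k → τ.mem k = 0 := by
  have hD' : D = 3 + B.dim + n * B.dim + n * B.dim + B.dim := by rw [hD]; ring
  refine Ex.mono (k := (3 * B.dim + 20) + ((7 * B.dim + 4) + (1 + (1 + ((n * (7 * B.dim + 8) + 2) +
    (1 + ((n * (7 * B.dim + 8) + 2) + ((7 * B.dim + 4) + (1 +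
    (n * (p ^ B.dim * (60 * (B.dim + 1) ^ 2 + 6) + 10) + 4)))))))))) ?_
    (by unfold readCost; omega)
  have hkd : ∀ k < n, k * B.dim + B.dim ≤ n * B.dim := fun k hk => by
    rw [← Nat.succ_mul]; exact Nat.mul_le_mul_right _ hk
  refine (Ex.readParams hD hw hDw h90 hp0 hp1 hp2).seq ?_
  rintro τ₁ hk ⟨hP, h70⟩
  have hmem := hk.2 rfl
  refine (Ex.readVec hw hP.r90 hP.r91 hP.r92 hP.r93 h70 (y := minTail B) (by omega)
    (fun i hi => by rw [hmem, hM i hi])).seq ?_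
  rintro τ₂ hk ⟨h71, h70⟩
  have hP := hP.keep hk rfl
  have hmem := (hk.2 rfl).trans hmem
  refine (Ex.straight (P := mov 96 71) (Q := fun τ => τ.reg 96 = enc B (minTail B)) (by simp)
    (by simp [hP.r90, h71])).seq fun τ₃ hk h96 => ?_
  have hP := hP.keep hk rfl
  have hmem := (hk.2 rfl).trans hmem
  have h70 := (hk.reg 70 rfl).trans h70
  refine (Ex.straight (P := mov 75 100) (Q := fun τ => τ.reg 75 = D) (by simp)
    (by simp [hP.r90, hP.r100])).seq fun τ₄ hk h75 => ?_
  have hP := hP.keep hk rfl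
  have hmem := (hk.2 rfl).trans hmem
  have h70 := (hk.reg 70 rfl).trans h70
  have h96 := (hk.reg 96 rfl).trans h96
  refine (Ex.readVecs hw hP.r90 hP.r91 hP.r92 hP.r93 hP.r99 h70 h75 (y := a) (by omega) (by omega)
    (fun k hk i hi => by rw [hmem, ha k hk i hi])).seq ?_
  rintro τ₅ hk ⟨h70, hAa, hold₁⟩
  have hP := hP.keep hk rfl
  have h96 := (hk.reg 96 rfl).trans h96
  rw [hmem] at hold₁
  refine (Ex.straight (P := mov 75 101) (Q := fun τ => τ.reg 75 = D + (n + 2)) (by simp)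
    (by simp [hP.r90, hP.r101])).seq fun τ₆ hk h75 => ?_
  have hP := hP.keep hk rfl
  have hmem := hk.2 rfl
  have h70 := (hk.reg 70 rfl).trans h70
  have h96 := (hk.reg 96 rfl).trans h96
  rw [← hmem] at hAa hold₁
  refine (Ex.readVecs hw hP.r90 hP.r91 hP.r92 hP.r93 hP.r99 h70 h75 (y := g) (by omega) (by omega)
    (fun k hk i hi => by
      have := hkd k hk
      rw [hold₁ _ (by omega), hg k hk i hi])).seq ?_
  rintro τ₇ hk ⟨h70, hAg, hold₂⟩
  have hP := hP.keep hk rfl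
  have h96 := (hk.reg 96 rfl).trans h96
  refine (Ex.readVec hw hP.r90 hP.r91 hP.r92 hP.r93 h70 (y := b) (by omega)
    (fun i hi => by rw [hold₂ _ (by omega), hold₁ _ (by omega), hb i hi])).seq ?_
  rintro τ₈ hk ⟨h71, -⟩
  have hP := hP.keep hk rfl
  have hmem := hk.2 rfl
  have h96 := (hk.reg 96 rfl).trans h96
  refine (Ex.straight (P := mov 104 71) (Q := fun τ => τ.reg 104 = enc B b) (by simp)
    (by simp [hP.r90, h71])).seq fun τ₉ hk h104 => ?_
  have hP := hP.keep hk rfl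
  have hmem := (hk.2 rfl).trans hmem
  have h96 := (hk.reg 96 rfl).trans h96
  rw [← hmem] at hAg hold₂
  have hC := hP.cst h96
  refine (Ex.orders (m := n + 2) hw hC hP.r99 hP.r101 (by rw [hP.r102]; ring) (by omega) (by omega)
    (G := G) hord (fun k hk => by rw [hAg k hk, hgG k hk])).call le_rfl ?_
  rintro τ hk ⟨hAr, hold₃⟩
  have hP := hP.keep hk rfl
  have h96 := (hk.reg 96 rfl).trans h96
  have h104 := (hk.reg 104 rfl).trans h104
  refine ⟨⟨hP.cst h96, hP.r98, hP.r99, hP.r100, hP.r101, hP.r102, hP.r103, h104⟩,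
    ⟨fun i hi => ?_, fun i hi => ?_, fun i hi => ?_, fun i hi => ?_⟩, hP.r26, fun k hk => ?_⟩
  · rw [hold₃ _ (by omega), hold₂ _ (by omega)]
    by_cases hin : i < n
    · exact hAa i hin
    -- The places of the dummy terms are never written: the zeros initially in memory encode
    -- coefficient 0, and in the other arrays base 0 and order minus one 0.
    · rw [hold₁ _ (by omega), hz _ (by omega), ha0 i (by omega), enc_zero]
  · rw [hold₃ _ (by omega)]
    by_cases hin : i < n
    · exact hAg i hin
    · rw [hold₂ _ (by omega), hold₁ _ (by omega), hz _ (by omega), hg0 i (by omega), enc_zero]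
  · by_cases hin : i < n
    · rw [hrG i hin, ← hAr i hin]; congr 1; ring
    · rw [hold₃ _ (by omega), hold₂ _ (by omega), hold₁ _ (by omega), hz _ (by omega),
        hr0 i (by omega)]
  · rw [hold₃ _ (by omega), hold₂ _ (by omega), hold₁ _ (by omega), hz _ (by omega)]
    simp
  · rw [hold₃ _ (by omega), hold₂ _ (by omega), hold₁ _ (by omega), hz _ (by omega)]

end

/-! ### The input list -/

theorem length_flatten_ofFn {n d : ℕ} (f : Fin n → List ℕ) (hf : ∀ k, (f k).length = d) :
    (List.ofFn f).flatten.length = n * d := by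
  simp [List.length_flatten, List.map_ofFn, Function.comp_def, hf]

theorem getD_flatten_ofFn {n d : ℕ} (f : Fin n → List ℕ) (hf : ∀ k, (f k).length = d) (k : Fin n)
    {i : ℕ} (hi : i < d) : (List.ofFn f).flatten.getD (k * d + i) 0 = (f k).getD i 0 := by
  induction n with
  | zero => exact k.elim0
  | succ n ih =>
    rw [List.ofFn_succ, List.flatten_cons]
    refine Fin.cases ?_ (fun k => ?_) k
    · rw [List.getD_append _ _ _ _ (by simpa [hf] using hi)]
      simp
    · rw [List.getD_append_right _ _ _ _ (by rw [hf, Fin.val_succ]; nlinarith), hf, Fin.val_succ,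
        ← ih (fun k => f k.succ) (fun k => hf _) k]
      congr 1
      rw [add_mul]; omega

theorem getD_lt {l : List ℕ} {N : ℕ} (h : ∀ x ∈ l, x < N) (hN : 0 < N) (k : ℕ) :
    l.getD k 0 < N := by
  by_cases hk : k < l.length
  · rw [List.getD_eq_getElem _ _ hk]; exact h _ (List.getElem_mem hk)
  · rw [List.getD_eq_default _ _ (by omega)]; exact hN

theorem length_coords {p : ℕ} {F : Type*} [Field F] [Algebra (ZMod p) F]
    (B : PowerBasis (ZMod p) F) (y : F) : (coords B y).length = B.dim := by
  simp [coords]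

section

variable {p : ℕ} [hp : Fact p.Prime] {F : Type*} [Field F] [Algebra (ZMod p) F]
  {B : PowerBasis (ZMod p) F} {w n : ℕ} {b : F} {a g : Fin n → Fˣ}

theorem getD_coords (B : PowerBasis (ZMod p) F) (y : F) {i : ℕ} (hi : i < B.dim) :
    (coords B y).getD i 0 = dg B y i := by
  rw [List.getD_eq_getElem _ _ (by rwa [length_coords])]
  simp [coords, dg, hi]

/-- A family indexed by `Fin n`, extended by zero. -/
noncomputable def extend₀ (a : Fin n → Fˣ) (i : ℕ) : F := if h : i < n then (a ⟨i, h⟩ : F) else 0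

/-- The orders minus one, extended by zero. -/
noncomputable def ords (g : Fin n → Fˣ) (i : ℕ) : ℕ :=
  if h : i < n then orderOf (g ⟨i, h⟩) - 1 else 0

theorem getD_inputData (a g : Fin n → Fˣ) (b : F) (D : ℕ) (hD : D = 3 + (2 * n + 2) * B.dim) :
    (inputData B a g b).getD 0 0 = p ∧ (inputData B a g b).getD 1 0 = B.dim ∧
    (inputData B a g b).getD 2 0 = n ∧
    (∀ i < B.dim, (inputData B a g b).getD (3 + i) 0 = dg B (minTail B) i) ∧
    (∀ k < n, ∀ i < B.dim, (inputData B a g b).getD (3 + B.dim + k * B.dim + i) 0 =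
      dg B (extend₀ a k) i) ∧
    (∀ k < n, ∀ i < B.dim, (inputData B a g b).getD (3 + B.dim + n * B.dim + k * B.dim + i) 0 =
      dg B (extend₀ g k) i) ∧
    (∀ i < B.dim, (inputData B a g b).getD (3 + B.dim + n * B.dim + n * B.dim + i) 0 =
      dg B b i) ∧
    ∀ k, D ≤ k → (inputData B a g b).getD k 0 = 0 := by
  set L₁ := List.ofFn fun i : Fin B.dim => ((minpoly (ZMod p) B.gen).coeff i).val with hL₁
  set L₂ := (List.ofFn fun i => coords B (a i : F)).flatten with hL₂
  set L₃ := (List.ofFn fun i => coords B (g i : F)).flatten with hL₃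
  have hl₁ : L₁.length = B.dim := by simp [hL₁]
  have hl₂ : L₂.length = n * B.dim := length_flatten_ofFn _ fun k => length_coords B _
  have hl₃ : L₃.length = n * B.dim := length_flatten_ofFn _ fun k => length_coords B _
  have hl₄ := length_coords B b
  have hI : inputData B a g b = p :: B.dim :: n :: (L₁ ++ (L₂ ++ (L₃ ++ coords B b))) := by
    simp [inputData, hL₁, hL₂, hL₃]
  have hkd : ∀ k < n, k * B.dim + B.dim ≤ n * B.dim := fun k hk => by
    rw [← Nat.succ_mul]; exact Nat.mul_le_mul_right _ hk
  have h3 : ∀ k, (inputData B a g b).getD (3 + k) 0 =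
      (L₁ ++ (L₂ ++ (L₃ ++ coords B b))).getD k 0 := fun k => by
    rw [hI, add_comm]; rfl
  refine ⟨by rw [hI]; rfl, by rw [hI]; rfl, by rw [hI]; rfl, ?_, ?_, ?_, ?_, ?_⟩
  · intro i hi
    rw [h3, List.getD_append _ _ _ _ (by omega), List.getD_eq_getElem _ _ (by omega), minTail,
      dg_sum B _ hi]
    have : NeZero p := ⟨hp.out.ne_zero⟩
    simp [hL₁, Nat.mod_eq_of_lt (ZMod.val_lt _)]
  · intro k hk i hi
    have := hkd k hk
    rw [show 3 + B.dim + k * B.dim + i = 3 + (B.dim + (k * B.dim + i)) by ring, h3,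
      List.getD_append_right _ _ _ _ (by omega), List.getD_append _ _ _ _ (by omega), hl₁,
      Nat.add_sub_cancel_left,
      getD_flatten_ofFn _ (fun k => length_coords B _) ⟨k, hk⟩ hi, getD_coords B _ hi,
      extend₀, dif_pos hk]
  · intro k hk i hi
    have := hkd k hk
    rw [show 3 + B.dim + n * B.dim + k * B.dim + i =
        3 + (B.dim + (n * B.dim + (k * B.dim + i))) by ring, h3,
      List.getD_append_right _ _ _ _ (by omega), hl₁, Nat.add_sub_cancel_left,
      List.getD_append_right _ _ _ _ (by omega), List.getD_append _ _ _ _ (by omega), hl₂,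
      Nat.add_sub_cancel_left,
      getD_flatten_ofFn _ (fun k => length_coords B _) ⟨k, hk⟩ hi, getD_coords B _ hi,
      extend₀, dif_pos hk]
  · intro i hi
    rw [show 3 + B.dim + n * B.dim + n * B.dim + i =
        3 + (B.dim + (n * B.dim + (n * B.dim + i))) by ring, h3,
      List.getD_append_right _ _ _ _ (by omega), hl₁, Nat.add_sub_cancel_left,
      List.getD_append_right _ _ _ _ (by omega), hl₂, Nat.add_sub_cancel_left,
      List.getD_append_right _ _ _ _ (by omega), hl₃, Nat.add_sub_cancel_left,
      getD_coords B _ hi]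
  · intro k hk
    refine List.getD_eq_default _ _ ?_
    rw [hI]
    simp only [List.length_cons, List.length_append, hl₁, hl₂, hl₃, hl₄]
    have : D = 3 + (B.dim + (n * B.dim + (n * B.dim + B.dim))) := by rw [hD]; ring
    omega

theorem mem_inputData_lt {N x : ℕ} (hpN : p < N) (hdN : B.dim < N) (hnN : n < N)
    (hx : x ∈ inputData B a g b) : x < N := by
  have : NeZero p := ⟨hp.out.ne_zero⟩
  have hv : ∀ z : ZMod p, z.val < N := fun z => (ZMod.val_lt z).trans hpN
  simp only [inputData, coords, List.mem_append, List.mem_cons, List.mem_flatten, List.mem_ofFn,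
    List.not_mem_nil, or_false] at hx
  rcases hx with ((((rfl | rfl | rfl) | ⟨i, rfl⟩) | ⟨l, ⟨i, rfl⟩, hl⟩) | ⟨l, ⟨i, rfl⟩, hl⟩) | ⟨i, rfl⟩
  · exact hpN
  · exact hdN
  · exact hnN
  · exact hv _
  · obtain ⟨j, rfl⟩ := List.mem_ofFn.1 hl
    exact hv _
  · obtain ⟨j, rfl⟩ := List.mem_ofFn.1 hl
    exact hv _
  · exact hv _

end

/-! ### Correctness and cost of the whole program -/

section

variable {p : ℕ} [hp : Fact p.Prime] {F : Type*} [Field F] [Algebra (ZMod p) F]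
  {B : PowerBasis (ZMod p) F} {w n : ℕ} {b : F} {a g : Fin n → Fˣ}

theorem card_eq_pow_dim [Fintype F] (B : PowerBasis (ZMod p) F) :
    Fintype.card F = p ^ B.dim := by
  rw [Module.card_fintype B.basis, ZMod.card, Fintype.card_fin]

theorem ords_lt [Fintype F] (B : PowerBasis (ZMod p) F) (g : Fin n → Fˣ) (i : ℕ) :
    ords g i + 1 ≤ p ^ B.dim := by
  classical
  unfold ords
  split_ifs with h
  · have h1 := orderOf_pos (g ⟨i, h⟩)
    have h2 := orderOf_le_card_univ (x := g ⟨i, h⟩)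
    have h3 := Fintype.card_le_of_injective (fun u : Fˣ => (u : F)) Units.val_injective
    rw [card_eq_pow_dim B] at h3
    omega
  · exact pow_pos hp.out.pos _

theorem sum_extend₀ (a g : Fin n → Fˣ) (x : ℕ → ℕ) :
    ∑ i ∈ Finset.range (n + 2), extend₀ a i * extend₀ g i ^ x i =
      ∑ i : Fin n, (a i : F) * (g i : F) ^ x i := by
  rw [Finset.sum_range_succ, Finset.sum_range_succ, Finset.sum_range]
  simp [extend₀]

theorem solvesWithin_main [Fintype F] (hn : 1 ≤ n) (hw : 4 * (p ^ B.dim) ^ (n + 2) < 2 ^ w)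
    (hDw : 3 + (2 * n + 2) * B.dim + 4 * (n + 2) + (n + 6) * p ^ B.dim < 2 ^ w)
    {U₁ U₂ U₃ : Finset ℕ} {i₁ i₂ i₃ h X : ℕ} {T : ℝ}
    (hi₁ : i₁ = sel (ords g) (n + 2) ∅) (hU₁ : U₁ = {i₁}) (hi₂ : i₂ = sel (ords g) (n + 2) U₁)
    (hU₂ : U₂ = insert i₂ U₁) (hi₃ : i₃ = sel (ords g) (n + 2) U₂) (hU₃ : U₃ = insert i₃ U₂)
    (hX : (ords g i₃ + 1 ≤ h ∧ 15 * (n + 2) + 4 + 100 * (B.dim + 1) ^ 2 *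
        (∑ k ∈ Finset.range (n + 2), extendCost (ords g) (p ^ B.dim) U₃ U₁ k +
          (2 * ((ords g i₃ + 1) * (ords g i₂ + 1)) + 1)) ≤ X) ∨
      ∃ x < h, x < ords g i₃ + 1 ∧ ∃ x' < ords g i₂ + 1, ∃ x'' < ords g i₁ + 1,
        b - ∑ i ∈ (Finset.range (n + 2)).filter (· ∉ U₃), extend₀ a i =
          extend₀ a i₁ * extend₀ g i₁ ^ x'' + extend₀ a i₂ * extend₀ g i₂ ^ x' +
            extend₀ a i₃ * extend₀ g i₃ ^ x)
    (hT : (((readCost (p ^ B.dim) B.dim n +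
      solveCost (p ^ B.dim) B.dim n (n + 2) (ords g i₂) h X) * (1 + w) ^ 2 : ℕ) : ℝ) ≤ T) :
    SolvesWithin main B a g b T := by
  classical
  have hq : 0 < p ^ B.dim := pow_pos hp.out.pos _
  have hpq := le_pow_dim B
  have hmq : p ^ B.dim ≤ (n + 6) * p ^ B.dim := Nat.le_mul_of_pos_left _ (by omega)
  have hdd : B.dim ≤ (2 * n + 2) * B.dim := Nat.le_mul_of_pos_left _ (by omega)
  obtain ⟨h0, h1, h2, hM, ha, hg, hb, hz⟩ := getD_inputData (B := B) a g b _ rfl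
  have hbd : Bd w (State.init (inputData B a g b)) := by
    refine ⟨fun r => ?_, fun k => ?_⟩
    · exact pow_pos two_pos _
    · exact getD_lt (fun x hx => mem_inputData_lt (by omega) (by omega) (by omega) hx)
        (pow_pos two_pos _) k
  have hr : ∀ i, ords g i < p ^ B.dim := fun i => ords_lt B g i
  have hw2 := sq_lt_of_word (B := B) (by omega : 2 ≤ n + 2) hw
  have hrun := (Ex.readInput (w := w) (σ := State.init (inputData B a g b)) (B := B) (n := n)
    (b := b) (a := extend₀ a) (g := extend₀ g) (r := ords g)
    -- The default 1 makes the order bound hold for every index; only indices below `n` are read.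
    (G := fun i => if h : i < n then g ⟨i, h⟩ else 1) rfl hw2 (by omega) rfl h0 h1 h2
    (fun k => by
      have h2 := orderOf_le_card_univ (x := if h : k < n then g ⟨k, h⟩ else 1)
      have h3 := Fintype.card_le_of_injective (fun u : Fˣ => (u : F)) Units.val_injective
      rw [card_eq_pow_dim B] at h3
      exact h2.trans h3)
    (fun k hk => by simp [extend₀, hk]) (fun k hk => by simp [ords, hk])
    (fun k hk => by simp [extend₀, hk]) (fun k hk => by simp [extend₀, hk])
    (fun k hk => by simp [ords, hk]) hM ha hg hb hz).seq fun τ _ hτ =>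
    Ex.solve (h := h) (X := X) (by omega) (by omega) hw hr
      (by rw [show n + 2 + 4 = n + 6 by ring]; omega) hτ.1 hτ.2.1 hτ.2.2.1
      hτ.2.2.2 hi₁ hU₁ hi₂ hU₂ hi₃ hU₃ hX
  obtain ⟨t, τ, hR, ht, -, hA⟩ := hrun hbd
  refine ⟨t, τ, hR, le_trans (by exact_mod_cast ht) hT, ?_⟩
  rcases hA with ⟨hA, x, hx, hbx, hmem⟩ | ⟨hA, hno⟩
  · refine .inl ⟨hA, fun i => ?_, ?_⟩
    · have := hx i (by omega)
      change τ.mem i < _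
      rw [hmem i i.2]
      simp only [ords, i.2, dif_pos] at this
      have h1 := orderOf_pos (g i)
      simp only [Fin.eta] at this
      omega
    · rw [sum_extend₀] at hbx
      rw [expPoly, hbx, sub_eq_zero]
      exact Finset.sum_congr rfl fun i _ => by rw [hmem i i.2]
  · refine .inr ⟨hA, fun x hx => ?_⟩
    have := hno (fun i => if h : i < n then x ⟨i, h⟩ else 0) (fun i _ => by
      simp only [ords]
      split_ifs with hi
      · have := hx ⟨i, hi⟩
        omega
      · exact le_rfl)
    rw [sum_extend₀] at this
    simp only [Fin.is_lt, dif_pos, Fin.eta] at this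
    rw [expPoly, Ne, sub_eq_zero]
    exact this.symm

end

/-! ### Character sums over cosets of multiplicative subgroups -/

section

variable {F : Type*} [Field F] [Fintype F]

/-- The exponential sum over a set, with frequency `t`. -/
noncomputable def expSum (ψ : AddChar F ℂ) (A : Finset F) (t : F) : ℂ := ∑ x ∈ A, ψ (t * x)

theorem conj_expSum (ψ : AddChar F ℂ) (A : Finset F) (t : F) :
    (starRingEnd ℂ) (expSum ψ A t) = ∑ x ∈ A, ψ (t * -x) := by
  simp only [expSum, map_sum, mul_neg, AddChar.map_neg_eq_conj]

/-- Parseval: after expanding the square, orthogonality leaves the diagonal pairs only. -/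
theorem sum_norm_expSum_sq {ψ : AddChar F ℂ} (hψ : ψ.IsPrimitive) (A : Finset F) :
    ∑ t, ‖expSum ψ A t‖ ^ 2 = Fintype.card F * A.card := by
  classical
  have h : ∑ t, expSum ψ A t * (starRingEnd ℂ) (expSum ψ A t) = Fintype.card F * A.card := by
    simp only [conj_expSum]
    simp only [expSum, Finset.sum_mul_sum, ← AddChar.map_add_eq_mul, ← mul_add]
    rw [Finset.sum_comm]
    have : ∀ x ∈ A, ∑ t, ∑ y ∈ A, ψ (t * (x + -y)) = Fintype.card F := fun x hx => by
      rw [Finset.sum_comm]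
      simp only [AddChar.sum_mulShift _ hψ, ← sub_eq_add_neg, sub_eq_zero]
      simp [hx]
    rw [Finset.sum_congr rfl this]
    simp [mul_comm]
  simp only [Complex.mul_conj'] at h
  exact_mod_cast h

/-- The coset is invariant under multiplication by `u`, so the sum takes the same value at the `s`
distinct frequencies `t u^j`, where `s` is the order of `u`. By Parseval these contribute at most `q
s` altogether, so each squared modulus is at most `q`. -/
theorem norm_expSum_sq_le {ψ : AddChar F ℂ} (hψ : ψ.IsPrimitive) (u : Fˣ) {α : F} (hα : α ≠ 0)
    [DecidableEq F] {t : F} (ht : t ≠ 0) :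
    ‖expSum ψ ((Finset.range (orderOf u)).image fun x => α * (u : F) ^ x) t‖ ^ 2 ≤
      Fintype.card F := by
  set s := orderOf u with hs
  have hs0 : 0 < s := orderOf_pos u
  have hinj : ∀ c : F, c ≠ 0 → Set.InjOn (fun x => c * (u : F) ^ x) (Finset.range s) := by
    intro c hc x hx y hy hxy
    have h := mul_left_cancel₀ hc hxy
    have h' : u ^ x = u ^ y := by ext; simpa using h
    exact pow_injOn_Iio_orderOf (by simpa using hx) (by simpa using hy) h'
  set A := (Finset.range s).image fun x => α * (u : F) ^ x with hA
  have hAc : A.card = s := by rw [Finset.card_image_of_injOn (hinj α hα), Finset.card_range]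
  have huA : A.image (fun x => (u : F) * x) = A := by
    refine Finset.eq_of_subset_of_card_le (fun y hy => ?_) ?_
    · simp only [hA, Finset.mem_image, Finset.mem_range] at hy ⊢
      obtain ⟨_, ⟨x, hx, rfl⟩, rfl⟩ := hy
      refine ⟨(x + 1) % s, Nat.mod_lt _ hs0, ?_⟩
      have : u ^ ((x + 1) % s) = u ^ (x + 1) := pow_mod_orderOf u _
      have := congrArg (fun v : Fˣ => (v : F)) this
      simp only [Units.val_pow_eq_pow_val] at this
      rw [this]; ring
    · exact (Finset.card_image_of_injective _ (mul_right_injective₀ u.ne_zero)).ge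
  have hshift : ∀ t, expSum ψ A (t * u) = expSum ψ A t := by
    intro t
    conv_rhs => rw [← huA]
    rw [expSum, expSum, Finset.sum_image fun x _ y _ h => mul_left_cancel₀ u.ne_zero h]
    exact Finset.sum_congr rfl fun x _ => by rw [mul_assoc]
  have hpow : ∀ j : ℕ, expSum ψ A (t * (u : F) ^ j) = expSum ψ A t := by
    intro j
    induction j with
    | zero => simp
    | succ j ih => rw [pow_succ, ← mul_assoc, hshift, ih]
  have h1 : ∑ y ∈ (Finset.range s).image (fun x => t * (u : F) ^ x), ‖expSum ψ A y‖ ^ 2 ≤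
      Fintype.card F * A.card := by
    rw [← sum_norm_expSum_sq hψ]
    exact Finset.sum_le_sum_of_subset_of_nonneg (Finset.subset_univ _) fun _ _ _ => by positivity
  rw [Finset.sum_image (hinj t ht)] at h1
  simp only [hpow, Finset.sum_const, Finset.card_range, nsmul_eq_mul, hAc] at h1
  have hs' : (0 : ℝ) < s := by exact_mod_cast hs0
  nlinarith

/-- Few elements of a finite field are missed by the sumset of two cosets of multiplicative
subgroups and a third set. -/
theorem card_missed_le [DecidableEq F] (u v : Fˣ) {α β : F} (hα : α ≠ 0) (hβ : β ≠ 0)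
    (D E : Finset F)
    (hE : ∀ e ∈ E, ∀ x < orderOf u, ∀ y < orderOf v, ∀ z ∈ D,
      e ≠ α * (u : F) ^ x + β * (v : F) ^ y + z) :
    (orderOf u) ^ 2 * (orderOf v) ^ 2 * D.card * E.card ≤ Fintype.card F ^ 4 := by
  have hcard : ∀ (u : Fˣ) {α : F}, α ≠ 0 →
      ((Finset.range (orderOf u)).image fun x => α * (u : F) ^ x).card = orderOf u := by
    intro u α hα
    rw [Finset.card_image_of_injOn, Finset.card_range]
    intro x hx y hy hxy
    have h := mul_left_cancel₀ hα hxy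
    have h' : u ^ x = u ^ y := by ext; simpa using h
    exact pow_injOn_Iio_orderOf (by simpa using hx) (by simpa using hy) h'
  obtain ⟨ψ, hψ⟩ : ∃ ψ : AddChar F ℂ, ψ.IsPrimitive :=
    ⟨_, AddChar.FiniteField.primitiveChar_to_Complex_isPrimitive F⟩
  have hbA := fun {t : F} (ht : t ≠ 0) => norm_expSum_sq_le hψ u hα ht
  have hbB := fun {t : F} (ht : t ≠ 0) => norm_expSum_sq_le hψ v hβ ht
  have hcA := hcard u hα
  have hcB := hcard v hβ
  set A := (Finset.range (orderOf u)).image fun x => α * (u : F) ^ x with hA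
  set B := (Finset.range (orderOf v)).image fun x => β * (v : F) ^ x with hB
  -- Up to the factor `q`, this sum counts the representations of elements of `E` as sums from `A`,
  -- `B` and `D`; there are none.
  have hzero : ∑ t, expSum ψ A t * expSum ψ B t * expSum ψ D t *
      (starRingEnd ℂ) (expSum ψ E t) = 0 := by
    simp only [conj_expSum]
    simp only [expSum, Finset.sum_mul, Finset.mul_sum,
      ← AddChar.map_add_eq_mul, ← mul_add]
    rw [Finset.sum_comm]
    refine Finset.sum_eq_zero fun e he => ?_
    rw [Finset.sum_comm]
    refine Finset.sum_eq_zero fun z hz => ?_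
    rw [Finset.sum_comm]
    refine Finset.sum_eq_zero fun x hx => ?_
    rw [Finset.sum_comm]
    refine Finset.sum_eq_zero fun y hy => ?_
    simp only [AddChar.sum_mulShift _ hψ]
    obtain ⟨i, hi, rfl⟩ := Finset.mem_image.1 hx
    obtain ⟨j, hj, rfl⟩ := Finset.mem_image.1 hy
    rw [if_neg, Nat.cast_zero]
    rw [← sub_eq_add_neg, sub_eq_zero]
    exact (hE e he j (Finset.mem_range.1 hj) i (Finset.mem_range.1 hi) z hz).symm
  have h0 : ∀ S : Finset F, expSum ψ S 0 = S.card := fun S => by simp [expSum]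
  obtain ⟨q, hq⟩ : ∃ q : ℝ, q = Fintype.card F := ⟨_, rfl⟩
  simp only [← hq] at hbA hbB
  have hq0 : 0 ≤ q := by rw [hq]; positivity
  rw [← Finset.add_sum_erase _ _ (Finset.mem_univ (0 : F)), add_eq_zero_iff_eq_neg] at hzero
  simp only [h0, map_natCast] at hzero
  -- The term at frequency 0 must be cancelled by the others, where the two coset sums together
  -- contribute at most `√q · √q = q`.
  have h1 : (A.card * B.card * D.card * E.card : ℝ) ≤
      q * ∑ t, ‖expSum ψ D t‖ * ‖expSum ψ E t‖ := by
    calc (A.card * B.card * D.card * E.card : ℝ)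
        = ‖(A.card * B.card * D.card * E.card : ℂ)‖ := by simp
      _ ≤ ∑ t ∈ Finset.univ.erase 0, q * (‖expSum ψ D t‖ * ‖expSum ψ E t‖) := by
          rw [hzero, norm_neg]
          refine norm_sum_le_of_le _ fun t ht => ?_
          have ht := Finset.ne_of_mem_erase ht
          have h2 : ‖expSum ψ A t‖ * ‖expSum ψ B t‖ ≤ q := by
            nlinarith [hbA ht, hbB ht, sq_nonneg (‖expSum ψ A t‖ - ‖expSum ψ B t‖)]
          simp only [norm_mul, RCLike.norm_conj]
          rw [mul_assoc]
          exact mul_le_mul_of_nonneg_right h2 (by positivity)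
      _ ≤ _ := by
          rw [Finset.mul_sum]
          exact Finset.sum_le_sum_of_subset_of_nonneg (Finset.subset_univ _)
            fun _ _ _ => by positivity
  have h2 := Finset.sum_mul_sq_le_sq_mul_sq Finset.univ (fun t => ‖expSum ψ D t‖)
    (fun t => ‖expSum ψ E t‖)
  rw [sum_norm_expSum_sq hψ, sum_norm_expSum_sq hψ, ← hq] at h2
  have h3 : (A.card * B.card * D.card * E.card : ℝ) ^ 2 ≤ q ^ 2 * (q * D.card * (q * E.card)) := by
    refine (pow_le_pow_left₀ (by positivity) h1 2).trans ?_
    rw [mul_pow]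
    exact mul_le_mul_of_nonneg_left h2 (by positivity)
  rw [hcA, hcB] at h3
  -- Cauchy-Schwarz and Parseval were applied to `D` and `E`. It remains to cancel one factor `|D|
  -- |E|`, which may be 0.
  have h4 : (orderOf u ^ 2 * orderOf v ^ 2 * D.card * E.card) * (D.card * E.card) ≤
      Fintype.card F ^ 4 * (D.card * E.card) := by
    have : ((orderOf u ^ 2 * orderOf v ^ 2 * D.card * E.card) * (D.card * E.card) : ℝ) ≤
      q ^ 4 * (D.card * E.card) := by linarith
    rw [hq] at this
    exact_mod_cast this
  rcases Nat.eq_zero_or_pos (D.card * E.card) with h | h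
  · rw [mul_assoc, h]; simp
  · exact Nat.le_of_mul_le_mul_right h4 h

end

/-! ### Estimates for the number of steps -/

theorem readCost_add_solveCost_le {q d n h r₂ Y X : ℕ} (hq : 1 ≤ q)
    (hX : X = 15 * (n + 2) + 4 + 100 * (d + 1) ^ 2 * (Y + (2 * (h * (r₂ + 1)) + 1))) :
    readCost q d n + solveCost q d n (n + 2) r₂ h X ≤
      2000 * ((n + 2) * (d + 1) ^ 2 * (q + h * (r₂ + 1) + Y)) := by
  obtain ⟨z, hz⟩ : ∃ z, z = h * (r₂ + 1) := ⟨_, rfl⟩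
  unfold readCost solveCost
  rw [hX, ← hz]
  -- In terms of `q - 1` the difference of the two sides is a polynomial with nonnegative
  -- coefficients, which `positivity` recognizes after expansion.
  obtain ⟨q, rfl⟩ : ∃ k, q = k + 1 := ⟨q - 1, by omega⟩
  zify
  have e1 : (0 : ℤ) ≤ d := by positivity
  have e2 : (0 : ℤ) ≤ n := by positivity
  have e3 : (0 : ℤ) ≤ q := by positivity
  have e4 : (0 : ℤ) ≤ z := by positivity
  have e5 : (0 : ℤ) ≤ Y := by positivity
  rw [← sub_nonneg]
  ring_nf
  positivity

theorem le_rpow_mul_of_pow_le {y q c : ℝ} {j k : ℕ} (hk : k ≠ 0) (hq : 0 ≤ q) (hc : 0 ≤ c)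
    (h : y ^ k ≤ q ^ j * c ^ k) : y ≤ q ^ ((j : ℝ) / k) * c := by
  refine le_of_pow_le_pow_left₀ hk (by positivity) (h.trans_eq ?_)
  rw [mul_pow, ← Real.rpow_natCast (q ^ _), ← Real.rpow_mul hq,
    div_mul_cancel₀ _ (by exact_mod_cast hk), Real.rpow_natCast]

/-- The exponent of `q` in the number of steps. -/
noncomputable def stepExp (n : ℕ) : ℝ :=
  if n ≤ 2 then 1 else if n = 3 then 6 / 5 else if n = 4 then 10 / 7 else 8 / 5

/-- For `n ≤ 4` the exponents compare directly and the power of `n` is bounded. For `n ≥ 5` there is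
room in the exponent that grows linearly in `n`; as `q ≥ 2`, it yields an exponential in `n` that
beats the sixth power. -/
theorem exists_pow_mul_rpow_stepExp_le : ∃ K : ℝ, 0 ≤ K ∧ ∀ (n : ℕ) (q : ℝ), 1 ≤ n → 2 ≤ q →
    ((n : ℝ) + 2) ^ 6 * q ^ stepExp n ≤ K * q ^ ((n : ℝ) * (n + 1) / (2 * (2 * n - 1))) := by
  have hl : 0 < Real.log 2 := Real.log_pos one_lt_two
  refine ⟨6 ^ 6 + 720 * (4 / Real.log 2) ^ 6 * 8, by positivity, fun n q hn hq => ?_⟩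
  have hq0 : 0 < q := by linarith
  have hle : ∀ x : ℝ, x ≤ (n : ℝ) * (n + 1) / (2 * (2 * n - 1)) → n ≤ 4 →
      ((n : ℝ) + 2) ^ 6 * q ^ x ≤ (6 ^ 6 + 720 * (4 / Real.log 2) ^ 6 * 8) *
        q ^ ((n : ℝ) * (n + 1) / (2 * (2 * n - 1))) := by
    intro x hx hn4
    have h1 : ((n : ℝ) + 2) ^ 6 ≤ 6 ^ 6 := by
      have : (n : ℝ) ≤ 4 := by exact_mod_cast hn4
      exact pow_le_pow_left₀ (by positivity) (by linarith) _
    have h2 : (0 : ℝ) ≤ 720 * (4 / Real.log 2) ^ 6 * 8 := by positivity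
    exact mul_le_mul (by linarith) (Real.rpow_le_rpow_of_exponent_le (by linarith) hx)
      (by positivity) (by positivity)
  unfold stepExp
  split_ifs with h2 h3 h4
  · refine hle _ ?_ (by omega)
    interval_cases n <;> norm_num
  · subst h3; refine hle _ ?_ (by omega); norm_num
  · subst h4; refine hle _ ?_ (by omega); norm_num
  have h5 : (5 : ℝ) ≤ n := by exact_mod_cast (by omega : 5 ≤ n)
  -- The left side is the asymptote of the right side; after clearing the denominator the difference
  -- is `3/4`. At `n = 5` it equals `13/8`, just above `8/5`.
  have he : (n : ℝ) / 4 + 3 / 8 ≤ (n : ℝ) * (n + 1) / (2 * (2 * n - 1)) := by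
    rw [le_div_iff₀ (by linarith)]; nlinarith
  set e := (n : ℝ) * (n + 1) / (2 * (2 * n - 1)) with he'
  -- A single term of the exponential series, of degree 6, whence `720 = 6!`.
  have h6 : ((n : ℝ) + 2) ^ 6 ≤ 720 * (4 / Real.log 2) ^ 6 * 2 ^ (((n : ℝ) + 2) / 4) := by
    have := Real.pow_div_factorial_le_exp (((n : ℝ) + 2) * (Real.log 2 / 4)) (by positivity) 6
    rw [Real.rpow_def_of_pos two_pos, show Real.log 2 * (((n : ℝ) + 2) / 4) =
      ((n : ℝ) + 2) * (Real.log 2 / 4) by ring]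
    rw [mul_pow, div_le_iff₀ (by positivity)] at this
    calc ((n : ℝ) + 2) ^ 6 = (((n : ℝ) + 2) ^ 6 * (Real.log 2 / 4) ^ 6) * (4 / Real.log 2) ^ 6 := by
          field_simp
      _ ≤ _ := mul_le_mul_of_nonneg_right this (by positivity)
      _ = _ := by norm_num [Nat.factorial]; ring
  have h7 : (2 : ℝ) ^ (((n : ℝ) + 2) / 4) ≤ 8 * q ^ (e - 8 / 5) := by
    calc (2 : ℝ) ^ (((n : ℝ) + 2) / 4) ≤ 2 ^ ((3 : ℝ) + (e - 8 / 5)) :=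
          Real.rpow_le_rpow_of_exponent_le one_le_two (by linarith)
      _ = 8 * 2 ^ (e - 8 / 5) := by
          rw [Real.rpow_add two_pos]; norm_num
      _ ≤ _ := by
          have := Real.rpow_le_rpow two_pos.le hq (by linarith : 0 ≤ e - 8 / 5)
          linarith
  have h8 : q ^ e = q ^ (e - 8 / 5) * q ^ (8 / 5 : ℝ) := by
    rw [← Real.rpow_add hq0]; ring_nf
  rw [h8, ← mul_assoc]
  refine mul_le_mul_of_nonneg_right ?_ (by positivity)
  calc ((n : ℝ) + 2) ^ 6 ≤ 720 * (4 / Real.log 2) ^ 6 * 2 ^ (((n : ℝ) + 2) / 4) := h6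
    _ ≤ 720 * (4 / Real.log 2) ^ 6 * (8 * q ^ (e - 8 / 5)) :=
        mul_le_mul_of_nonneg_left h7 (by positivity)
    _ ≤ _ := by
        have : 0 ≤ q ^ (e - 8 / 5) := by positivity
        nlinarith

/-- The slack is `s₂ s₃³ ≤ s₁⁴`. When `s₁² s₂² s₃` is at most about `q³`, an exhaustive search takes
about `q^(6/5)` lookups at most. -/
theorem mul_pow_five_le {s₁ s₂ s₃ : ℕ} (h12 : s₂ ≤ s₁) (h23 : s₃ ≤ s₂) :
    (s₂ * s₃) ^ 5 ≤ (s₁ ^ 2 * s₂ ^ 2 * s₃) ^ 2 :=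
  calc (s₂ * s₃) ^ 5 = (s₂ * s₃ ^ 3) * (s₂ ^ 4 * s₃ ^ 2) := by ring
    _ ≤ (s₁ * s₁ ^ 3) * (s₂ ^ 4 * s₃ ^ 2) := by
        have := h23.trans h12
        gcongr
    _ = _ := by ring

theorem pow_three_le_pow_five {s₁ s₂ s₃ : ℕ} (h12 : s₂ ≤ s₁) (h23 : s₃ ≤ s₂) :
    (s₁ ^ 2 * s₂ ^ 2 * s₃) ^ 3 ≤ (s₁ ^ 2 * s₂) ^ 5 :=
  calc (s₁ ^ 2 * s₂ ^ 2 * s₃) ^ 3 = (s₂ * s₃ ^ 3) * (s₁ ^ 6 * s₂ ^ 5) := by ring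
    _ ≤ (s₁ * s₁ ^ 3) * (s₁ ^ 6 * s₂ ^ 5) := by
        have := h23.trans h12
        gcongr
    _ = _ := by ring

/-- The counterpart for large orders: with `Q = q³ log q`, the base on the left is the main part of
the cost `h s₂` of the shortened search. -/
theorem div_pow_five_le {s₁ s₂ s₃ : ℕ} {Q : ℝ} (hQ : 0 < Q) (h12 : s₂ ≤ s₁) (h23 : s₃ ≤ s₂)
    (h3 : 1 ≤ s₃) (h : Q ≤ (s₁ : ℝ) ^ 2 * s₂ ^ 2 * s₃) :
    (Q / ((s₁ : ℝ) ^ 2 * s₂)) ^ 5 ≤ Q ^ 2 := by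
  have h1 : (1 : ℝ) ≤ s₁ := by exact_mod_cast h3.trans (h23.trans h12)
  have h2 : (1 : ℝ) ≤ s₂ := by exact_mod_cast h3.trans h23
  rw [div_pow, div_le_iff₀ (by positivity)]
  have h4 : Q ^ 3 ≤ ((s₁ : ℝ) ^ 2 * s₂ ^ 2 * s₃) ^ 3 := pow_le_pow_left₀ hQ.le h 3
  have h5 : ((s₁ : ℝ) ^ 2 * s₂ ^ 2 * s₃) ^ 3 ≤ ((s₁ : ℝ) ^ 2 * s₂) ^ 5 := by
    exact_mod_cast pow_three_le_pow_five h12 h23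
  calc Q ^ 5 = Q ^ 2 * Q ^ 3 := by ring
    _ ≤ _ := mul_le_mul_of_nonneg_left (h4.trans h5) (by positivity)

section

variable {r : ℕ → ℕ} {n q i₁ i₂ i₃ : ℕ} {U₁ U₂ U₃ : Finset ℕ}

/-- A nontrivial term outside the top three forces the top three to be nontrivial too, hence to be
genuine terms. That makes four of them, and for `n = 4` no further one. -/
theorem three_lt_of_pos (hr0 : ∀ i, n ≤ i → r i = 0) (hU₃ : U₃.card = 3)
    (hmax : ∀ i ∈ U₃, ∀ j < n + 2, j ∉ U₃ → r j ≤ r i) {k : ℕ} (hk : k ∉ U₃) (hrk : 0 < r k) :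
    4 ≤ n ∧ (n = 4 → ∀ j, j ∉ U₃ → j ≠ k → r j = 0) := by
  have hlt : ∀ i, 0 < r i → i < n := fun i hi => by
    by_contra h; have := hr0 i (by omega); omega
  have hkn := hlt k hrk
  have hsub : insert k U₃ ⊆ Finset.range n := by
    intro i hi
    rcases Finset.mem_insert.1 hi with rfl | hi
    · exact Finset.mem_range.2 hkn
    · exact Finset.mem_range.2 (hlt _ (hrk.trans_le (hmax i hi k (by omega) hk)))
  have hc : (insert k U₃).card = 4 := by rw [Finset.card_insert_of_notMem hk, hU₃]
  have h1 := Finset.card_le_card hsub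
  rw [hc, Finset.card_range] at h1
  refine ⟨h1, fun h4 j hj hjk => ?_⟩
  by_contra hne
  have hjn := hlt j (by omega)
  have h2 : insert j (insert k U₃) ⊆ Finset.range n :=
    Finset.insert_subset (Finset.mem_range.2 hjn) hsub
  have h3 := Finset.card_le_card h2
  rw [Finset.card_insert_of_notMem (by simp [hjk, hj]), hc, Finset.card_range] at h3
  omega

/-- The two cases are the dichotomy on `s₁² s₂² s₃` against `q³ L`, with `L = log q` in the
application. In the first there is a shortened search and no fallback; in the second everything is
exhaustive and `Y` is the cost of extending the table. The integer `l ≥ L` absorbs all logarithms.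
-/
theorem steps_le {h Y : ℕ} {l : ℕ} {L : ℝ} (hq : 2 ≤ q)
    (hr : ∀ i, r i + 1 ≤ q) (hr0 : ∀ i, n ≤ i → r i = 0) (hL0 : 0 < L) (hL : L ≤ l) (hl : 1 ≤ l)
    (hU₁ : U₁ = {i₁}) (hU₂ : U₂ = insert i₂ U₁) (hU₃ : U₃ = insert i₃ U₂)
    (h1 : i₁ < n + 2 ∧ i₁ ∉ (∅ : Finset ℕ) ∧ ∀ j < n + 2, j ∉ (∅ : Finset ℕ) → r j ≤ r i₁)
    (h2 : i₂ < n + 2 ∧ i₂ ∉ U₁ ∧ ∀ j < n + 2, j ∉ U₁ → r j ≤ r i₂)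
    (h3 : i₃ < n + 2 ∧ i₃ ∉ U₂ ∧ ∀ j < n + 2, j ∉ U₂ → r j ≤ r i₃)
    (hcase : (Y = 0 ∧ h ≤ r i₃ + 1 ∧
        (q : ℝ) ^ 3 * L ≤ ((r i₁ + 1 : ℕ) : ℝ) ^ 2 * ((r i₂ + 1 : ℕ) : ℝ) ^ 2 * (r i₃ + 1 : ℕ) ∧
        (h : ℝ) ≤ (q : ℝ) ^ 3 * L / (((r i₁ + 1 : ℕ) : ℝ) ^ 2 * ((r i₂ + 1 : ℕ) : ℝ) ^ 2) + 1) ∨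
      (h = r i₃ + 1 ∧
        ((r i₁ + 1 : ℕ) : ℝ) ^ 2 * ((r i₂ + 1 : ℕ) : ℝ) ^ 2 * (r i₃ + 1 : ℕ) ≤ (q : ℝ) ^ 3 * L ∧
        Y = ∑ k ∈ Finset.range (n + 2), extendCost r q U₃ U₁ k)) :
    ((q + h * (r i₂ + 1) + Y : ℕ) : ℝ) ≤ 5 * ((n : ℝ) + 2) * ((q : ℝ) ^ stepExp n * l) := by
  have hc3 : U₃.card = 3 := by
    rw [hU₃, Finset.card_insert_of_notMem h3.2.1, hU₂, Finset.card_insert_of_notMem h2.2.1, hU₁,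
      Finset.card_singleton]
  have h12 : r i₂ ≤ r i₁ := h1.2.2 _ h2.1 (by simp)
  have h23 : r i₃ ≤ r i₂ := h2.2.2 _ h3.1 fun h => h3.2.1 (by rw [hU₂]; simp [h])
  have hm3 : ∀ j < n + 2, j ∉ U₃ → r j ≤ r i₃ := fun j hj hjU =>
    h3.2.2 _ hj fun h => hjU (by rw [hU₃]; simp [h])
  have hmax : ∀ i ∈ U₃, ∀ j < n + 2, j ∉ U₃ → r j ≤ r i := by
    intro i hi j hj hjU
    have := hm3 j hj hjU
    rw [hU₃, hU₂, hU₁] at hi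
    simp only [Finset.mem_insert, Finset.mem_singleton] at hi
    rcases hi with rfl | rfl | rfl <;> omega
  have hi1 := hr i₁
  have hi2 := hr i₂
  obtain ⟨s₁, hs₁⟩ : ∃ s, s = r i₁ + 1 := ⟨_, rfl⟩
  obtain ⟨s₂, hs₂⟩ : ∃ s, s = r i₂ + 1 := ⟨_, rfl⟩
  obtain ⟨s₃, hs₃⟩ : ∃ s, s = r i₃ + 1 := ⟨_, rfl⟩
  rw [← hs₁] at hi1
  rw [← hs₂] at hi2
  rw [← hs₁, ← hs₂, ← hs₃] at hcase
  rw [← hs₂]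
  have hs12 : s₂ ≤ s₁ := by omega
  have hs23 : s₃ ≤ s₂ := by omega
  have hs30 : 1 ≤ s₃ := by omega
  have hq1 : (1 : ℝ) ≤ q := by exact_mod_cast (by omega : 1 ≤ q)
  have hl1 : (1 : ℝ) ≤ l := by exact_mod_cast hl
  set R : ℝ := (q : ℝ) ^ stepExp n * l with hR
  have hmono : ∀ x : ℝ, x ≤ stepExp n → (q : ℝ) ^ x * l ≤ R := fun x hx =>
    mul_le_mul_of_nonneg_right (Real.rpow_le_rpow_of_exponent_le hq1 hx) (by positivity)
  have hqR : (q : ℝ) ≤ R := by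
    have := hmono 1 (by unfold stepExp; split_ifs <;> norm_num)
    rw [Real.rpow_one] at this
    nlinarith
  have hQ : (q : ℝ) ^ 3 * L ≤ (q : ℝ) ^ 3 * l := mul_le_mul_of_nonneg_left hL (by positivity)
  have hQ0 : 0 < (q : ℝ) ^ 3 * L := by positivity
  have hll : ∀ {i j : ℕ}, i ≤ j → (l : ℝ) ^ i ≤ (l : ℝ) ^ j := fun h => pow_le_pow_right₀ hl1 h
  -- Taking fifth roots gives `q^(6/5)`, which `R` dominates only from `n = 3` on.
  have h65 : 3 ≤ n → ∀ y : ℝ, y ^ 5 ≤ ((q : ℝ) ^ 3 * L) ^ 2 → y ≤ R := by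
    intro hn y hy
    refine (le_rpow_mul_of_pow_le (q := q) (c := l) (j := 6) (k := 5) (by norm_num) (by positivity)
      (by positivity) ?_).trans (hmono _ ?_)
    · calc y ^ 5 ≤ ((q : ℝ) ^ 3 * L) ^ 2 := hy
        _ ≤ ((q : ℝ) ^ 3 * l) ^ 2 := pow_le_pow_left₀ hQ0.le hQ 2
        _ = (q : ℝ) ^ 6 * (l : ℝ) ^ 2 := by ring
        _ ≤ _ := mul_le_mul_of_nonneg_left (hll (by norm_num)) (by positivity)
    · unfold stepExp
      rw [if_neg (by omega)]
      split_ifs <;> norm_num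
  have hs2R : (s₂ : ℝ) ≤ R := (by exact_mod_cast hi2 : (s₂ : ℝ) ≤ q).trans hqR
  have hhs : (h : ℝ) * s₂ ≤ 2 * R := by
    have hR0 : 0 ≤ R := by positivity
    rcases Nat.lt_or_ge n 3 with hn | hn
    -- With at most two genuine terms the third selected one is a dummy or trivial, so the outer
    -- loop has a single round.
    · have hs3 : s₃ = 1 := by
        by_contra hne
        have hpos : 0 < r i₃ := by omega
        have hsub : U₃ ⊆ Finset.range n := by
          intro i hi
          by_contra hin
          have h0 := hr0 i (by simpa using hin)
          rw [hU₃, hU₂, hU₁] at hi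
          simp only [Finset.mem_insert, Finset.mem_singleton] at hi
          rcases hi with rfl | rfl | rfl <;> omega
        have := Finset.card_le_card hsub
        rw [hc3, Finset.card_range] at this
        omega
      have hh : (h : ℝ) ≤ 1 := by
        rcases hcase with ⟨-, hh, -⟩ | ⟨hh, -⟩ <;> exact_mod_cast (by omega : h ≤ 1)
      have : (0 : ℝ) ≤ s₂ := by positivity
      nlinarith
    · rcases hcase with ⟨-, -, hbig, hh⟩ | ⟨hh, hsmall, -⟩
      · have hy := h65 hn _ (div_pow_five_le hQ0 hs12 hs23 hs30 hbig)
        have h2 : (1 : ℝ) ≤ s₂ := by exact_mod_cast hs30.trans hs23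
        have h1 : (1 : ℝ) ≤ s₁ := by exact_mod_cast hs30.trans (hs23.trans hs12)
        have : (q : ℝ) ^ 3 * L / ((s₁ : ℝ) ^ 2 * s₂ ^ 2) * s₂ =
            (q : ℝ) ^ 3 * L / ((s₁ : ℝ) ^ 2 * s₂) := by field_simp
        have := mul_le_mul_of_nonneg_right hh (by positivity : (0 : ℝ) ≤ s₂)
        linarith
      · have h5 : ((s₂ : ℝ) * s₃) ^ 5 ≤ ((s₁ : ℝ) ^ 2 * s₂ ^ 2 * s₃) ^ 2 := by
          exact_mod_cast mul_pow_five_le hs12 hs23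
        have := h65 hn _ (h5.trans (pow_le_pow_left₀ (by positivity) hsmall 2))
        rw [hh]
        linarith
  have hY : (Y : ℝ) ≤ ((n : ℝ) + 2) * (3 * R) := by
    rcases hcase with ⟨rfl, -⟩ | ⟨-, hsmall, rfl⟩
    · push_cast; positivity
    have hk : ∀ k ∈ Finset.range (n + 2), (extendCost r q U₃ U₁ k : ℝ) ≤ 3 * R := by
      intro k hk
      have hkn := Finset.mem_range.1 hk
      unfold extendCost
      split_ifs with hkU
      · push_cast; positivity
      set M := ∏ i ∈ U₁ ∪ (Finset.range k).filter (· ∉ U₃), (r i + 1) with hM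
      have hmq : min q M ≤ q := min_le_left _ _
      have hmM : min q M ≤ M := min_le_right _ _
      have hsk : r k + 1 ≤ s₃ := by have := hm3 k hkn hkU; omega
      rcases Nat.eq_zero_or_pos (r k) with hrk | hrk
      · rw [hrk, zero_add, mul_one]
        have : ((q + min q M : ℕ) : ℝ) ≤ q + q := by exact_mod_cast (by omega)
        linarith
      obtain ⟨hn4, hz⟩ := three_lt_of_pos hr0 hc3 hmax hkU hrk
      obtain ⟨s, hs⟩ : ∃ s, s = r k + 1 := ⟨_, rfl⟩
      rw [← hs] at hsk ⊢
      rcases hn4.eq_or_lt with hn4 | hn5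
      -- For `n = 4` the index `k` is the only nontrivial one outside the top three, so before this
      -- extension the bound on the table size is still `s₁`.
      · have hM1 : M = s₁ := by
          rw [hM, hs₁]
          refine Finset.prod_eq_single i₁ (fun j hj hji => ?_) fun h => absurd (by simp [hU₁]) h
          simp only [hU₁, Finset.mem_union, Finset.mem_singleton, hji, false_or, Finset.mem_filter,
            Finset.mem_range] at hj
          simp [hz hn4.symm j hj.2 (by omega)]
        -- One factor `s₁` is bounded by `q`, the rest by `s₁² s₂² s₃`. The resulting exponent `4/3`
        -- lies below `10/7`.
        have h3 : ((s₁ : ℝ) * s) ^ 3 ≤ (q : ℝ) ^ 4 * (l : ℝ) ^ 3 := by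
          calc ((s₁ : ℝ) * s) ^ 3 = s₁ * ((s₁ : ℝ) ^ 2 * (s ^ 2 * s)) := by ring
            _ ≤ q * ((s₁ : ℝ) ^ 2 * (s₂ ^ 2 * s₃)) := by
                have := hsk.trans hs23
                gcongr
            _ ≤ q * ((q : ℝ) ^ 3 * l) := by
                rw [← mul_assoc ((s₁ : ℝ) ^ 2)]
                exact mul_le_mul_of_nonneg_left (hsmall.trans hQ) (by positivity)
            _ = (q : ℝ) ^ 4 * (l : ℝ) ^ 1 := by ring
            _ ≤ _ := mul_le_mul_of_nonneg_left (hll (by norm_num)) (by positivity)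
        have h4 := (le_rpow_mul_of_pow_le (by norm_num) (by positivity) (by positivity) h3).trans
          (hmono _ (by unfold stepExp; rw [if_neg (by omega), if_neg (by omega),
            if_pos hn4.symm]; norm_num))
        have h5 : ((q + min q M * s : ℕ) : ℝ) ≤ q + s₁ * s := by
          rw [hM1] at hmM ⊢
          exact_mod_cast Nat.add_le_add_left (Nat.mul_le_mul_right s hmM) q
        linarith
      -- For `n ≥ 5` the table may be full, so its size is bounded by `q`. The order `s` is at most
      -- each of the three largest, hence at most about `q^(3/5)`.
      · have h3 : (s : ℝ) ^ 5 ≤ (q : ℝ) ^ 3 * (l : ℝ) ^ 5 := by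
          calc (s : ℝ) ^ 5 = (s : ℝ) ^ 2 * s ^ 2 * s := by ring
            _ ≤ (s₁ : ℝ) ^ 2 * s₂ ^ 2 * s₃ := by
                have h := hsk.trans hs23
                have h' := h.trans hs12
                gcongr
            _ ≤ (q : ℝ) ^ 3 * (l : ℝ) ^ 1 := by rw [pow_one]; exact hsmall.trans hQ
            _ ≤ _ := mul_le_mul_of_nonneg_left (hll (by norm_num)) (by positivity)
        have h4 := le_rpow_mul_of_pow_le (by norm_num) (by positivity) (by positivity) h3
        have h5 : (q : ℝ) * s ≤ R := by
          calc (q : ℝ) * s ≤ (q : ℝ) ^ (1 : ℝ) * ((q : ℝ) ^ (((3 : ℕ) : ℝ) / (5 : ℕ)) * l) := by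
                rw [Real.rpow_one]
                exact mul_le_mul_of_nonneg_left h4 (by positivity)
            _ = (q : ℝ) ^ (8 / 5 : ℝ) * l := by
                rw [← mul_assoc, ← Real.rpow_add (by linarith)]; norm_num
            _ ≤ R := hmono _ (by unfold stepExp; rw [if_neg (by omega), if_neg (by omega),
                if_neg (by omega)])
        have h6 : ((q + min q M * s : ℕ) : ℝ) ≤ q + q * s := by
          exact_mod_cast Nat.add_le_add_left (Nat.mul_le_mul_right s hmq) q
        linarith
    rw [Nat.cast_sum]
    refine (Finset.sum_le_card_nsmul _ _ _ hk).trans_eq ?_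
    rw [Finset.card_range, nsmul_eq_mul]; push_cast; ring
  push_cast
  have hR0 : 0 ≤ R := by positivity
  have hn0 : (0 : ℝ) ≤ n := by positivity
  nlinarith

end

/-! ### Word length and logarithms -/

theorem word_bounds {q d n l : ℕ} (hq : q ≤ 2 ^ l) (hq0 : 1 ≤ q) (hd : d ≤ q) (hl : 1 ≤ l) :
    4 * q ^ (n + 2) < 2 ^ (6 * (n + 2) * l) ∧
      3 + (2 * n + 2) * d + 4 * (n + 2) + (n + 6) * q < 2 ^ (6 * (n + 2) * l) := by
  have hnl : n + 2 ≤ (n + 2) * l := Nat.le_mul_of_pos_right _ hl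
  have hll : l ≤ (n + 2) * l := Nat.le_mul_of_pos_left _ (by omega)
  have hw : 6 * (n + 2) * l = 6 * ((n + 2) * l) := by ring
  constructor
  · calc 4 * q ^ (n + 2) ≤ 2 ^ 2 * (2 ^ l) ^ (n + 2) := by gcongr; norm_num
      _ = 2 ^ (2 + (n + 2) * l) := by rw [← pow_mul, ← pow_add, mul_comm l]
      _ < _ := Nat.pow_lt_pow_right one_lt_two (by omega)
  · have h1 : 7 * n + 19 < 2 ^ (n + 5) := by
      induction n with
      | zero => norm_num
      | succ n ih =>
        have : n + 2 ≤ (n + 2) * l := Nat.le_mul_of_pos_right _ hl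
        have h2 := ih this (Nat.le_mul_of_pos_left _ (by omega)) (by ring)
        rw [show n + 1 + 5 = (n + 5) + 1 by ring, pow_succ]
        omega
    calc 3 + (2 * n + 2) * d + 4 * (n + 2) + (n + 6) * q
        ≤ 3 * q + (2 * n + 2) * q + (4 * (n + 2)) * q + (n + 6) * q := by
          have := Nat.le_mul_of_pos_right (4 * (n + 2)) hq0
          have := Nat.mul_le_mul_left (2 * n + 2) hd
          omega
      _ = (7 * n + 19) * q := by ring
      _ < 2 ^ (n + 5) * 2 ^ l := Nat.mul_lt_mul_of_lt_of_le h1 hq (by positivity)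
      _ = 2 ^ (n + 5 + l) := (pow_add _ _ _).symm
      _ ≤ _ := Nat.pow_le_pow_right two_pos (by omega)

/-- Rounding up costs one more `log 2 ≤ log q`, and `2 / log 2 < 3`. -/
theorem clog_le_three_mul_log {q : ℕ} (hq : 2 ≤ q) : (Nat.clog 2 q : ℝ) ≤ 3 * Real.log q := by
  have h1 := Nat.pow_pred_clog_lt_self one_lt_two hq
  have h2 : 1 ≤ Nat.clog 2 q := Nat.clog_pos one_lt_two hq
  have h3 : Real.log ((2 : ℝ) ^ (Nat.clog 2 q - 1)) ≤ Real.log q :=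
    Real.log_le_log (by positivity) (by exact_mod_cast h1.le)
  rw [Real.log_pow, Nat.cast_sub h2] at h3
  have h4 : Real.log 2 ≤ Real.log q := Real.log_le_log two_pos (by exact_mod_cast hq)
  have h5 := Real.log_two_gt_d9
  have h6 : (1 : ℝ) ≤ Nat.clog 2 q := by exact_mod_cast h2
  push_cast at h3
  nlinarith

theorem log_le_clog {q : ℕ} (hq : 2 ≤ q) : Real.log q ≤ Nat.clog 2 q := by
  have h1 : Real.log q ≤ Real.log ((2 : ℝ) ^ Nat.clog 2 q) :=
    Real.log_le_log (by positivity) (by exact_mod_cast Nat.le_pow_clog one_lt_two q)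
  rw [Real.log_pow] at h1
  have h2 := Real.log_two_lt_d9
  have h3 : (0 : ℝ) ≤ Nat.clog 2 q := by positivity
  nlinarith

/-- The fifth power of the logarithm consists of two factors from field arithmetic, two from the
cost of an instruction on words of length `6 (n + 2) l`, and one from `steps_le`. The powers of `n +
2` add up to 4. -/
theorem time_le {q d n l N V : ℕ} {K₀ : ℝ} (hn : 1 ≤ n) (hq : 2 ≤ q) (hd : d ≤ l) (hl : 1 ≤ l)
    (hl3 : (l : ℝ) ≤ 3 * Real.log q)
    (hK₀ : ((n : ℝ) + 2) ^ 6 * (q : ℝ) ^ stepExp n ≤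
      K₀ * (q : ℝ) ^ ((n : ℝ) * (n + 1) / (2 * (2 * n - 1))))
    (hN : N ≤ 2000 * ((n + 2) * (d + 1) ^ 2 * V))
    (hV : (V : ℝ) ≤ 5 * ((n : ℝ) + 2) * ((q : ℝ) ^ stepExp n * l)) :
    ((N * (1 + 6 * (n + 2) * l) ^ 2 : ℕ) : ℝ) ≤
      (10 ^ 9 * K₀) * (q : ℝ) ^ ((n : ℝ) * (n + 1) / (2 * (2 * n - 1))) * Real.log q ^ 5 := by
  have h1 : N * (1 + 6 * (n + 2) * l) ^ 2 ≤ 392000 * ((n + 2) ^ 3 * l ^ 4 * V) :=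
    calc N * (1 + 6 * (n + 2) * l) ^ 2
        ≤ 2000 * ((n + 2) * (2 * l) ^ 2 * V) * (7 * (n + 2) * l) ^ 2 := by
          have : 1 + 6 * (n + 2) * l ≤ 7 * (n + 2) * l := by nlinarith
          refine Nat.mul_le_mul (hN.trans ?_) (Nat.pow_le_pow_left this 2)
          have : d + 1 ≤ 2 * l := by omega
          gcongr
      _ = _ := by ring
  have hl1 : (1 : ℝ) ≤ l := by exact_mod_cast hl
  set e := (n : ℝ) * (n + 1) / (2 * (2 * n - 1))
  have hn1 : (1 : ℝ) ≤ (n : ℝ) + 2 := by linarith [(Nat.cast_nonneg n : (0 : ℝ) ≤ n)]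
  have hA : 0 ≤ K₀ * (q : ℝ) ^ e := le_trans (by positivity) hK₀
  calc ((N * (1 + 6 * (n + 2) * l) ^ 2 : ℕ) : ℝ)
      ≤ 392000 * (((n : ℝ) + 2) ^ 3 * (l : ℝ) ^ 4 * V) := by exact_mod_cast h1
    _ ≤ 392000 * (((n : ℝ) + 2) ^ 3 * (l : ℝ) ^ 4 *
          (5 * ((n : ℝ) + 2) * ((q : ℝ) ^ stepExp n * l))) := by gcongr
    _ = 1960000 * ((((n : ℝ) + 2) ^ 4 * (q : ℝ) ^ stepExp n) * (l : ℝ) ^ 5) := by ring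
    _ ≤ 1960000 * ((((n : ℝ) + 2) ^ 6 * (q : ℝ) ^ stepExp n) * (l : ℝ) ^ 5) := by
        have := pow_le_pow_right₀ hn1 (by norm_num : 4 ≤ 6)
        gcongr
    _ ≤ 1960000 * ((K₀ * (q : ℝ) ^ e) * (3 * Real.log q) ^ 5) := by gcongr
    _ = 476280000 * ((K₀ * (q : ℝ) ^ e) * Real.log q ^ 5) := by ring
    _ ≤ 10 ^ 9 * ((K₀ * (q : ℝ) ^ e) * Real.log q ^ 5) := by
        have : 0 ≤ Real.log q := by linarith
        have : 0 ≤ (K₀ * (q : ℝ) ^ e) * Real.log q ^ 5 := by positivity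
        nlinarith
    _ = _ := by ring

/-! ### The exceptional right-hand sides -/

section

variable {p : ℕ} [hp : Fact p.Prime] {F : Type*} [Field F] [Algebra (ZMod p) F] {n : ℕ}

theorem ords_of_le (g : Fin n → Fˣ) {i : ℕ} (hi : n ≤ i) : ords g i = 0 := by
  simp [ords, hi]

variable [Fintype F]

theorem ords_add_one (g : Fin n → Fˣ) {i : ℕ} (hi : i < n) :
    ords g i + 1 = orderOf (g ⟨i, hi⟩) := by
  have := orderOf_pos (g ⟨i, hi⟩)
  simp only [ords, hi, dif_pos]
  omega

theorem extend₀_mul_pow_injOn (a g : Fin n → Fˣ) (i : ℕ) {h : ℕ} (hh : h ≤ ords g i + 1) :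
    Set.InjOn (fun x => extend₀ a i * extend₀ g i ^ x) (Finset.range h) := by
  intro x hx y hy hxy
  simp only [Finset.coe_range, Set.mem_Iio] at hx hy
  by_cases hi : i < n
  · rw [ords_add_one g hi] at hh
    simp only [extend₀, hi, dif_pos] at hxy
    have h' : g ⟨i, hi⟩ ^ x = g ⟨i, hi⟩ ^ y := by
      ext; simpa using hxy
    exact pow_injOn_Iio_orderOf (Set.mem_Iio.2 (by omega)) (Set.mem_Iio.2 (by omega)) h'
  · rw [ords_of_le g (by omega)] at hh
    omega

/-- `card_missed_le` is applied to two full cosets and the first `h` values of the third term.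
Nothing is required of the third index: for a dummy term the third set has at most one element. -/
theorem ncard_missed_le {i₁ i₂ i₃ h : ℕ} (a g : Fin n → Fˣ) (c : F) {L : ℝ} (hL : 0 < L)
    (hi₁ : i₁ < n) (hi₂ : i₂ < n) (hh : h ≤ ords g i₃ + 1)
    (hbig : (Fintype.card F : ℝ) ^ 3 * L ≤
      ((ords g i₁ + 1 : ℕ) : ℝ) ^ 2 * ((ords g i₂ + 1 : ℕ) : ℝ) ^ 2 * h) :
    ({b : F | ¬ ∃ x < h, x < ords g i₃ + 1 ∧ ∃ x' < ords g i₂ + 1, ∃ x'' < ords g i₁ + 1,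
        b - c = extend₀ a i₁ * extend₀ g i₁ ^ x'' + extend₀ a i₂ * extend₀ g i₂ ^ x' +
            extend₀ a i₃ * extend₀ g i₃ ^ x}.ncard : ℝ) ≤ Fintype.card F / L := by
  classical
  set S := {b : F | ¬ ∃ x < h, x < ords g i₃ + 1 ∧ ∃ x' < ords g i₂ + 1, ∃ x'' < ords g i₁ + 1,
        b - c = extend₀ a i₁ * extend₀ g i₁ ^ x'' + extend₀ a i₂ * extend₀ g i₂ ^ x' +
            extend₀ a i₃ * extend₀ g i₃ ^ x} with hS
  have h1 := card_missed_le (g ⟨i₁, hi₁⟩) (g ⟨i₂, hi₂⟩) (a ⟨i₁, hi₁⟩).ne_zero (a ⟨i₂, hi₂⟩).ne_zero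
    ((Finset.range h).image fun x => extend₀ a i₃ * extend₀ g i₃ ^ x)
    (S.toFinset.image fun b => b - c) (by
      intro e he x hx y hy z hz heq
      obtain ⟨b, hb, rfl⟩ := Finset.mem_image.1 he
      obtain ⟨k, hk, rfl⟩ := Finset.mem_image.1 hz
      rw [Set.mem_toFinset] at hb
      have hk := Finset.mem_range.1 hk
      refine hb ⟨k, hk, by omega, y, by rwa [ords_add_one g hi₂], x, by rwa [ords_add_one g hi₁], ?_⟩
      rw [heq]
      simp [extend₀, hi₁, hi₂])
  rw [Finset.card_image_of_injective _ (sub_left_injective), Finset.card_image_of_injOn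
    (extend₀_mul_pow_injOn a g i₃ hh), Finset.card_range, ← Set.ncard_eq_toFinset_card',
    ← ords_add_one g hi₁, ← ords_add_one g hi₂] at h1
  have h2 : ((ords g i₁ + 1 : ℕ) : ℝ) ^ 2 * ((ords g i₂ + 1 : ℕ) : ℝ) ^ 2 * h * S.ncard ≤
      (Fintype.card F : ℝ) ^ 4 := by exact_mod_cast h1
  have hq : (0 : ℝ) < Fintype.card F := by exact_mod_cast Fintype.card_pos
  rw [le_div_iff₀ hL]
  have h3 := (mul_le_mul_of_nonneg_right hbig (Nat.cast_nonneg S.ncard)).trans h2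
  have h4 : (Fintype.card F : ℝ) ^ 3 * (S.ncard * L) ≤ (Fintype.card F : ℝ) ^ 3 * Fintype.card F := by
    linarith
  exact le_of_mul_le_mul_left h4 (by positivity)

theorem ncard_not_solvesWithin_le {K₀ : ℝ} (B : PowerBasis (ZMod p) F) (hn : 1 ≤ n)
    (a g : Fin n → Fˣ)
    (hK₀ : ((n : ℝ) + 2) ^ 6 * (Fintype.card F : ℝ) ^ stepExp n ≤
      K₀ * (Fintype.card F : ℝ) ^ ((n : ℝ) * (n + 1) / (2 * (2 * n - 1)))) :
    ({b : F | ¬ SolvesWithin main B a g b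
        ((10 ^ 9 * K₀) * (Fintype.card F : ℝ) ^ ((n : ℝ) * (n + 1) / (2 * (2 * n - 1)))
          * Real.log (Fintype.card F) ^ 5)}.ncard : ℝ)
      ≤ Fintype.card F / Real.log (Fintype.card F) := by
  classical
  obtain ⟨T, hT⟩ : ∃ T, T = (10 ^ 9 * K₀) * (Fintype.card F : ℝ) ^
    ((n : ℝ) * (n + 1) / (2 * (2 * n - 1))) * Real.log (Fintype.card F) ^ 5 := ⟨_, rfl⟩
  rw [← hT]
  have hq : 2 ≤ Fintype.card F := Fintype.one_lt_card
  have hqd := card_eq_pow_dim B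
  set q := Fintype.card F with hqdef
  set l := Nat.clog 2 q with hldef
  have hl : 1 ≤ l := Nat.clog_pos one_lt_two hq
  have hL0 : 0 < Real.log q := Real.log_pos (by exact_mod_cast hq)
  have hdl : B.dim ≤ l := by
    have h1 : 2 ^ B.dim ≤ 2 ^ l := (Nat.pow_le_pow_left hp.out.two_le _).trans
      (hqd.symm.le.trans (Nat.le_pow_clog one_lt_two q))
    exact (Nat.pow_le_pow_iff_right one_lt_two).1 h1
  have hdq : B.dim ≤ q := by
    rw [hqd]; exact (Nat.lt_pow_self hp.out.one_lt).le
  obtain ⟨hw, hDw⟩ := word_bounds (n := n) (Nat.le_pow_clog one_lt_two q) (by omega) hdq hl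
  rw [← hldef] at hw hDw
  obtain ⟨i₁, hi₁⟩ : ∃ i, i = sel (ords g) (n + 2) ∅ := ⟨_, rfl⟩
  obtain ⟨U₁, hU₁⟩ : ∃ U : Finset ℕ, U = {i₁} := ⟨_, rfl⟩
  obtain ⟨i₂, hi₂⟩ : ∃ i, i = sel (ords g) (n + 2) U₁ := ⟨_, rfl⟩
  obtain ⟨U₂, hU₂⟩ : ∃ U : Finset ℕ, U = insert i₂ U₁ := ⟨_, rfl⟩
  obtain ⟨i₃, hi₃⟩ : ∃ i, i = sel (ords g) (n + 2) U₂ := ⟨_, rfl⟩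
  obtain ⟨U₃, hU₃⟩ : ∃ U : Finset ℕ, U = insert i₃ U₂ := ⟨_, rfl⟩
  have h1 := sel_spec (r := ords g) (m := n + 2) (U := ∅) (by simp)
  have h2 := sel_spec (r := ords g) (m := n + 2) (U := U₁) (by simp [hU₁])
  rw [← hi₁] at h1
  rw [← hi₂] at h2
  have h3 := sel_spec (r := ords g) (m := n + 2) (U := U₂) (by
    rw [hU₂, Finset.card_insert_of_notMem h2.2.1, hU₁, Finset.card_singleton]; omega)
  rw [← hi₃] at h3
  have hsolve := fun (b : F) (h Y : ℕ) (hcase : (Y = 0 ∧ h ≤ ords g i₃ + 1 ∧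
      (q : ℝ) ^ 3 * Real.log q ≤ ((ords g i₁ + 1 : ℕ) : ℝ) ^ 2 * ((ords g i₂ + 1 : ℕ) : ℝ) ^ 2 *
        (ords g i₃ + 1 : ℕ) ∧
      (h : ℝ) ≤ (q : ℝ) ^ 3 * Real.log q /
        (((ords g i₁ + 1 : ℕ) : ℝ) ^ 2 * ((ords g i₂ + 1 : ℕ) : ℝ) ^ 2) + 1) ∨
      (h = ords g i₃ + 1 ∧ ((ords g i₁ + 1 : ℕ) : ℝ) ^ 2 * ((ords g i₂ + 1 : ℕ) : ℝ) ^ 2 *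
        (ords g i₃ + 1 : ℕ) ≤ (q : ℝ) ^ 3 * Real.log q ∧
        Y = ∑ k ∈ Finset.range (n + 2), extendCost (ords g) q U₃ U₁ k)) hX =>
    solvesWithin_main (B := B) (b := b) (a := a) (g := g) (w := 6 * (n + 2) * l) (h := h)
      (X := 15 * (n + 2) + 4 + 100 * (B.dim + 1) ^ 2 * (Y + (2 * (h * (ords g i₂ + 1)) + 1)))
      (T := T) hn (by rwa [← hqd]) (by rwa [← hqd]) hi₁ hU₁ hi₂ hU₂ hi₃ hU₃ hX
      (by
        rw [hT]
        rw [← hqd]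
        exact time_le hn hq hdl hl (clog_le_three_mul_log hq) hK₀
          (readCost_add_solveCost_le (by omega) rfl)
          (steps_le hq (fun i => by rw [hqd]; exact ords_lt B g i) (fun i hi => ords_of_le g hi)
            hL0 (log_le_clog hq) hl hU₁ hU₂ hU₃ h1 h2 h3 hcase))
  have h12 : ords g i₂ ≤ ords g i₁ := h1.2.2 _ h2.1 (by simp)
  have h23 : ords g i₃ ≤ ords g i₂ := h2.2.2 _ h3.1 fun h => h3.2.1 (by rw [hU₂]; simp [h])
  have hq0 : (0 : ℝ) < q := by exact_mod_cast (by omega : 0 < q)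
  rcases le_total ((q : ℝ) ^ 3 * Real.log q) (((ords g i₁ + 1 : ℕ) : ℝ) ^ 2 *
    ((ords g i₂ + 1 : ℕ) : ℝ) ^ 2 * (ords g i₃ + 1 : ℕ)) with hbig | hsmall
  · have hpos : (0 : ℝ) < ((ords g i₁ + 1 : ℕ) : ℝ) ^ 2 * ((ords g i₂ + 1 : ℕ) : ℝ) ^ 2 := by
      positivity
    -- The least number of outer rounds for which the character sum bound leaves at most `q / log q`
    -- exceptions; `hbig` says that it does not exceed `s₃`.
    obtain ⟨h, hh⟩ : ∃ h, h = ⌈(q : ℝ) ^ 3 * Real.log q /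
      (((ords g i₁ + 1 : ℕ) : ℝ) ^ 2 * ((ords g i₂ + 1 : ℕ) : ℝ) ^ 2)⌉₊ := ⟨_, rfl⟩
    have hh3 : h ≤ ords g i₃ + 1 := by
      rw [hh, Nat.ceil_le, div_le_iff₀ hpos]
      linarith
    have hh1 : (h : ℝ) ≤ (q : ℝ) ^ 3 * Real.log q /
        (((ords g i₁ + 1 : ℕ) : ℝ) ^ 2 * ((ords g i₂ + 1 : ℕ) : ℝ) ^ 2) + 1 := by
      rw [hh]; exact (Nat.ceil_lt_add_one (by positivity)).le
    have hh2 : (q : ℝ) ^ 3 * Real.log q ≤ ((ords g i₁ + 1 : ℕ) : ℝ) ^ 2 *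
        ((ords g i₂ + 1 : ℕ) : ℝ) ^ 2 * h := by
      rw [mul_comm _ (h : ℝ), ← div_le_iff₀ hpos, hh]
      exact Nat.le_ceil _
    -- The character sum estimate needs two genuine terms. If the second order were 1, `hbig` would
    -- read `q³ log q ≤ s₁² ≤ q²`, which is impossible as `q log q > 1`.
    have hpos₂ : 0 < ords g i₂ := by
      by_contra hne
      have e2 : ords g i₂ = 0 := by omega
      have e3 : ords g i₃ = 0 := by omega
      have hs1 : ((ords g i₁ + 1 : ℕ) : ℝ) ≤ q := by
        rw [hqd]; exact_mod_cast ords_lt B g i₁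
      rw [e2, e3] at hbig
      have h4 : (q : ℝ) ^ 3 * Real.log q ≤ (q : ℝ) ^ 2 := by
        refine hbig.trans ?_
        simpa using pow_le_pow_left₀ (by positivity) hs1 2
      have h5 : Real.log 2 ≤ Real.log q := Real.log_le_log two_pos (by exact_mod_cast hq)
      have h6 := Real.log_two_gt_d9
      have h7 : (2 : ℝ) ≤ q := by exact_mod_cast hq
      have h8 : (q : ℝ) ^ 2 * (q * Real.log q) ≤ (q : ℝ) ^ 2 * 1 := by linarith
      have h9 := le_of_mul_le_mul_left h8 (by positivity)
      nlinarith
    have hlt : ∀ i, 0 < ords g i → i < n := fun i hi => by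
      by_contra hni
      rw [ords_of_le g (by omega)] at hi
      exact absurd hi (lt_irrefl _)
    refine le_trans ?_ (ncard_missed_le a g
      (∑ i ∈ (Finset.range (n + 2)).filter (· ∉ U₃), extend₀ a i) hL0 (hlt i₁ (by omega))
      (hlt i₂ hpos₂) hh3 hh2)
    refine Nat.cast_le.2 (Set.ncard_le_ncard (fun b hb hex => hb ?_) (Set.toFinite _))
    -- The fallback is not reached, so no extension cost is charged.
    exact hsolve b h 0 (.inl ⟨rfl, hh3, hbig, hh1⟩) (.inr hex)
  -- For small orders even the exhaustive procedure meets the time bound, so no `b` is exceptional.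
  · have hempty : {b : F | ¬ SolvesWithin main B a g b T} = ∅ := by
      refine Set.eq_empty_iff_forall_notMem.2 fun b hb => hb ?_
      refine hsolve b (ords g i₃ + 1) _ (.inr ⟨rfl, hsmall, rfl⟩) (.inl ⟨le_rfl, ?_⟩)
      rw [hqd]
    rw [hempty, Set.ncard_empty, Nat.cast_zero]
    positivity

end

end ExpZeros

theorem theorem1 :
    ∃ (P : ExpZeros.Prog) (K : ℝ) (C : ℕ),
      ∀ (p : ℕ) [Fact p.Prime] (F : Type*) [Field F] [Fintype F] [Algebra (ZMod p) F]
        (B : PowerBasis (ZMod p) F) (n : ℕ), 1 ≤ n → ∀ (a g : Fin n → Fˣ),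
        ({b : F | ¬ ExpZeros.SolvesWithin P B a g b
            (K * (Fintype.card F : ℝ) ^ ((n : ℝ) * (n + 1) / (2 * (2 * n - 1)))
              * Real.log (Fintype.card F) ^ C)}.ncard : ℝ)
          ≤ Fintype.card F / Real.log (Fintype.card F) := by
  obtain ⟨K₀, -, hK₀⟩ := ExpZeros.exists_pow_mul_rpow_stepExp_le
  refine ⟨ExpZeros.main, 10 ^ 9 * K₀, 5, fun p _ F _ _ _ B n hn a g => ?_⟩
  exact ExpZeros.ncard_not_solvesWithin_le B hn a g
    (hK₀ n _ hn (by exact_mod_cast Fintype.one_lt_card))
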